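/- **Setting.** Let $d,K\ge 1$. A $K$-class linear classifier on $\mathbb R^d$ is a function $f(x)=\arg\max_{i\in[K]}(w^{(i)}\cdot x+t_i)$ with $w^{(i)}\in\mathbb R^d$, $t_i\in\mathbb R$ (ties are resolved by the smallest index); $\mathcal L_{d,K}$ is the class of all of them. For a distribution $D$ on $\mathbb R^d\times[K]$ let $\mathrm{OPT}=\inf_{f\in\mathcal L_{d,K}}\Pr_{(x,y)\sim D}[f(x)\ne y]$. **Partitions.** Let $L=(v^{(1)},\dots,v^{(k)})$ be an orthonormal list with span $V$, $\epsilon'\in(0,1)$ and $\tau\in(0,\epsilon'/2)$. The $\epsilon'$-approximating partition with respect to $V$ with basis $L$ and offset $\tau$ consists of the cells $S_j=\{x: z_{j_i}\le v^{(i)}\cdot x\le z_{j_i+1},\ 1\le i\le k\}$, $j\in\{0,\dots,M-1\}^k$, where $z_i=-\sqrt{2\log(k/\epsilon')}+i\epsilon'+\tau$ and $M=\lceil 2\sqrt{2\log(k/\epsilon')}/\epsilon'\rceil$. (A point of several cells is assigned to the one that has, in each coordinate, the smallest index; for $k=0$ the only cell is $\mathbb R^d$.) **The algorithm.** It has parameters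 $T,N,\epsilon',\sigma,\tau$ and works as follows. Start with the empty list $L_1$. For $t=1,\dots,T$: draw $N$ i.i.d. examples from $D$, with empirical distribution $\widehat D$; take the $\epsilon'$-approximating partition $\mathcal S$ with respect to $V_t=\mathrm{span}(L_t)$ with basis $L_t$ and offset $\tau$; for $S\in\mathcal S$ and $i\in[K]$ let $\widehat u^{(S,i)}=\mathbf E_{(x,y)\sim\widehat D}[x\,\mathbf 1(y=i)\mid x\in S]$, let $p^{(S,i)}$ be its projection onto $V_t^\perp$, and compute the matrix $\widehat U=\sum_{S\in\mathcal S,\,i\in[K]}\Pr_{\widehat D}[S]\;p^{(S,i)}(p^{(S,i)})^\top$ (cells that contain no example are skipped); compute an orthonormal basis of eigenvectors of $\widehat U$, and obtain $L_{t+1}$ by adding to $L_t$ those of them whose eigenvalue is at least $\sigma$. Finally take the $\epsilon'$-approximating partition with respect to $\mathrm{span}(L_{T+1})$ with basis $L_{T+1}$ and offset $\tau$, draw $N$ further i.i.d. examples, and return the hypothesis $h$ that is constant on each cell, with a label that appears most often among the new examples in the cell, the smallest one in case of a tie (outside of the cells $h$ takes a fixed label). The eigenvectors are supplied by an arbitrary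 exact eigensolver whose output depends measurably on the matrix. The algorithm works with exact real numbers. Its running time is the number of arithmetic operations, square roots, logarithms and comparisons of real numbers plus the number of loop iterations and of steps for handling indices; rounding up to an integer $m\ge 0$ costs $m+1$ steps, and the eigendecomposition of a symmetric $n\times n$ matrix costs $n^3+1$ steps. **Theorem.** There are a universal constant $C>0$ and positive integers $a,b,s,c,A$ such that the following holds for all $d,K\ge1$, all $\epsilon,\delta\in(0,1)$ and every distribution $D$ on $\mathbb R^d\times[K]$ whose $x$-marginal is $\mathcal N(0,I)$. Run the algorithm with the parameters $$T=\lceil a(K/\epsilon)^a\rceil,\qquad \epsilon'=\frac1{b(K/\epsilon)^b},\qquad \sigma=\frac1{s(K/\epsilon)^s},\qquad N=\lceil d\,2^{T^c}\log(2/\delta)\rceil ,$$ any $\tau\in(0,\epsilon'/2)$ and any such eigensolver. Then 1. the total number $N_{\mathrm{tot}}=(T+1)N$ of i.i.d. examples drawn from $D$ satisfies $N_{\mathrm{tot}}\le d\,2^{A(K/\epsilon)^A}\log(2/\delta)$; 2. on all possible examples the running time is at most $A\,N_{\mathrm{tot}}^A$; 3. with probability at least $1-\delta$ over the examples, the hypothesis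 $h$ that is returned satisfies $\Pr_{(x,y)\sim D}[h(x)\ne y]\le C\cdot\mathrm{OPT}+\epsilon$. -/

import Mathlib

open MeasureTheory ProbabilityTheory

namespace MulticlassLearning

/-! ### Multiclass linear classifiers, 0-1 error and the optimal error -/

/-- The class of `K`-class linear classifiers on `ℝ^d`: the functions
`x ↦ argmax_i (w i ⬝ x + t i)`, ties being resolved by the smallest index. -/
def linearClassifiers (d K : ℕ) : Set ((Fin d → ℝ) → Fin K) :=
  {f | ∃ (w : Fin K → Fin d → ℝ) (t : Fin K → ℝ),
    ∀ x, IsLeast {i | ∀ j, w j ⬝ᵥ x + t j ≤ w i ⬝ᵥ x + t i} (f x)}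

/-- The 0-1 error `Pr_{(x,y) ∼ D}[h x ≠ y]`. -/
noncomputable def err {d K : ℕ} (D : Measure ((Fin d → ℝ) × Fin K))
    (h : (Fin d → ℝ) → Fin K) : ℝ :=
  D.real {p | h p.1 ≠ p.2}

/-- `OPT`, the infimum of the 0-1 error over all linear classifiers. -/
noncomputable def opt {d K : ℕ} (D : Measure ((Fin d → ℝ) × Fin K)) : ℝ :=
  sInf (err D '' linearClassifiers d K)

/-- The standard normal distribution `N(0, I)` on `ℝ^d`. -/
noncomputable def stdNormal (d : ℕ) : Measure (Fin d → ℝ) :=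
  Measure.pi fun _ => gaussianReal 0 1

/-! ### Programs over the reals and their running time -/

/-- Programs over a type `R` of real numbers with result in `α`. Programs are written for an
arbitrary type `R`, so that the only way in which they can act on numbers is through the
instructions below. -/
inductive Prog (R : Type) (α : Type) : Type where
  /-- stop and return a value -/
  | ret (a : α) : Prog R α
  /-- spend `n` steps on manipulating indices -/
  | charge (n : ℕ) (next : Prog R α) : Prog R α
  /-- write down a rational constant -/
  | const (q : ℚ) (next : R → Prog R α) : Prog R α
  | add (x y : R) (next : R → Prog R α) : Prog R α
  | sub (x y : R) (next : R → Prog R α) : Prog R α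
  | mul (x y : R) (next : R → Prog R α) : Prog R α
  | div (x y : R) (next : R → Prog R α) : Prog R α
  | sqrt (x : R) (next : R → Prog R α) : Prog R α
  | log (x : R) (next : R → Prog R α) : Prog R α
  /-- decide whether `x < y` -/
  | lt (x y : R) (next : Bool → Prog R α) : Prog R α
  /-- round up to a natural number -/
  | ceil (x : R) (next : ℕ → Prog R α) : Prog R α
  /-- compute the eigenvalues and an orthonormal basis of eigenvectors of a symmetric matrix -/
  | eigh (n : ℕ) (M : Fin n → Fin n → R) (next : (Fin n → R × (Fin n → R)) → Prog R α) : Prog R α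

/-- An exact eigensolver: for each symmetric `n × n` matrix it returns an orthonormal basis of
eigenvectors together with their eigenvalues, depending measurably on the matrix. -/
structure EigenSolver where
  solve : (n : ℕ) → (Fin n → Fin n → ℝ) → Fin n → ℝ × (Fin n → ℝ)
  measurable_solve : ∀ n, Measurable (solve n)
  orthonormal : ∀ n M, (∀ i j, M i j = M j i) →
    ∀ i j, (solve n M i).2 ⬝ᵥ (solve n M j).2 = if i = j then 1 else 0
  eigenvector : ∀ n M, (∀ i j, M i j = M j i) →
    ∀ i, Matrix.mulVec (Matrix.of M) (solve n M i).2 = (solve n M i).1 • (solve n M i).2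

/-- A closed relation with nonempty fibres in a compact metric space has a measurable selection. -/
theorem exists_measurable_selection {X Y : Type} [MetricSpace X] [CompactSpace X] [Nonempty X]
    [MeasurableSpace X] [BorelSpace X] [TopologicalSpace Y] [MeasurableSpace Y] [BorelSpace Y]
    (F : Set (Y × X)) (hF : IsClosed F) (hne : ∀ y, ∃ x, (y, x) ∈ F) :
    ∃ f : Y → X, Measurable f ∧ ∀ y, (y, f y) ∈ F := by
  obtain ⟨g0, hg0, hs0⟩ := exists_nat_bool_continuous_surjective_of_compact X
  let g : cantorSet → X := fun c => g0 (cantorSetHomeomorphNatToBool c)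
  have hg : Continuous g := hg0.comp cantorSetHomeomorphNatToBool.continuous
  have hs : Function.Surjective g := hs0.comp cantorSetHomeomorphNatToBool.surjective
  have : CompactSpace cantorSet := isCompact_iff_compactSpace.mp isCompact_cantorSet
  have hleast : ∀ y, ∃ c, IsLeast {c : cantorSet | (y, g c) ∈ F} c := by
    intro y
    have hcl : IsClosed {c : cantorSet | (y, g c) ∈ F} :=
      hF.preimage (continuous_const.prodMk hg)
    refine hcl.isCompact.exists_isLeast ?_
    obtain ⟨x, hx⟩ := hne y
    obtain ⟨c, rfl⟩ := hs x
    exact ⟨c, hx⟩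
  choose m hm using hleast
  have hmeas : Measurable fun y => ((m y : cantorSet) : ℝ) := by
    refine measurable_of_Iic fun t => ?_
    have : (fun y => ((m y : cantorSet) : ℝ)) ⁻¹' Set.Iic t =
        Prod.fst '' {p : Y × cantorSet | (p.1, g p.2) ∈ F ∧ (p.2 : ℝ) ≤ t} := by
      ext y
      constructor
      · intro hy
        exact ⟨(y, m y), ⟨(hm y).1, hy⟩, rfl⟩
      · rintro ⟨⟨y', c⟩, ⟨h1, h2⟩, rfl⟩
        exact le_trans (Subtype.coe_le_coe.mpr ((hm y').2 h1)) h2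
    rw [this]
    refine (isClosedMap_fst_of_compactSpace _ ?_).measurableSet
    have h1 : IsClosed {p : Y × cantorSet | (p.1, g p.2) ∈ F} :=
      hF.preimage (continuous_fst.prodMk (hg.comp continuous_snd))
    have h2 : IsClosed {p : Y × cantorSet | (p.2 : ℝ) ≤ t} :=
      isClosed_le (continuous_subtype_val.comp continuous_snd) continuous_const
    exact h1.inter h2
  have hm' : Measurable m := by
    have := hmeas.subtype_mk (h := fun y => (m y).2)
    simpa using this
  exact ⟨fun y => g (m y), hg.measurable.comp hm', fun y => (hm y).1⟩

/-- Eigensolvers exist. -/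
theorem EigenSolver.nonempty : Nonempty EigenSolver := by
  have key : ∀ n : ℕ, ∃ f : (Fin n → Fin n → ℝ) → (Fin n → Fin n → ℝ), Measurable f ∧
      ∀ M, (∀ i j, M i j = M j i) →
        (∀ i j, f M i ⬝ᵥ f M j = if i = j then 1 else 0) ∧
        ∀ i, Matrix.mulVec (Matrix.of M) (f M i) =
          (f M i ⬝ᵥ Matrix.mulVec (Matrix.of M) (f M i)) • f M i := by
    intro n
    let X := Fin n → Fin n → Set.Icc (-1 : ℝ) 1
    let sy : (Fin n → Fin n → ℝ) → Matrix (Fin n) (Fin n) ℝ :=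
      fun M => Matrix.of fun i j => (M i j + M j i) / 2
    let vec : X → Fin n → Fin n → ℝ := fun V i j => V i j
    let F : Set ((Fin n → Fin n → ℝ) × X) :=
      {p | (∀ i j, vec p.2 i ⬝ᵥ vec p.2 j = if i = j then 1 else 0) ∧
        ∀ i, Matrix.mulVec (sy p.1) (vec p.2 i) =
          (vec p.2 i ⬝ᵥ Matrix.mulVec (sy p.1) (vec p.2 i)) • vec p.2 i}
    have hvec : Continuous vec := by fun_prop
    have hsy : Continuous sy := by
      refine continuous_pi fun i => continuous_pi fun j => ?_
      simp only [sy, Matrix.of_apply]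
      fun_prop
    have hv2 : ∀ i, Continuous fun p : (Fin n → Fin n → ℝ) × X => vec p.2 i :=
      fun i => (continuous_apply i).comp (hvec.comp continuous_snd)
    have hmv : ∀ i, Continuous fun p : (Fin n → Fin n → ℝ) × X =>
        Matrix.mulVec (sy p.1) (vec p.2 i) :=
      fun i => (hsy.comp continuous_fst).matrix_mulVec (hv2 i)
    have hF : IsClosed F := by
      simp only [F, Set.ofPred_and, Set.ofPred_forall]
      refine IsClosed.inter (isClosed_iInter fun i => isClosed_iInter fun j => ?_)
        (isClosed_iInter fun i => ?_)
      · exact isClosed_eq ((hv2 i).dotProduct (hv2 j)) continuous_const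
      · exact isClosed_eq (hmv i) (((hv2 i).dotProduct (hmv i)).smul (hv2 i))
    have hne : ∀ M, ∃ V, (M, V) ∈ F := by
      intro M
      have hH : (sy M).IsHermitian := by
        ext i j
        simp [sy, add_comm]
      have ho : ∀ i j, (hH.eigenvectorBasis i).ofLp ⬝ᵥ (hH.eigenvectorBasis j).ofLp =
          if i = j then 1 else 0 := by
        intro i j
        have h := orthonormal_iff_ite.mp hH.eigenvectorBasis.orthonormal i j
        rw [← h, dotProduct_comm]
        simp [PiLp.inner_apply, dotProduct]
      have he : ∀ i, Matrix.mulVec (sy M) (hH.eigenvectorBasis i).ofLp =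
          hH.eigenvalues i • (hH.eigenvectorBasis i).ofLp := fun i => hH.mulVec_eigenvectorBasis i
      have hb : ∀ i j, (hH.eigenvectorBasis i).ofLp j ∈ Set.Icc (-1 : ℝ) 1 := by
        intro i j
        have h1 := ho i i
        simp only [if_true, dotProduct] at h1
        have h2 := Finset.single_le_sum
          (f := fun l => (hH.eigenvectorBasis i).ofLp l * (hH.eigenvectorBasis i).ofLp l)
          (fun l _ => mul_self_nonneg _) (Finset.mem_univ j)
        rw [h1] at h2
        exact abs_le.mp (abs_le_one_iff_mul_self_le_one.mpr h2)
      refine ⟨fun i j => ⟨_, hb i j⟩, ?_, ?_⟩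
      · intro i j
        exact ho i j
      · intro i
        change Matrix.mulVec (sy M) (hH.eigenvectorBasis i).ofLp =
          ((hH.eigenvectorBasis i).ofLp ⬝ᵥ
            Matrix.mulVec (sy M) (hH.eigenvectorBasis i).ofLp) • (hH.eigenvectorBasis i).ofLp
        rw [he i, dotProduct_smul, ho i i]
        simp
    have : Nonempty X := ⟨(hne 0).choose⟩
    obtain ⟨f, hf, hfF⟩ := exists_measurable_selection F hF hne
    refine ⟨fun M => vec (f M), hvec.measurable.comp hf, fun M hM => ?_⟩
    have hsM : sy M = Matrix.of M := by
      ext i j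
      simp [sy, hM j i]
    have h := hfF M
    simp only [F, Set.mem_ofPred_eq, hsM] at h
    exact h
  choose f hf hspec using key
  refine ⟨⟨fun n M i => (f n M i ⬝ᵥ Matrix.mulVec (Matrix.of M) (f n M i), f n M i), ?_, ?_, ?_⟩⟩
  · intro n
    have hfi : ∀ i, Measurable fun M => f n M i := fun i => (measurable_pi_apply i).comp (hf n)
    refine measurable_pi_lambda _ fun i => Measurable.prodMk ?_ (hfi i)
    have hc : Continuous fun p : (Fin n → Fin n → ℝ) × (Fin n → ℝ) =>
        p.2 ⬝ᵥ Matrix.mulVec (Matrix.of p.1) p.2 := by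
      simp only [dotProduct, Matrix.mulVec, Matrix.of_apply]
      fun_prop
    exact hc.measurable.comp (measurable_id.prodMk (hfi i))
  · intro n M hM
    exact (hspec n M hM).1
  · intro n M hM
    exact (hspec n M hM).2

namespace Prog

/-- Sequential composition. -/
def bind {R α β : Type} : Prog R α → (α → Prog R β) → Prog R β
  | ret a, g => g a
  | charge n k, g => charge n (bind k g)
  | const q k, g => const q fun r => bind (k r) g
  | add x y k, g => add x y fun r => bind (k r) g
  | sub x y k, g => sub x y fun r => bind (k r) g
  | mul x y k, g => mul x y fun r => bind (k r) g
  | div x y k, g => div x y fun r => bind (k r) g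
  | sqrt x k, g => sqrt x fun r => bind (k r) g
  | log x k, g => log x fun r => bind (k r) g
  | lt x y k, g => lt x y fun r => bind (k r) g
  | ceil x k, g => ceil x fun r => bind (k r) g
  | eigh n M k, g => eigh n M fun r => bind (k r) g

instance (R : Type) : Monad (Prog R) where
  pure := ret
  bind := bind

/-- The result of a program over the actual real numbers. -/
noncomputable def run {α : Type} (E : EigenSolver) : Prog ℝ α → α
  | ret a => a
  | charge _ k => run E k
  | const q k => run E (k q)
  | add x y k => run E (k (x + y))
  | sub x y k => run E (k (x - y))
  | mul x y k => run E (k (x * y))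
  | div x y k => run E (k (x / y))
  | sqrt x k => run E (k (Real.sqrt x))
  | log x k => run E (k (Real.log x))
  | lt x y k => run E (k (@decide (x < y) (Classical.propDecidable _)))
  | ceil x k => run E (k ⌈x⌉₊)
  | eigh n M k => run E (k (E.solve n M))

/-- The running time: each arithmetic operation, elementary function and comparison costs one
step, rounding up to `m` costs `m + 1` steps (it can be done by counting), and an
eigendecomposition of an `n × n` matrix costs `n ^ 3 + 1` steps. -/
noncomputable def steps {α : Type} (E : EigenSolver) : Prog ℝ α → ℕ
  | ret _ => 0
  | charge n k => n + steps E k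
  | const q k => 1 + steps E (k q)
  | add x y k => 1 + steps E (k (x + y))
  | sub x y k => 1 + steps E (k (x - y))
  | mul x y k => 1 + steps E (k (x * y))
  | div x y k => 1 + steps E (k (x / y))
  | sqrt x k => 1 + steps E (k (Real.sqrt x))
  | log x k => 1 + steps E (k (Real.log x))
  | lt x y k => 1 + steps E (k (@decide (x < y) (Classical.propDecidable _)))
  | ceil x k => (⌈x⌉₊ + 1) + steps E (k ⌈x⌉₊)
  | eigh n M k => (n ^ 3 + 1) + steps E (k (E.solve n M))

/-! Single instructions as programs. -/

def charge' {R : Type} (n : ℕ) : Prog R Unit := charge n (ret ())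
def const' {R : Type} (q : ℚ) : Prog R R := const q ret
def add' {R : Type} (x y : R) : Prog R R := add x y ret
def sub' {R : Type} (x y : R) : Prog R R := sub x y ret
def mul' {R : Type} (x y : R) : Prog R R := mul x y ret
def div' {R : Type} (x y : R) : Prog R R := div x y ret
def sqrt' {R : Type} (x : R) : Prog R R := sqrt x ret
def log' {R : Type} (x : R) : Prog R R := log x ret
def lt' {R : Type} (x y : R) : Prog R Bool := lt x y ret
def ceil' {R : Type} (x : R) : Prog R ℕ := ceil x ret
def eigh' {R : Type} {n : ℕ} (M : Fin n → Fin n → R) : Prog R (Fin n → R × (Fin n → R)) :=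
  eigh n M ret

/-- A loop through a list, updating a state; each round costs one step besides its body. -/
def forEach {R σ β : Type} : List β → σ → (σ → β → Prog R σ) → Prog R σ
  | [], s, _ => ret s
  | b :: l, s, body => charge 1 (bind (body s b) fun s' => forEach l s' body)

/-- Fill an array of length `n`; each entry costs one step besides its computation. -/
def tabulate {R β : Type} : (n : ℕ) → (Fin n → Prog R β) → Prog R (Fin n → β)
  | 0, _ => ret Fin.elim0
  | n + 1, f => charge 1 (bind (f 0) fun b =>
      bind (tabulate n fun i => f i.succ) fun bs => ret (Fin.cons b bs))

end Prog

open Prog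

/-! ### Approximating partitions -/

/-- The inner product of two vectors. -/
def dot {R : Type} {d : ℕ} (x y : Fin d → R) : Prog R R := do
  let zero ← const' 0
  forEach (List.finRange d) zero fun acc i => do
    let p ← mul' (x i) (y i)
    add' acc p

/-- The data of an `ε'`-approximating partition of `ℝ^d`: an orthonormal list of vectors, and the
thresholds `z_i = start + i * width`, `0 ≤ i ≤ num`. The cells are indexed by the lists `j` of
numbers `< num`, one number for each basis vector; the cell of `j` consists of the points `x` with
`z_(j_i) ≤ v_i ⬝ x ≤ z_(j_i + 1)` for all `i`. -/
structure Partition (R : Type) (d : ℕ) where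
  basis : List (Fin d → R)
  start : R
  width : R
  num : ℕ

/-- The `ε'`-approximating partition with respect to the span of the orthonormal list `L` of `k`
vectors and with offset `τ`: the thresholds are `z_i = -√(2 log (k / ε')) + i ε' + τ` for
`0 ≤ i ≤ ⌈2 √(2 log (k / ε')) / ε'⌉`. (If `k = 0`, the only cell is the whole space.) -/
def mkPartition {R : Type} {d : ℕ} (ε' τ : R) (L : List (Fin d → R)) :
    Prog R (Partition R d) := do
  let zero ← const' 0
  let two ← const' 2
  charge' L.length
  let k ← const' (L.length : ℚ)
  let q ← div' k ε'
  let l ← log' q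
  let l2 ← mul' two l
  let r ← sqrt' l2
  let r2 ← mul' two r
  let w ← div' r2 ε'
  let num ← ceil' w
  let m ← sub' zero r
  let start ← add' m τ
  pure { basis := L, start := start, width := ε', num := num }

/-- The threshold `z_i`. -/
def threshold {R : Type} {d : ℕ} (P : Partition R d) (i : ℕ) : Prog R R := do
  let c ← const' (i : ℚ)
  let m ← mul' c P.width
  add' P.start m

/-- The first `j < num` with `z_j ≤ p ≤ z_(j+1)`, if there is one. -/
def intervalOf {R : Type} {d : ℕ} (P : Partition R d) (p : R) : Prog R (Option ℕ) :=
  forEach (List.range P.num) none fun found j =>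
    match found with
    | some i => pure (some i)
    | none => do
        let lo ← threshold P j
        let hi ← threshold P (j + 1)
        let below ← lt' p lo
        let above ← lt' hi p
        pure (if below || above then none else some j)

/-- The index of the cell that contains `x` (the first one, for a point of a common face), if `x`
lies in some cell. -/
def cellOf {R : Type} {d : ℕ} (P : Partition R d) (x : Fin d → R) :
    Prog R (Option (List ℕ)) :=
  forEach P.basis.reverse (some []) fun found v =>
    match found with
    | none => pure none
    | some js => do
        let p ← dot v x
        let j ← intervalOf P p
        pure (j.map fun i => i :: js)

/-- Compare two cell indices. -/
def sameCell {R : Type} (a b : List ℕ) : Prog R Bool := do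
  charge' (a.length + b.length + 1)
  pure (decide (a = b))

/-- Labelled examples. -/
abbrev Example (R : Type) (d K : ℕ) : Type := (Fin d → R) × Fin K

/-- The examples that lie in some cell, each with the index of its cell. -/
def locate {R : Type} {d K : ℕ} (P : Partition R d) (S : List (Example R d K)) :
    Prog R (List (List ℕ × Example R d K)) :=
  forEach S [] fun acc e => do
    let c ← cellOf P e.1
    match c with
    | none => pure acc
    | some js => pure ((js, e) :: acc)

/-- The indices, without repetition, of the cells that contain an example. -/
def occupied {R : Type} {d K : ℕ} (Q : List (List ℕ × Example R d K)) :
    Prog R (List (List ℕ)) :=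
  forEach Q [] fun cells q => do
    let seen ← forEach cells false fun b c => do
      let s ← sameCell c q.1
      pure (b || s)
    pure (if seen then cells else q.1 :: cells)

/-- The examples in the cell with index `js`. -/
def examplesIn {R : Type} {d K : ℕ} (Q : List (List ℕ × Example R d K)) (js : List ℕ) :
    Prog R (List (Example R d K)) :=
  forEach Q [] fun acc q => do
    let s ← sameCell q.1 js
    pure (if s then q.2 :: acc else acc)

/-! ### Estimating relevant directions -/

/-- The conditional empirical moment `Ê[x 1(y = i) | x ∈ S]` of the (nonempty) list of the examples
in the cell `S`. -/
def moment {R : Type} {d K : ℕ} (S : List (Example R d K)) (i : Fin K) :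
    Prog R (Fin d → R) := do
  let zero ← const' 0
  charge' S.length
  let n ← const' (S.length : ℚ)
  let total ← forEach S (fun _ : Fin d => zero) fun acc e =>
    if e.2 = i then tabulate d fun l => add' (acc l) (e.1 l) else pure acc
  tabulate d fun l => div' (total l) n

/-- The projection of `u` onto the orthogonal complement of the span of the orthonormal list `L`. -/
def projPerp {R : Type} {d : ℕ} (L : List (Fin d → R)) (u : Fin d → R) :
    Prog R (Fin d → R) :=
  forEach L u fun acc v => do
    let c ← dot v u
    tabulate d fun l => do
      let m ← mul' c (v l)
      sub' (acc l) m

/-- Given a sample `S` and an orthonormal list `L` with span `V`, compute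
`Û = ∑_(S, i) (û^(S,i))^⊥V ((û^(S,i))^⊥V)ᵀ P̂r[S]`, where `û^(S,i) = Ê[x 1(y = i) | x ∈ S]`, over
the cells `S` of an `ε'`-approximating partition with respect to `V` and the labels `i`, and return
the unit eigenvectors of `Û` whose eigenvalues are at least `s`. Cells without examples have
`P̂r[S] = 0` and are skipped. -/
def relevantDirections {R : Type} {d K : ℕ} (ε' s τ : R) (L : List (Fin d → R))
    (S : List (Example R d K)) : Prog R (List (Fin d → R)) := do
  let zero ← const' 0
  charge' S.length
  let N ← const' (S.length : ℚ)
  let P ← mkPartition ε' τ L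
  let Q ← locate P S
  let cells ← occupied Q
  let U ← forEach cells (fun (_ _ : Fin d) => zero) fun U js => do
    let C ← examplesIn Q js
    charge' C.length
    let n ← const' (C.length : ℚ)
    let weight ← div' n N
    forEach (List.finRange K) U fun U i => do
      let u ← moment C i
      let p ← projPerp L u
      tabulate d fun a => tabulate d fun b => do
        let m ← mul' (p a) (p b)
        let m' ← mul' m weight
        add' (U a b) m'
  let spec ← eigh' U
  forEach (List.finRange d) [] fun dirs r => do
    let small ← lt' (spec r).1 s
    pure (if small then dirs else (spec r).2 :: dirs)

/-! ### The learning algorithm -/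

/-- A piecewise constant hypothesis: a partition with a label for some of its cells; all other points
get the label `0`. -/
structure Hypothesis (R : Type) (d K : ℕ) where
  partition : Partition R d
  table : List (List ℕ × Fin K)

/-- The label that a hypothesis gives to the point `x`. -/
def predict {R : Type} {d K : ℕ} [NeZero K] (H : Hypothesis R d K) (x : Fin d → R) :
    Prog R (Fin K) := do
  let c ← cellOf H.partition x
  match c with
  | none => pure 0
  | some js => forEach H.table 0 fun label entry => do
      let s ← sameCell entry.1 js
      pure (if s then entry.2 else label)

/-- The label that occurs most often in a list of examples (the smallest one, if there is a
tie). -/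
def majority {R : Type} {d K : ℕ} [NeZero K] (S : List (Example R d K)) : Prog R (Fin K) := do
  let best ← forEach (List.finRange K) ((0 : Fin K), (0 : ℕ)) fun best i => do
    let n ← forEach S (0 : ℕ) fun n e => pure (if e.2 = i then n + 1 else n)
    pure (if best.2 < n then (i, n) else best)
  pure best.1

/-- The learner. It uses one sample for each round of the subspace approximation, starting from
the empty list and adding in each round the relevant directions found, and a last sample for
the piecewise constant hypothesis, which gives each cell of an `ε'`-approximating partition a
label that appears most often among the examples in it. -/
def learn {R : Type} {d K : ℕ} [NeZero K] (ε' s τ : R)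
    (rounds : List (List (Example R d K))) (last : List (Example R d K)) :
    Prog R (Hypothesis R d K) := do
  let L ← forEach rounds [] fun L S => do
    let dirs ← relevantDirections ε' s τ L S
    charge' (L.length + dirs.length)
    pure (L ++ dirs)
  let P ← mkPartition ε' τ L
  let Q ← locate P last
  let cells ← occupied Q
  let table ← forEach cells [] fun table js => do
    let C ← examplesIn Q js
    let label ← majority C
    pure ((js, label) :: table)
  pure { partition := P, table := table }

/-! ### The parameters -/

/-- The number of rounds `T`, a polynomial in `K` and `1 / ε`. -/
noncomputable def numRounds (a K : ℕ) (ε : ℝ) : ℕ := ⌈a * (K / ε) ^ a⌉₊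

/-- The inverse of a polynomial in `K` and `1 / ε`. It is used for the width `ε' = 1 / p` of
the cells and for the eigenvalue threshold. -/
noncomputable def invPoly (b K : ℕ) (ε : ℝ) : ℝ := 1 / (b * (K / ε) ^ b)

/-- The number of examples per sample, `d 2^(T^c) log (2 / δ)` rounded up. -/
noncomputable def batchSize (c d T : ℕ) (δ : ℝ) : ℕ :=
  ⌈(d : ℝ) * 2 ^ (T ^ c) * Real.log (2 / δ)⌉₊

/-- `T + 1` samples of `N` examples each. -/
abbrev Data (d K T N : ℕ) : Type := Fin (T + 1) → Fin N → Example ℝ d K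

/-- The law of `T + 1` independent samples of `N` i.i.d. examples from `D`. -/
noncomputable def dataLaw {d K : ℕ} (D : Measure ((Fin d → ℝ) × Fin K)) (T N : ℕ) :
    Measure (Data d K T N) :=
  Measure.pi fun _ => Measure.pi fun _ => D

/-- The learner on given data: the first `T` samples are used in the rounds. -/
def learnFrom {d K T N : ℕ} [NeZero K] (ε' s τ : ℝ) (S : Data d K T N) :
    Prog ℝ (Hypothesis ℝ d K) :=
  learn ε' s τ (List.ofFn fun t : Fin T => List.ofFn (S t.castSucc))
    (List.ofFn (S (Fin.last T)))

/-- The function `ℝ^d → [K]` described by the hypothesis that is returned. -/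
noncomputable def learned (E : EigenSolver) {d K T N : ℕ} [NeZero K] (ε' s τ : ℝ)
    (S : Data d K T N) (x : Fin d → ℝ) : Fin K :=
  ((predict ((learnFrom ε' s τ S).run E) x).run E)

end MulticlassLearning

namespace MulticlassLearning

/-! ### The standard normal distribution -/

/-! Fix a linear classifier `f` whose error exceeds `OPT` by at most a small multiple of `ε`. The
spans `V_t` of the lists of directions increase, and the quantity to control is the probability that
`f x` differs from `f` at the projection of `x` to `V_t`. If it is `O(OPT + ε)` at the end, so is
the error of the majority labels, because a cell of the fine partition is almost a point of `V_t`
(`GoodSample.err_le`).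

Suppose that this probability is large compared with the noise, that is, with the mass of the
mislabelled examples and of those too close to a decision boundary. Then cells of noticeable total
mass are bad: the class `i` of the representative is wrong in them much more often than the noise
explains (`IsClassifier.bad_cells_mass`). Inside a cell the component of `x` orthogonal to `V_t` is
still Gaussian, and up to noise the label maximizes affine functions `A j - τ j` of it, with the
value `0` for the label `i` and all `τ j ≥ 0`. In this situation some moment `E[A j 1(y = j)]` is
large (`exists_large_moment`), and a constant ratio between the bad mass and the noise is enough for
that. This is what keeps the final constant independent of `K`. The reason is as follows. Choose `m`
as a quantile at a small level `p` of the maximum of the `A j - τ j`, and divide each `A j` by `τ j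
+ m`. The rescaled value at the observed label is at least `1` on the clean points above the
quantile and nonnegative on the other clean points. Noise of mass `p / 16` can take away only a
fraction of `p`: the maximum of the rescaled functions is sublinear and exceeds `1` with probability
at most `p`, so its part beyond `3` integrates to at most `p / 4` (`IsSublinear.lintegral_tail_le`).
This decay is free of the dimension and of `K`; it comes from the rotation invariance of Gaussian
pairs (`IsSublinear.tail_mul_le`).

Consequently every bad cell has a conditional moment with a noticeable component along a difference
`w b - w a` (`IsClassifier.exists_moment_of_bad_cell`). The quadratic form of the estimated matrix
is then large on the unit vectors along these differences, while its trace is at most `3 K`. So the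
eigenvectors above the threshold are few and capture a definite part of these unit vectors
(`card_large_eigenvalues`, `large_eigenvectors_capture`). The potential, the sum of the squared
products of the directions found with the `K ^ 2` unit vectors, is at most `K ^ 2` by Bessel's
inequality. Hence the projection error must be small in one of `T` rounds (`potential_increase`).
Later rounds cannot spoil this: `f` at the projection is within a factor two of the best prediction
from the projection (`IsClassifier.proj_optimal`), by reflection at the subspace and convexity of
the class regions, and a larger subspace allows more predictions.

For the statistics, frequencies obey Hoeffding's inequality, and empirical moments are controlled by
averaging exponential moments over a Gaussian direction (`measure_vector_deviation_le`). Each round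
uses a sample independent of the list it is applied to (`measure_not_goodFor_le`). The exponential
sample size pays for the number of cells. The program itself only visits cells that contain
examples, so its running time is polynomial in the number of examples (`steps_learnFrom_le`). -/

instance isProbabilityMeasure_stdNormal (d : ℕ) : IsProbabilityMeasure (stdNormal d) := by
  unfold stdNormal; infer_instance

theorem hasGaussianLaw_stdNormal (d : ℕ) :
    HasGaussianLaw (fun x : Fin d → ℝ => x) (stdNormal d) := by
  have h1 : ∀ i, (stdNormal d).map (fun x : Fin d → ℝ => x i) = gaussianReal 0 1 := fun i =>
    (measurePreserving_eval (fun _ : Fin d => gaussianReal 0 1) i).map_eq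
  refine iIndepFun.hasGaussianLaw (X := fun (i : Fin d) (x : Fin d → ℝ) => x i) (fun i => ?_) ?_
  · exact ⟨by rw [h1]; infer_instance⟩
  · exact iIndepFun_pi (X := fun _ x => x) (fun i => aemeasurable_id)

instance isGaussian_stdNormal (d : ℕ) : IsGaussian (stdNormal d) := by
  have := (hasGaussianLaw_stdNormal d).isGaussian_map
  rwa [show (fun x : Fin d → ℝ => x) = id from rfl, Measure.map_id] at this

/-- The linear functional `x ↦ v ⬝ᵥ x`. -/
noncomputable def dotCLM {d : ℕ} (v : Fin d → ℝ) : (Fin d → ℝ) →L[ℝ] ℝ :=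
  LinearMap.toContinuousLinearMap
    { toFun := fun x => v ⬝ᵥ x
      map_add' := fun x y => dotProduct_add v x y
      map_smul' := fun c x => by simp [dotProduct_smul] }

@[simp] theorem dotCLM_apply {d : ℕ} (v x : Fin d → ℝ) : dotCLM v x = v ⬝ᵥ x := rfl

theorem exists_eq_dotCLM {d : ℕ} (L : (Fin d → ℝ) →L[ℝ] ℝ) : ∃ v, L = dotCLM v := by
  refine ⟨fun i => L (Pi.single i 1), ?_⟩
  ext x
  have : x = ∑ i, x i • (Pi.single i (1 : ℝ) : Fin d → ℝ) := by
    ext j; simp [Finset.sum_apply, Pi.single_apply]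
  conv_lhs => rw [this]
  simp [dotProduct, mul_comm, map_sum]

@[fun_prop] theorem measurable_dot_right {d : ℕ} (v : Fin d → ℝ) :
    Measurable fun x : Fin d → ℝ => v ⬝ᵥ x := (dotCLM v).continuous.measurable

theorem hasGaussianLaw_dot {d : ℕ} (v : Fin d → ℝ) :
    HasGaussianLaw (fun x => v ⬝ᵥ x) (stdNormal d) :=
  (hasGaussianLaw_stdNormal d).map_fun (dotCLM v)

theorem memLp_dot {d : ℕ} (v : Fin d → ℝ) : MemLp (fun x => v ⬝ᵥ x) 2 (stdNormal d) :=
  (hasGaussianLaw_dot v).memLp_two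

theorem integral_dot {d : ℕ} (v : Fin d → ℝ) : ∫ x, v ⬝ᵥ x ∂stdNormal d = 0 := by
  have h1 : ∀ i, (stdNormal d).map (fun x : Fin d → ℝ => x i) = gaussianReal 0 1 := fun i =>
    (measurePreserving_eval (fun _ : Fin d => gaussianReal 0 1) i).map_eq
  have hI : ∀ i, ∫ x : Fin d → ℝ, x i ∂stdNormal d = 0 := by
    intro i
    have := integral_map (μ := stdNormal d) (φ := fun x : Fin d → ℝ => x i)
      (measurable_pi_apply i).aemeasurable (f := fun y : ℝ => y) (by fun_prop)
    rw [← this, h1]; exact integral_id_gaussianReal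
  have hint : ∀ i, Integrable (fun x : Fin d → ℝ => x i) (stdNormal d) := fun i =>
    (HasGaussianLaw.eval (hasGaussianLaw_stdNormal d) i).integrable
  simp only [dotProduct]
  rw [integral_finsetSum _ fun i _ => (hint i).const_mul _]
  simp [integral_const_mul, hI]

theorem covariance_dot {d : ℕ} (v w : Fin d → ℝ) :
    cov[fun x => v ⬝ᵥ x, fun x => w ⬝ᵥ x; stdNormal d] = v ⬝ᵥ w := by
  have h1 : ∀ i, (stdNormal d).map (fun x : Fin d → ℝ => x i) = gaussianReal 0 1 := fun i =>
    (measurePreserving_eval (fun _ : Fin d => gaussianReal 0 1) i).map_eq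
  have hmem : ∀ i, MemLp (fun x : Fin d → ℝ => x i) 2 (stdNormal d) := fun i =>
    (HasGaussianLaw.eval (hasGaussianLaw_stdNormal d) i).memLp_two
  have hcov : ∀ i j : Fin d, cov[fun x : Fin d → ℝ => x i, fun x => x j; stdNormal d] =
      if i = j then 1 else 0 := by
    intro i j
    split_ifs with h
    · subst h
      rw [covariance_self (measurable_pi_apply i).aemeasurable]
      have := variance_id_map (μ := stdNormal d) (X := fun x : Fin d → ℝ => x i)
        (measurable_pi_apply i).aemeasurable
      rw [← this, h1]; simp
    · have hind : iIndepFun (fun (i : Fin d) (x : Fin d → ℝ) => x i) (stdNormal d) :=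
        iIndepFun_pi (X := fun _ x => x) (fun i => aemeasurable_id)
      exact (hind.indepFun h).covariance_eq_zero (hmem i) (hmem j)
  simp only [dotProduct]
  rw [covariance_fun_sum_fun_sum (fun i => (hmem i).const_mul _) (fun i => (hmem i).const_mul _)]
  simp [covariance_const_mul_left, covariance_const_mul_right, hcov, mul_comm]

theorem dotProduct_self_nonneg' {d : ℕ} (v : Fin d → ℝ) : 0 ≤ v ⬝ᵥ v :=
  Finset.sum_nonneg fun i _ => mul_self_nonneg (v i)

theorem map_dot_stdNormal {d : ℕ} (v : Fin d → ℝ) :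
    (stdNormal d).map (fun x => v ⬝ᵥ x) = gaussianReal 0 (v ⬝ᵥ v).toNNReal := by
  rw [(hasGaussianLaw_dot v).map_eq_gaussianReal, integral_dot]
  congr 1
  rw [← covariance_self (hasGaussianLaw_dot v).aemeasurable, covariance_dot]

/-- A measurable linear map whose transpose preserves lengths preserves the standard normal
distribution. -/
theorem measurePreserving_of_dot {d : ℕ} (F : (Fin d → ℝ) → Fin d → ℝ) (hF : Measurable F)
    (G : (Fin d → ℝ) → Fin d → ℝ) (hFG : ∀ v x, v ⬝ᵥ F x = G v ⬝ᵥ x)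
    (hG : ∀ v, G v ⬝ᵥ G v = v ⬝ᵥ v) : MeasurePreserving F (stdNormal d) (stdNormal d) := by
  refine ⟨hF, ?_⟩
  have : IsProbabilityMeasure ((stdNormal d).map F) := Measure.isProbabilityMeasure_map hF.aemeasurable
  -- A measure is determined by the laws of its linear functionals. Composed with `F`, the
  -- functional of `v` becomes that of `G v`, which has the same length and therefore the same
  -- centred Gaussian law.
  refine Measure.ext_of_charFunDual ?_
  ext L
  obtain ⟨v, rfl⟩ := exists_eq_dotCLM L
  rw [charFunDual_eq_charFun_map_one, charFunDual_eq_charFun_map_one,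
    Measure.map_map (dotCLM v).continuous.measurable hF]
  have h1 : (⇑(dotCLM v) ∘ F) = fun x => G v ⬝ᵥ x := by ext x; simp [hFG]
  have h2 : (⇑(dotCLM v)) = fun x => v ⬝ᵥ x := by ext x; simp
  rw [h1, h2, map_dot_stdNormal, map_dot_stdNormal, hG]

/-- Linear functionals orthogonal to each other are independent. -/
theorem indepFun_dot {d k m : ℕ} (v : Fin k → Fin d → ℝ) (a : Fin m → Fin d → ℝ)
    (h : ∀ i j, v i ⬝ᵥ a j = 0) :
    IndepFun (fun x i => v i ⬝ᵥ x) (fun x j => a j ⬝ᵥ x) (stdNormal d) := by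
  refine HasGaussianLaw.indepFun_of_covariance_eval (X := fun i x => v i ⬝ᵥ x)
    (Y := fun j x => a j ⬝ᵥ x) ?_ fun i j => ?_
  · exact (hasGaussianLaw_stdNormal d).map_fun
      ((ContinuousLinearMap.pi fun i => dotCLM (v i)).prod
        (ContinuousLinearMap.pi fun j => dotCLM (a j)))
  · rw [covariance_dot, h]

/-! ### Anti-concentration and tails of linear functionals -/

theorem gaussianPDFReal_one_le (x : ℝ) : gaussianPDFReal 0 1 x ≤ 2 / 5 := by
  rw [gaussianPDFReal]
  have h1 : Real.exp (-(x - 0) ^ 2 / (2 * ((1 : NNReal) : ℝ))) ≤ 1 := by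
    rw [Real.exp_le_one_iff]
    have := sq_nonneg (x - 0)
    simp only [NNReal.coe_one]; linarith
  have h2 : (5 / 2 : ℝ) ≤ √(2 * Real.pi * ((1 : NNReal) : ℝ)) := by
    apply Real.le_sqrt_of_sq_le
    have := Real.pi_gt_d2
    simp only [NNReal.coe_one]; linarith
  have h3 : (√(2 * Real.pi * ((1 : NNReal) : ℝ)))⁻¹ ≤ 2 / 5 := by
    rw [show (2 / 5 : ℝ) = (5 / 2)⁻¹ by norm_num]
    exact inv_anti₀ (by norm_num) h2
  calc _ ≤ (2 / 5 : ℝ) * 1 := by gcongr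
    _ = _ := by norm_num

/-- The density is below `2 / 5`, since `2 π ≥ (5 / 2) ^ 2`. This constant leaves mass outside `[-1,
1]` and gives an interval of half-width `r` a mass of at most `r`. -/
theorem gaussianReal_Icc_le (a b : ℝ) :
    gaussianReal 0 1 (Set.Icc a b) ≤ ENNReal.ofReal (2 / 5 * (b - a)) := by
  rw [gaussianReal_apply 0 one_ne_zero]
  calc ∫⁻ x in Set.Icc a b, gaussianPDF 0 1 x
      ≤ ∫⁻ _ in Set.Icc a b, ENNReal.ofReal (2 / 5) :=
        lintegral_mono fun x => ENNReal.ofReal_le_ofReal (gaussianPDFReal_one_le x)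
    _ = _ := by
        rw [setLIntegral_const, Real.volume_Icc, ← ENNReal.ofReal_mul (by norm_num)]

/-- A functional of length one is standard normal. -/
theorem map_dot_unit {d : ℕ} {v : Fin d → ℝ} (hv : v ⬝ᵥ v = 1) :
    (stdNormal d).map (fun x => v ⬝ᵥ x) = gaussianReal 0 1 := by
  rw [map_dot_stdNormal, hv]; simp

/-- The length of a vector. -/
noncomputable def len {d : ℕ} (v : Fin d → ℝ) : ℝ := √(v ⬝ᵥ v)

theorem len_nonneg {d : ℕ} (v : Fin d → ℝ) : 0 ≤ len v := Real.sqrt_nonneg _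

theorem len_sq {d : ℕ} (v : Fin d → ℝ) : len v ^ 2 = v ⬝ᵥ v :=
  Real.sq_sqrt (dotProduct_self_nonneg' v)

theorem len_pos {d : ℕ} {v : Fin d → ℝ} (hv : v ≠ 0) : 0 < len v := by
  refine Real.sqrt_pos.mpr (lt_of_le_of_ne (dotProduct_self_nonneg' v) fun h => hv ?_)
  exact dotProduct_self_eq_zero.mp h.symm

theorem unit_normalize {d : ℕ} {v : Fin d → ℝ} (hv : v ≠ 0) :
    ((len v)⁻¹ • v) ⬝ᵥ ((len v)⁻¹ • v) = 1 := by
  have := len_pos hv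
  rw [smul_dotProduct, dotProduct_smul, ← len_sq, smul_eq_mul, smul_eq_mul]
  field_simp

theorem abs_dot_le {d : ℕ} (v w : Fin d → ℝ) : |v ⬝ᵥ w| ≤ len v * len w := by
  have h : (v ⬝ᵥ w) ^ 2 ≤ (v ⬝ᵥ v) * (w ⬝ᵥ w) := by
    have := Finset.sum_mul_sq_le_sq_mul_sq Finset.univ v w
    simpa [dotProduct, pow_two] using this
  rw [len, len, ← Real.sqrt_mul (dotProduct_self_nonneg' v)]
  exact Real.abs_le_sqrt h

/-- Anti-concentration. -/
theorem stdNormal_slab_le {d : ℕ} {v : Fin d → ℝ} (hv : v ≠ 0) (t r : ℝ) :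
    stdNormal d {x | |v ⬝ᵥ x + t| ≤ r * len v} ≤ ENNReal.ofReal r := by
  rcases lt_or_ge r 0 with hr | hr
  · have : {x : Fin d → ℝ | |v ⬝ᵥ x + t| ≤ r * len v} = ∅ := by
      ext x
      simp only [Set.mem_ofPred_eq, Set.mem_empty_iff_false, iff_false, not_le]
      exact lt_of_lt_of_le (mul_neg_of_neg_of_pos hr (len_pos hv)) (abs_nonneg _)
    simp [this]
  have hl := len_pos hv
  have hsub : {x : Fin d → ℝ | |v ⬝ᵥ x + t| ≤ r * len v} ⊆
      (fun x => ((len v)⁻¹ • v) ⬝ᵥ x) ⁻¹' Set.Icc (-t / len v - r) (-t / len v + r) := by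
    intro x hx
    rw [Set.mem_ofPred_eq, abs_le] at hx
    simp only [Set.mem_preimage, smul_dotProduct, smul_eq_mul, Set.mem_Icc]
    constructor
    · rw [div_sub' hl.ne', inv_mul_eq_div]
      gcongr; linarith
    · rw [div_add' _ _ _ hl.ne', inv_mul_eq_div]
      gcongr; linarith
  refine (measure_mono hsub).trans ?_
  rw [← Measure.map_apply (by fun_prop) measurableSet_Icc, map_dot_unit (unit_normalize hv)]
  refine (gaussianReal_Icc_le _ _).trans (ENNReal.ofReal_le_ofReal ?_)
  linarith

theorem integral_dot_sq {d : ℕ} (v : Fin d → ℝ) :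
    ∫ x, (v ⬝ᵥ x) ^ 2 ∂stdNormal d = v ⬝ᵥ v := by
  have h := variance_eq_integral (μ := stdNormal d) (hasGaussianLaw_dot v).aemeasurable
  rw [integral_dot] at h
  rw [← covariance_dot, covariance_self (hasGaussianLaw_dot v).aemeasurable, h]
  simp

/-- Chebyshev's inequality for linear functionals. -/
theorem stdNormal_tail_le {d : ℕ} (v : Fin d → ℝ) {h : ℝ} (hh : 0 < h) :
    stdNormal d {x | h * len v < |v ⬝ᵥ x|} ≤ ENNReal.ofReal (1 / h ^ 2) := by
  by_cases hv : v = 0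
  · subst hv; simp [len]
  have hl := len_pos hv
  have hc := meas_ge_le_variance_div_sq (memLp_dot v) (mul_pos hh hl)
  rw [integral_dot] at hc
  refine (measure_mono fun x hx => ?_).trans (hc.trans (ENNReal.ofReal_le_ofReal ?_))
  · simp only [Set.mem_ofPred_eq, sub_zero] at hx ⊢; exact hx.le
  · rw [← covariance_self (hasGaussianLaw_dot v).aemeasurable, covariance_dot, mul_pow, len_sq]
    have : 0 < v ⬝ᵥ v := by rw [← len_sq]; positivity
    rw [div_le_div_iff₀ (by positivity) (by positivity)]
    linarith

theorem measurePreserving_neg_stdNormal (d : ℕ) :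
    MeasurePreserving (fun x : Fin d → ℝ => -x) (stdNormal d) (stdNormal d) :=
  measurePreserving_of_dot _ measurable_neg (fun v => -v) (by simp) (by simp)

/-- By symmetry the two tails beyond `1` have equal mass, and `[-1, 1]` has mass at most `4 / 5`. -/
theorem stdNormal_dot_gt_unit {d : ℕ} {v : Fin d → ℝ} (hv : v ⬝ᵥ v = 1) :
    ENNReal.ofReal (1 / 10) ≤ stdNormal d {x | 1 < v ⬝ᵥ x} := by
  set A : Set (Fin d → ℝ) := {x | 1 < v ⬝ᵥ x}
  have hv0 : v ≠ 0 := by rintro rfl; simp at hv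
  have hA : MeasurableSet A := measurableSet_lt measurable_const (by fun_prop)
  have hneg : stdNormal d {x | v ⬝ᵥ x < -1} = stdNormal d A := by
    rw [← (measurePreserving_neg_stdNormal d).measure_preimage hA.nullMeasurableSet]
    congr 1; ext x; simp only [A, Set.mem_preimage, Set.mem_ofPred_eq, dotProduct_neg]
    constructor <;> intro h <;> linarith
  have hmid : stdNormal d {x | v ⬝ᵥ x ∈ Set.Icc (-1 : ℝ) 1} ≤ ENNReal.ofReal (4 / 5) := by
    have := Measure.map_apply (μ := stdNormal d) (measurable_dot_right v)
      (measurableSet_Icc (a := (-1 : ℝ)) (b := 1))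
    rw [map_dot_unit hv] at this
    change stdNormal d ((fun x => v ⬝ᵥ x) ⁻¹' _) ≤ _
    rw [← this]
    refine (gaussianReal_Icc_le _ _).trans (ENNReal.ofReal_le_ofReal (by norm_num))
  have hcov : (Set.univ : Set (Fin d → ℝ)) ⊆ ({x | v ⬝ᵥ x < -1} ∪ A) ∪
      {x | v ⬝ᵥ x ∈ Set.Icc (-1 : ℝ) 1} := by
    intro x _
    simp only [A, Set.mem_union, Set.mem_ofPred_eq, Set.mem_Icc]
    by_cases h1 : v ⬝ᵥ x < -1
    · simp [h1]
    · by_cases h2 : 1 < v ⬝ᵥ x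
      · simp [h2]
      · right; constructor <;> linarith
  have h1 : (1 : ENNReal) ≤ (stdNormal d A + stdNormal d A) + ENNReal.ofReal (4 / 5) := by
    calc (1 : ENNReal) = stdNormal d Set.univ := measure_univ.symm
      _ ≤ _ := (measure_mono hcov).trans ((measure_union_le _ _).trans
        (add_le_add ((measure_union_le _ _).trans (by rw [hneg])) hmid))
  have hfin : stdNormal d A ≠ ⊤ := measure_ne_top _ _
  rw [ENNReal.ofReal_le_iff_le_toReal hfin]
  have h2 := ENNReal.toReal_mono (by simp [hfin]) h1
  rw [ENNReal.toReal_add (by simp [hfin]) (by simp), ENNReal.toReal_add hfin hfin,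
    ENNReal.toReal_ofReal (by norm_num)] at h2
  simp only [ENNReal.toReal_one] at h2
  linarith

/-- Otherwise the event would contain the one where the normalized functional exceeds `1`, of mass
at least `1 / 10`. This turns a bound on a quantile into a bound on the length of a weight vector.
-/
theorem len_le_of_tail {d : ℕ} (v : Fin d → ℝ) {m : ℝ} (hm : 0 < m)
    (h : stdNormal d {x | m < v ⬝ᵥ x} < ENNReal.ofReal (1 / 10)) : len v ≤ m := by
  by_contra! hlt
  have hv0 : v ≠ 0 := by
    rintro rfl; simp [len] at hlt; linarith
  have hl := len_pos hv0
  have := stdNormal_dot_gt_unit (unit_normalize hv0)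
  refine absurd (this.trans (measure_mono fun x hx => ?_)) (not_le.mpr h)
  simp only [Set.mem_ofPred_eq, smul_dotProduct, smul_eq_mul] at hx ⊢
  rw [inv_mul_eq_div, one_lt_div hl] at hx
  linarith

/-! ### Exponential moments -/

theorem lintegral_exp_dot {d : ℕ} (v : Fin d → ℝ) :
    ∫⁻ x, ENNReal.ofReal (Real.exp (v ⬝ᵥ x)) ∂stdNormal d =
      ENNReal.ofReal (Real.exp (v ⬝ᵥ v / 2)) := by
  have h := mgf_gaussianReal (map_dot_stdNormal v) 1
  simp only [mgf, one_mul, one_pow, mul_one, zero_add] at h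
  rw [Real.coe_toNNReal _ (dotProduct_self_nonneg' v)] at h
  rw [← h, ofReal_integral_eq_lintegral_ofReal]
  · have h3 := integrable_exp_mul_gaussianReal (μ := 0) (v := (v ⬝ᵥ v).toNNReal) 1
    rw [← map_dot_stdNormal v] at h3
    have := (integrable_map_measure (by fun_prop) (by fun_prop)).mp h3
    simpa [Function.comp_def] using this
  · exact ae_of_all _ fun _ => (Real.exp_pos _).le

/-- For `c < 1 / 2` the product with the density is an unnormalized Gaussian of variance `1 / (1 - 2
c)`. -/
theorem lintegral_exp_sq_gaussianReal {c : ℝ} (hc : c < 1 / 2) :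
    ∫⁻ x, ENNReal.ofReal (Real.exp (c * x ^ 2)) ∂gaussianReal 0 1 =
      ENNReal.ofReal (√(1 / (1 - 2 * c))) := by
  rw [gaussianReal_of_var_ne_zero 0 one_ne_zero,
    lintegral_withDensity_eq_lintegral_mul _ (measurable_gaussianPDF 0 1) (by fun_prop)]
  have hcongr : ∀ x : ℝ, (gaussianPDF 0 1 * fun x => ENNReal.ofReal (Real.exp (c * x ^ 2))) x =
      ENNReal.ofReal ((√(2 * Real.pi))⁻¹ * Real.exp (-(1 / 2 - c) * x ^ 2)) := by
    intro x
    simp only [Pi.mul_apply, gaussianPDF, gaussianPDFReal]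
    rw [← ENNReal.ofReal_mul (by positivity)]
    congr 1
    rw [mul_assoc, ← Real.exp_add]
    simp only [NNReal.coe_one, mul_one, sub_zero]
    ring_nf
  rw [lintegral_congr hcongr, ← ofReal_integral_eq_lintegral_ofReal]
  · rw [integral_const_mul, integral_gaussian, ← Real.sqrt_inv, ← Real.sqrt_mul (by positivity)]
    congr 2
    have := Real.pi_pos
    have : (1 - 2 * c) ≠ 0 := by linarith
    have : (1 / 2 - c) ≠ 0 := by linarith
    field_simp
  · exact (integrable_exp_neg_mul_sq (by linarith)).const_mul _
  · exact ae_of_all _ fun _ => by positivity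

theorem lintegral_pi_prod {ι Z : Type*} [Fintype ι] [MeasurableSpace Z] (μ : Measure Z)
    [IsProbabilityMeasure μ] (f : Z → ENNReal) (hf : Measurable f) :
    ∫⁻ z : ι → Z, ∏ i, f (z i) ∂Measure.pi (fun _ => μ) = (∫⁻ z, f z ∂μ) ^ Fintype.card ι := by
  rw [lintegral_prod_eq_prod_lintegral_of_indepFun Finset.univ (fun i (z : ι → Z) => f (z i))
    (iIndepFun_pi (X := fun _ => f) fun _ => hf.aemeasurable) (by fun_prop)]
  have : ∀ i : ι, ∫⁻ z : ι → Z, f (z i) ∂Measure.pi (fun _ => μ) = ∫⁻ z, f z ∂μ := fun i =>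
    (measurePreserving_eval (fun _ : ι => μ) i).lintegral_comp hf
  simp [this]

/-- The integrand factorizes over the coordinates, each of which contributes `√2`. This factor is
how the dimension enters the concentration of the moments. -/
theorem lintegral_exp_norm_sq {d : ℕ} :
    ∫⁻ x, ENNReal.ofReal (Real.exp (x ⬝ᵥ x / 4)) ∂stdNormal d = ENNReal.ofReal (√2 ^ d) := by
  have h : ∀ x : Fin d → ℝ, ENNReal.ofReal (Real.exp (x ⬝ᵥ x / 4)) =
      ∏ i, ENNReal.ofReal (Real.exp (1 / 4 * x i ^ 2)) := by
    intro x
    rw [← ENNReal.ofReal_prod_of_nonneg (fun _ _ => (Real.exp_pos _).le), ← Real.exp_sum]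
    congr 2
    simp only [dotProduct, Finset.sum_div]
    exact Finset.sum_congr rfl fun i _ => by ring
  rw [lintegral_congr h, stdNormal,
    lintegral_pi_prod _ (fun y : ℝ => ENNReal.ofReal (Real.exp (1 / 4 * y ^ 2))) (by fun_prop),
    lintegral_exp_sq_gaussianReal (c := 1 / 4) (by norm_num)]
  norm_num [ENNReal.ofReal_pow]

/-- The upper tail of a standard normal functional. -/
theorem stdNormal_unit_tail_le {d : ℕ} {v : Fin d → ℝ} (hv : v ⬝ᵥ v = 1) {r : ℝ} (hr : 0 ≤ r) :
    stdNormal d {x | r ≤ v ⬝ᵥ x} ≤ ENNReal.ofReal (Real.exp (-r ^ 2 / 2)) := by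
  -- Chernoff's bound with the optimal parameter `r`.
  have h := mul_meas_ge_le_lintegral₀ (μ := stdNormal d)
    (f := fun x => ENNReal.ofReal (Real.exp ((r • v) ⬝ᵥ x))) (by fun_prop)
    (ENNReal.ofReal (Real.exp (r ^ 2)))
  rw [lintegral_exp_dot] at h
  have hsub : {x : Fin d → ℝ | r ≤ v ⬝ᵥ x} ⊆ {x | ENNReal.ofReal (Real.exp (r ^ 2)) ≤
      ENNReal.ofReal (Real.exp ((r • v) ⬝ᵥ x))} := by
    intro x hx
    simp only [Set.mem_ofPred_eq, smul_dotProduct, smul_eq_mul] at hx ⊢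
    gcongr
    nlinarith
  have h2 := (mul_le_mul_right (measure_mono hsub) (ENNReal.ofReal (Real.exp (r ^ 2)))).trans h
  rw [mul_comm] at h2
  have h3 := ENNReal.le_div_iff_mul_le (a := stdNormal d {x | r ≤ v ⬝ᵥ x})
    (b := ENNReal.ofReal (Real.exp (r ^ 2)))
    (c := ENNReal.ofReal (Real.exp (((r • v) ⬝ᵥ (r • v)) / 2)))
    (Or.inl (by simp [Real.exp_pos])) (Or.inl ENNReal.ofReal_ne_top)
  refine (h3.mpr h2).trans ?_
  rw [← ENNReal.ofReal_div_of_pos (Real.exp_pos _), ← Real.exp_sub]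
  apply ENNReal.ofReal_le_ofReal
  gcongr
  simp only [smul_dotProduct, dotProduct_smul, smul_eq_mul, hv]
  linarith

/-! ### Tails of sublinear functions and the moments of noisy linear classifiers -/

/-- Measurable sublinear functions. -/
structure IsSublinear {d : ℕ} (ρ : (Fin d → ℝ) → ℝ) : Prop where
  measurable : Measurable ρ
  add_le : ∀ x y, ρ (x + y) ≤ ρ x + ρ y
  smul : ∀ (c : ℝ) x, 0 ≤ c → ρ (c • x) = c * ρ x

/-- Rotation by `π / 4` preserves the law of a pair of independent points `x`, `y`. Put `u = (x + y)
/ √2` and `v = (y - x) / √2`, so that `u = √2 x + v = √2 y - v`. If `ρ u > 3 t` while `ρ` is at most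
`1` at `v` and at `-v`, then `ρ x` and `ρ y` both exceed `(3 t - 1) / √2 ≥ √2 t`. -/
theorem IsSublinear.tail_mul_le {d : ℕ} {ρ : (Fin d → ℝ) → ℝ} (hρ : IsSublinear ρ) {t : ℝ}
    (ht : 1 ≤ t) :
    stdNormal d {x | 3 * t < ρ x} * stdNormal d {x | ρ x ≤ 1 ∧ ρ (-x) ≤ 1} ≤
      stdNormal d {x | t < ρ x} ^ 2 := by
  have hm := hρ.measurable
  have hA : MeasurableSet {x | 3 * t < ρ x} := measurableSet_lt measurable_const hm
  have hB : MeasurableSet {x | ρ x ≤ 1 ∧ ρ (-x) ≤ 1} :=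
    (measurableSet_le hm measurable_const).inter
      (measurableSet_le (hm.comp measurable_neg) measurable_const)
  have hmean : (stdNormal d)[id] = 0 := by
    have hint : Integrable (fun x : Fin d → ℝ => x) (stdNormal d) :=
      (hasGaussianLaw_stdNormal d).integrable
    ext i
    have h1 := (ContinuousLinearMap.integral_comp_comm
      (ContinuousLinearMap.proj (R := ℝ) (φ := fun _ : Fin d => ℝ) i) hint)
    have h2 := integral_dot (Pi.single i (1 : ℝ) : Fin d → ℝ)
    simp only [single_one_dotProduct] at h2
    simp only [ContinuousLinearMap.proj_apply] at h1
    simp only [id]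
    rw [← h1, h2]; rfl
  have hrot := IsGaussian.map_rotation_eq_self (μ := stdNormal d) hmean (Real.pi / 4)
  rw [← Measure.prod_prod, ← hrot, Measure.map_apply (by fun_prop) (hA.prod hB), pow_two,
    ← Measure.prod_prod]
  refine measure_mono ?_
  rintro ⟨x, y⟩ hxy
  simp only [Set.mem_preimage, ContinuousLinearMap.rotation_apply, Set.mem_prod, Set.mem_ofPred_eq,
    Real.cos_pi_div_four, Real.sin_pi_div_four] at hxy ⊢
  obtain ⟨h1, h2, h3⟩ := hxy
  set c : ℝ := √2 / 2 with hc
  have hc2 : c * c = 1 / 2 := by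
    rw [hc]; nlinarith [Real.mul_self_sqrt (show (0 : ℝ) ≤ 2 by norm_num)]
  have hs : √2 = 2 * c := by rw [hc]; ring
  have hc0 : 0 ≤ c := by positivity
  have hc1 : c ≤ 3 / 4 := by nlinarith
  have e1 : c • x + c • y = (2 * c) • x + (-c • x + c • y) := by module
  have e2 : c • x + c • y = (2 * c) • y + -(-c • x + c • y) := by module
  constructor
  · have h4 := hρ.add_le ((2 * c) • x) (-c • x + c • y)
    rw [← e1, hρ.smul _ _ (by positivity)] at h4
    by_contra! hlt
    nlinarith
  · have h4 := hρ.add_le ((2 * c) • y) (-(-c • x + c • y))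
    rw [← e2, hρ.smul _ _ (by positivity)] at h4
    by_contra! hlt
    nlinarith

/-- The symmetric core has mass at least `1 - 2 p ≥ 49 / 50`, so tripling the level essentially
squares the tail; as the tail is at most `1 / 100`, each step gains a factor `50`. The bound stays
proportional to `p`, which allows a comparison with noise of mass a fraction of `p`. -/
theorem IsSublinear.tail_le {d : ℕ} {ρ : (Fin d → ℝ) → ℝ} (hρ : IsSublinear ρ) {p : ℝ}
    (hp : p ≤ 1 / 100) (h : (stdNormal d).real {x | 1 < ρ x} ≤ p) (n : ℕ) :
    (stdNormal d).real {x | 3 ^ n < ρ x} ≤ p / 50 ^ n := by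
  have hm := hρ.measurable
  have hp0 : 0 ≤ p := measureReal_nonneg.trans h
  have hcore : 49 / 50 ≤ (stdNormal d).real {x | ρ x ≤ 1 ∧ ρ (-x) ≤ 1} := by
    have h1 : MeasurableSet {x | 1 < ρ x} := measurableSet_lt measurable_const hm
    have hneg : (stdNormal d).real {x | 1 < ρ (-x)} ≤ p := by
      refine le_trans (le_of_eq ?_) h
      exact (measurePreserving_neg_stdNormal d).measureReal_preimage h1.nullMeasurableSet
    have h2 : (Set.univ : Set (Fin d → ℝ)) ⊆ {x | ρ x ≤ 1 ∧ ρ (-x) ≤ 1} ∪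
        ({x | 1 < ρ x} ∪ {x | 1 < ρ (-x)}) := by
      intro x _
      simp only [Set.mem_union, Set.mem_ofPred_eq]
      by_cases h3 : 1 < ρ x
      · simp [h3]
      · by_cases h4 : 1 < ρ (-x)
        · simp [h4]
        · left; exact ⟨not_lt.mp h3, not_lt.mp h4⟩
    have h3 := measureReal_mono (μ := stdNormal d) h2
    have h4 := measureReal_union_le (μ := stdNormal d) {x | ρ x ≤ 1 ∧ ρ (-x) ≤ 1}
      ({x | 1 < ρ x} ∪ {x | 1 < ρ (-x)})
    have h5 := measureReal_union_le (μ := stdNormal d) {x | 1 < ρ x} {x | 1 < ρ (-x)}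
    rw [probReal_univ] at h3
    linarith
  induction n with
  | zero => simpa using h
  | succ n ih =>
    have h1 := hρ.tail_mul_le (t := 3 ^ n) (one_le_pow₀ (by norm_num))
    have h2 := ENNReal.toReal_mono (by finiteness) h1
    rw [ENNReal.toReal_mul, ENNReal.toReal_pow] at h2
    change (stdNormal d).real _ * (stdNormal d).real _ ≤ (stdNormal d).real _ ^ 2 at h2
    rw [pow_succ' 3 n]
    set q := (stdNormal d).real {x | 3 * 3 ^ n < ρ x}
    set r := (stdNormal d).real {x | 3 ^ n < ρ x}
    have hq : 0 ≤ q := measureReal_nonneg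
    have hr : 0 ≤ r := measureReal_nonneg
    have h3 : q * (49 / 50) ≤ r ^ 2 := (mul_le_mul_of_nonneg_left hcore hq).trans h2
    set s : ℝ := (50 ^ n)⁻¹ with hs
    have hs0 : 0 < s := by positivity
    have hs1 : s ≤ 1 := inv_le_one_of_one_le₀ (one_le_pow₀ (by norm_num))
    have ih' : r ≤ p * s := by rw [hs, ← div_eq_mul_inv]; exact ih
    have h4 : r ^ 2 ≤ (p * s) ^ 2 := by gcongr
    have h5 : (p * s) ^ 2 ≤ 1 / 100 * (p * s) := by
      rw [pow_two]; gcongr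
      nlinarith
    rw [pow_succ, div_mul_eq_div_div, div_eq_mul_inv p, ← hs]
    linarith

/-- The far tail of a sublinear function contributes little to its integral. -/
theorem IsSublinear.lintegral_tail_le {d : ℕ} {ρ : (Fin d → ℝ) → ℝ} (hρ : IsSublinear ρ) {p : ℝ}
    (hp : p ≤ 1 / 100) (h : (stdNormal d).real {x | 1 < ρ x} ≤ p) :
    ∫⁻ x, ENNReal.ofReal (if 3 < ρ x then ρ x else 0) ∂stdNormal d ≤ ENNReal.ofReal (p / 4) := by
  have hm := hρ.measurable
  have hp0 : 0 ≤ p := measureReal_nonneg.trans h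
  have hset : ∀ n : ℕ, MeasurableSet {x | 3 ^ (n + 1) < ρ x} := fun n =>
    measurableSet_lt measurable_const hm
  -- A value above `3` lies in some shell `(3 ^ (n + 1), 3 ^ (n + 2)]`. The terms `3 ^ (n + 2) * p /
  -- 50 ^ (n + 1)` add up to `9 p / 47`.
  have hpt : ∀ x, ENNReal.ofReal (if 3 < ρ x then ρ x else 0) ≤
      ∑' n : ℕ, Set.indicator {x | 3 ^ (n + 1) < ρ x} (fun _ => ENNReal.ofReal (3 ^ (n + 2))) x := by
    intro x
    split_ifs with hx
    · have hex : ∃ n : ℕ, ρ x ≤ 3 ^ n :=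
        (pow_unbounded_of_one_lt (ρ x) (by norm_num : (1 : ℝ) < 3)).imp fun _ h => h.le
      classical
      have h1 := Nat.find_spec hex
      have h2 : 2 ≤ Nat.find hex := by
        by_contra! hlt
        have : (3 : ℝ) ^ Nat.find hex ≤ 3 ^ 1 := pow_le_pow_right₀ (by norm_num) (by omega)
        linarith
      obtain ⟨n, hn⟩ := Nat.exists_eq_add_of_le' h2
      have h3 : 3 ^ (n + 1) < ρ x := not_le.mp (Nat.find_min hex (by omega))
      refine le_trans ?_ (ENNReal.le_tsum n)
      rw [Set.indicator_of_mem (by exact h3)]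
      rw [hn] at h1
      exact ENNReal.ofReal_le_ofReal h1
    · simp
  refine (lintegral_mono hpt).trans ?_
  rw [lintegral_tsum fun n => ((measurable_const.indicator (hset n))).aemeasurable]
  have hterm : ∀ n : ℕ, ∫⁻ x, Set.indicator {x | 3 ^ (n + 1) < ρ x}
      (fun _ => ENNReal.ofReal (3 ^ (n + 2))) x ∂stdNormal d ≤
      ENNReal.ofReal (9 * p / 50 * (3 / 50) ^ n) := by
    intro n
    rw [lintegral_indicator (hset n), setLIntegral_const, ← ofReal_measureReal,
      ← ENNReal.ofReal_mul (by positivity)]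
    apply ENNReal.ofReal_le_ofReal
    calc (3 : ℝ) ^ (n + 2) * (stdNormal d).real {x | 3 ^ (n + 1) < ρ x}
        ≤ 3 ^ (n + 2) * (p / 50 ^ (n + 1)) := by gcongr; exact hρ.tail_le hp h _
      _ = 9 * p / 50 * (3 / 50) ^ n := by rw [div_pow]; field_simp; ring
  refine (ENNReal.tsum_le_tsum hterm).trans ?_
  rw [← ENNReal.ofReal_tsum_of_nonneg (fun n => by positivity)
    ((summable_geometric_of_lt_one (by norm_num) (by norm_num)).mul_left _), tsum_mul_left,
    tsum_geometric_of_lt_one (by norm_num) (by norm_num)]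
  apply ENNReal.ofReal_le_ofReal
  norm_num
  linarith

/-- Quantiles. -/
theorem exists_quantile {Ω : Type*} [MeasurableSpace Ω] (P : Measure Ω) [IsProbabilityMeasure P]
    {M : Ω → ℝ} (hM : Measurable M) {p : ℝ} (hp0 : 0 < p) (hp : p < P.real {ω | 0 < M ω}) :
    ∃ m : ℝ, 0 < m ∧ P.real {ω | m < M ω} ≤ p ∧ p ≤ P.real {ω | m ≤ M ω} := by
  have hgt : ∀ m : ℝ, MeasurableSet {ω | m < M ω} := fun m => measurableSet_lt measurable_const hM
  -- The quantile is the infimum of the levels exceeded with probability at most `p`. The upper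
  -- bound holds there by continuity from below; the lower bound by continuity from above, as no
  -- smaller level belongs to `S`.
  set S : Set ℝ := {m | P.real {ω | m < M ω} ≤ p} with hS
  have hlb : ∀ m ∈ S, 0 ≤ m := by
    intro m hm
    by_contra! hlt
    have : P.real {ω | 0 < M ω} ≤ P.real {ω | m < M ω} :=
      measureReal_mono fun ω (hω : 0 < M ω) => (hlt.trans hω : m < M ω)
    exact absurd (this.trans hm) (not_le.mpr hp)
  have hne : S.Nonempty := by
    have hanti : Antitone fun n : ℕ => {ω | (n : ℝ) < M ω} := fun a b hab ω (hω : (b : ℝ) < M ω) =>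
      (lt_of_le_of_lt (Nat.cast_le.mpr hab) hω : (a : ℝ) < M ω)
    have ht := tendsto_measure_iInter_atTop (μ := P) (s := fun n : ℕ => {ω | (n : ℝ) < M ω})
      (fun n => (hgt n).nullMeasurableSet) hanti ⟨0, measure_ne_top _ _⟩
    have hempty : (⋂ n : ℕ, {ω | (n : ℝ) < M ω}) = ∅ := by
      ext ω
      simp only [Set.mem_iInter, Set.mem_ofPred_eq, Set.mem_empty_iff_false, iff_false, not_forall,
        not_lt]
      exact exists_nat_ge (M ω)
    rw [hempty, measure_empty] at ht
    have ht2 := (ENNReal.tendsto_toReal ENNReal.zero_ne_top).comp ht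
    obtain ⟨n, hn⟩ := (ht2.eventually (gt_mem_nhds (by simpa using hp0))).exists
    exact ⟨n, le_of_lt hn⟩
  have hbdd : BddBelow S := ⟨0, hlb⟩
  set m := sInf S
  have hm0 : 0 ≤ m := le_csInf hne hlb
  have h1 : P.real {ω | m < M ω} ≤ p := by
    have hU : {ω | m < M ω} = ⋃ n : ℕ, {ω | m + 1 / ((n : ℝ) + 1) < M ω} := by
      ext ω
      simp only [Set.mem_ofPred_eq, Set.mem_iUnion]
      constructor
      · intro h
        obtain ⟨n, hn⟩ := exists_nat_one_div_lt (sub_pos.mpr h)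
        exact ⟨n, by linarith⟩
      · rintro ⟨n, hn⟩
        have : (0 : ℝ) < 1 / ((n : ℝ) + 1) := by positivity
        linarith
    have hmono : Monotone fun n : ℕ => {ω | m + 1 / ((n : ℝ) + 1) < M ω} := by
      intro a b hab ω hω
      simp only [Set.mem_ofPred_eq] at hω ⊢
      have := one_div_le_one_div_of_le (by positivity : (0 : ℝ) < (a : ℝ) + 1)
        (by gcongr : (a : ℝ) + 1 ≤ b + 1)
      linarith
    have ht := tendsto_measure_iUnion_atTop (μ := P) hmono
    rw [← hU] at ht
    refine ENNReal.toReal_le_of_le_ofReal hp0.le (le_of_tendsto' ht fun n => ?_)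
    obtain ⟨s, hs, hlt⟩ := exists_lt_of_csInf_lt hne
      (show m < m + 1 / ((n : ℝ) + 1) by linarith [show (0 : ℝ) < 1 / ((n : ℝ) + 1) by positivity])
    have hle : P {ω | m + 1 / ((n : ℝ) + 1) < M ω} ≤ P {ω | s < M ω} :=
      measure_mono fun ω hω => lt_trans hlt hω
    refine hle.trans ?_
    rw [← ofReal_measureReal]
    exact ENNReal.ofReal_le_ofReal hs
  have hmpos : 0 < m := by
    refine lt_of_le_of_ne hm0 fun h => ?_
    rw [← h] at h1
    exact absurd h1 (not_le.mpr hp)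
  refine ⟨m, hmpos, h1, ?_⟩
  have hI : {ω | m ≤ M ω} = ⋂ n : ℕ, {ω | m - 1 / ((n : ℝ) + 1) < M ω} := by
    ext ω
    simp only [Set.mem_ofPred_eq, Set.mem_iInter]
    constructor
    · intro h n
      have : (0 : ℝ) < 1 / ((n : ℝ) + 1) := by positivity
      linarith
    · intro h
      by_contra! hlt
      obtain ⟨n, hn⟩ := exists_nat_one_div_lt (sub_pos.mpr hlt)
      have := h n
      linarith
  have hanti : Antitone fun n : ℕ => {ω | m - 1 / ((n : ℝ) + 1) < M ω} := by
    intro a b hab ω hω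
    simp only [Set.mem_ofPred_eq] at hω ⊢
    have := one_div_le_one_div_of_le (by positivity : (0 : ℝ) < (a : ℝ) + 1)
      (by gcongr : (a : ℝ) + 1 ≤ b + 1)
    linarith
  have ht := tendsto_measure_iInter_atTop (μ := P)
    (s := fun n : ℕ => {ω | m - 1 / ((n : ℝ) + 1) < M ω})
    (fun n => (hgt _).nullMeasurableSet) hanti ⟨0, measure_ne_top _ _⟩
  rw [← hI] at ht
  rw [measureReal_def, ← ENNReal.ofReal_le_iff_le_toReal (measure_ne_top _ _)]
  refine ge_of_tendsto' ht fun n => ?_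
  rw [Function.comp_apply, ENNReal.ofReal_le_iff_le_toReal (measure_ne_top _ _)]
  by_contra! hlt
  have : m ≤ m - 1 / ((n : ℝ) + 1) := csInf_le hbdd hlt.le
  linarith [show (0 : ℝ) < 1 / ((n : ℝ) + 1) by positivity]

/-- The maximum of `c j * z j`, `j ∈ J`. -/
noncomputable def maxFun {K : ℕ} (J : Finset (Fin K)) (hJ : J.Nonempty) (c : Fin K → ℝ)
    (z : Fin K → ℝ) : ℝ :=
  J.sup' hJ fun j => c j * z j

theorem measurable_maxFun {K : ℕ} (J : Finset (Fin K)) (hJ : J.Nonempty) (c : Fin K → ℝ) :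
    Measurable (maxFun J hJ c) := by
  have := Finset.measurable_sup' (s := J) hJ (f := fun j (z : Fin K → ℝ) => c j * z j)
    (fun j _ => by fun_prop)
  convert this using 1
  ext z
  simp [maxFun]

theorem isSublinear_maxFun {d K : ℕ} (J : Finset (Fin K)) (hJ : J.Nonempty) (c : Fin K → ℝ)
    (a : Fin K → Fin d → ℝ) : IsSublinear fun x => maxFun J hJ c fun j => a j ⬝ᵥ x where
  measurable := (measurable_maxFun J hJ c).comp (by fun_prop)
  add_le x y := by
    refine Finset.sup'_le _ _ fun j hj => ?_
    beta_reduce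
    rw [dotProduct_add, mul_add]
    exact add_le_add (Finset.le_sup' (f := fun j => c j * (a j ⬝ᵥ x)) hj)
      (Finset.le_sup' (f := fun j => c j * (a j ⬝ᵥ y)) hj)
  smul r x hr := by
    have h : ∀ j, c j * (a j ⬝ᵥ (r • x)) = r * (c j * (a j ⬝ᵥ x)) := fun j => by
      rw [dotProduct_smul, smul_eq_mul]; ring
    simp only [maxFun, h]
    exact (Finset.apply_sup'_eq_sup'_comp hJ (fun t : ℝ => r * t)
      (fun u v => mul_max_of_nonneg u v hr)).symm

/-- Let the label `y` agree off a small noise set `N` with the maximizer of the affine functions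
`A j - τ j` of a Gaussian vector (with the value `0` for the label `i`), `τ ≥ 0`. If `y ≠ i` has
much larger probability than `N`, then the moment of some label in its own direction is large. -/
theorem exists_large_moment {d K : ℕ} {Ω : Type*} [MeasurableSpace Ω] (P : Measure Ω)
    [IsProbabilityMeasure P] (A : Fin K → Ω → ℝ) (hA : ∀ j, Measurable (A j))
    (a : Fin K → Fin d → ℝ)
    (law : P.map (fun ω j => A j ω) = (stdNormal d).map fun x j => a j ⬝ᵥ x)
    (y : Ω → Fin K) (hy : Measurable y) (J : Finset (Fin K)) (i : Fin K) (hi : i ∉ J)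
    (τ : Fin K → ℝ) (hτ : ∀ j ∈ J, 0 ≤ τ j) (N : Set Ω) (hN : MeasurableSet N)
    (h1 : ∀ ω ∉ N, y ω ≠ i → y ω ∈ J ∧ τ (y ω) < A (y ω) ω ∧
      ∀ k ∈ J, A k ω - τ k ≤ A (y ω) ω - τ (y ω))
    (h2 : ∀ ω ∉ N, y ω = i → ∀ k ∈ J, A k ω ≤ τ k)
    {e : ℝ} (he : 0 < e) (hbig : 1600 * P.real N + e ≤ P.real {ω | y ω ≠ i ∧ ω ∉ N}) :
    ∃ j ∈ J, ∃ m : ℝ, 0 < m ∧ len (a j) ≤ τ j + m ∧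
      e / (200 * K) * (τ j + m) ≤ ∫ ω, A j ω * (if y ω = j then 1 else 0) ∂P := by
  classical
  have hAv : Measurable fun ω j => A j ω := measurable_pi_lambda _ hA
  have hav : Measurable fun (x : Fin d → ℝ) (j : Fin K) => a j ⬝ᵥ x :=
    measurable_pi_lambda _ fun j => measurable_dot_right _
  have hI : (insert i J).Nonempty := ⟨i, Finset.mem_insert_self _ _⟩
  -- The label `i` competes with the constant value `0`. Off the noise, `M` is positive exactly
  -- where `y ≠ i`, and there it is attained at the observed label.
  let g : Fin K → Ω → ℝ := fun j ω => if j = i then 0 else A j ω - τ j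
  let M : Ω → ℝ := (insert i J).sup' hI g
  have hMm : Measurable M := Finset.measurable_sup' hI fun j _ => by
    by_cases hj : j = i
    · simp [g, hj]
    · simp only [g, hj, if_false]; exact (hA j).sub_const _
  have hMapp : ∀ ω, M ω = (insert i J).sup' hI fun j => g j ω := fun ω => by simp [M]
  have hgJ : ∀ j ∈ J, ∀ ω, g j ω = A j ω - τ j := fun j hj ω => by
    simp only [g]; rw [if_neg]; rintro rfl; exact hi hj
  have hgi : ∀ ω, g i ω = 0 := fun ω => by simp [g]
  have hMJ : ∀ j ∈ J, ∀ ω, A j ω - τ j ≤ M ω := fun j hj ω => by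
    rw [hMapp, ← hgJ j hj]
    exact Finset.le_sup' (f := fun j => g j ω) (Finset.mem_insert_of_mem hj)
  have hM1 : ∀ ω ∉ N, y ω ≠ i → M ω = A (y ω) ω - τ (y ω) := by
    intro ω hω hyi
    obtain ⟨hyJ, hlt, hmax⟩ := h1 ω hω hyi
    refine le_antisymm ?_ (hMJ _ hyJ ω)
    rw [hMapp]
    refine Finset.sup'_le _ _ fun j hj => ?_
    rcases Finset.mem_insert.mp hj with rfl | hj
    · rw [hgi]; linarith
    · rw [hgJ j hj]; exact hmax j hj
  have hM2 : ∀ ω ∉ N, y ω = i → M ω ≤ 0 := by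
    intro ω hω hyi
    rw [hMapp]
    refine Finset.sup'_le _ _ fun j hj => ?_
    rcases Finset.mem_insert.mp hj with rfl | hj
    · rw [hgi]
    · rw [hgJ j hj]; linarith [h2 ω hω hyi j hj]
  set η := P.real N
  have hη : 0 ≤ η := measureReal_nonneg
  set q := P.real {ω | y ω ≠ i ∧ ω ∉ N}
  have hq1 : q ≤ 1 := measureReal_le_one
  set p0 := P.real {ω | 0 < M ω}
  have hqp : q ≤ p0 := measureReal_mono fun ω ⟨hyi, hω⟩ => by
    change 0 < M ω
    rw [hM1 ω hω hyi]
    linarith [(h1 ω hω hyi).2.1]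
  -- A level below `p0` makes the quantile positive, and `1 / 100` is required for the tail bound.
  -- The ratio `1600` ensures that the noise is at most a sixteenth of either term of the minimum.
  set p := min (p0 / 2) (1 / 100)
  have hp0 : 0 < p0 := by linarith
  have hppos : 0 < p := lt_min (by linarith) (by norm_num)
  obtain ⟨m, hm, hmlt, hmle⟩ := exists_quantile P hMm hppos
    (lt_of_le_of_lt (min_le_left _ _) (by linarith : p0 / 2 < P.real {ω | 0 < M ω}))
  have hp100 : p ≤ 1 / 100 := min_le_right _ _
  have hηp : η ≤ p / 16 := by
    rw [le_div_iff₀ (by norm_num)]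
    exact le_min (by linarith) (by linarith)
  have hep : e ≤ 100 * p := by
    rw [← div_le_iff₀' (by norm_num)]
    exact le_min (by linarith) (by linarith)
  have hD : ∀ j ∈ J, 0 < τ j + m := fun j hj => by linarith [hτ j hj]
  -- After this scaling some function exceeds `1` only where `M > m`. The coefficient `0` for `i`
  -- makes `R` nonnegative.
  let c : Fin K → ℝ := fun j => if j = i then 0 else (τ j + m)⁻¹
  have hcJ : ∀ j ∈ J, c j = (τ j + m)⁻¹ := fun j hj => by
    simp only [c]; rw [if_neg]; rintro rfl; exact hi hj
  have hci : c i = 0 := by simp [c]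
  let R := maxFun (insert i J) hI c
  have hRm : Measurable R := measurable_maxFun _ _ _
  have hR0 : ∀ z, 0 ≤ R z := fun z => by
    have := Finset.le_sup' (f := fun j => c j * z j) (Finset.mem_insert_self i J)
    simp only [hci, zero_mul] at this
    exact this
  have hRJ : ∀ j ∈ J, ∀ z, c j * z j ≤ R z := fun j hj z =>
    Finset.le_sup' (f := fun j => c j * z j) (Finset.mem_insert_of_mem hj)
  have hsub := isSublinear_maxFun (insert i J) hI c a
  have hmapset : ∀ B : Set (Fin K → ℝ), MeasurableSet B →
      (stdNormal d).real {x | (fun j => a j ⬝ᵥ x) ∈ B} = P.real {ω | (fun j => A j ω) ∈ B} := by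
    intro B hB
    have e1 := Measure.map_apply (μ := P) hAv hB
    have e2 := Measure.map_apply (μ := stdNormal d) hav hB
    rw [law, e2] at e1
    simp only [measureReal_def]
    exact congrArg ENNReal.toReal e1
  have hR1 : (stdNormal d).real {x | 1 < maxFun (insert i J) hI c fun j => a j ⬝ᵥ x} ≤ p := by
    refine (hmapset {z | 1 < R z} (measurableSet_lt measurable_const hRm)).trans_le ?_
    refine (measureReal_mono fun ω hω => ?_).trans hmlt
    change 1 < R _ at hω
    change m < M ω
    simp only [R, maxFun] at hω
    obtain ⟨j, hj, hlt⟩ := (Finset.lt_sup'_iff _).mp hω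
    rcases Finset.mem_insert.mp hj with rfl | hj
    · simp [hci] at hlt; linarith
    · rw [hcJ j hj, inv_mul_eq_div, one_lt_div (hD j hj)] at hlt
      linarith [hMJ j hj ω]
  have htail := hsub.lintegral_tail_le hp100 hR1
  -- the tail under `P`
  let F : Ω → ℝ := fun ω => if 3 < R (-fun j => A j ω) then R (-fun j => A j ω) else 0
  have hFm : Measurable F := by
    have h3 : Measurable fun ω => R (-fun j => A j ω) := hRm.comp hAv.neg
    exact Measurable.ite (measurableSet_lt measurable_const h3) h3 measurable_const
  have hF0 : ∀ ω, 0 ≤ F ω := fun ω => by simp only [F]; split_ifs; exacts [hR0 _, le_rfl]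
  have hFtail : ∫⁻ ω, ENNReal.ofReal (F ω) ∂P ≤ ENNReal.ofReal (p / 4) := by
    let φ : (Fin K → ℝ) → ENNReal := fun z => ENNReal.ofReal (if 3 < R (-z) then R (-z) else 0)
    have hφ : Measurable φ := by
      have h3 : Measurable fun z => R (-z) := hRm.comp measurable_neg
      exact (Measurable.ite (measurableSet_lt measurable_const h3) h3 measurable_const).ennreal_ofReal
    have e1 : ∫⁻ ω, ENNReal.ofReal (F ω) ∂P = ∫⁻ z, φ z ∂P.map (fun ω j => A j ω) :=
      (lintegral_map hφ hAv).symm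
    rw [e1, law, lintegral_map hφ hav]
    have hψ : Measurable fun x : Fin d → ℝ => φ fun j => a j ⬝ᵥ x := hφ.comp hav
    -- On the noise the observed label may be the worst one, which is why the tail of `R` at the
    -- negated functions is needed; by symmetry it is the same.
    rw [← (measurePreserving_neg_stdNormal d).lintegral_comp hψ]
    refine le_trans (le_of_eq (lintegral_congr fun x => ?_)) htail
    simp only [φ, dotProduct_neg]
    have : (-fun j => -(a j ⬝ᵥ x)) = fun j => a j ⬝ᵥ x := by ext j; simp
    rw [this]
  have hFint : Integrable F P :=
    ⟨hFm.aestronglyMeasurable, by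
      rw [hasFiniteIntegral_iff_ofReal (ae_of_all _ hF0)]
      exact hFtail.trans_lt ENNReal.ofReal_lt_top⟩
  have hFle : ∫ ω, F ω ∂P ≤ p / 4 := by
    rw [integral_eq_lintegral_of_nonneg_ae (ae_of_all _ hF0) hFm.aestronglyMeasurable]
    exact ENNReal.toReal_le_of_le_ofReal (by positivity) hFtail
  have hAint : ∀ j, Integrable (A j) P := by
    intro j
    have h3 : (P.map fun ω j => A j ω).map (fun z => z j) =
        ((stdNormal d).map fun x j => a j ⬝ᵥ x).map fun z => z j := by rw [law]
    rw [Measure.map_map (measurable_pi_apply j) hAv, Measure.map_map (measurable_pi_apply j) hav]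
      at h3
    have h4 : Integrable id ((stdNormal d).map ((fun z : Fin K → ℝ => z j) ∘
        fun x j => a j ⬝ᵥ x)) := by
      rw [integrable_map_measure (by fun_prop) (by fun_prop)]
      exact (memLp_dot (a j)).integrable (by norm_num)
    rw [← h3, integrable_map_measure (by fun_prop) (by fun_prop)] at h4
    exact h4
  have hymeas : ∀ j, MeasurableSet {ω | y ω = j} := fun j => hy (measurableSet_singleton j)
  have hAyint : ∀ j, Integrable (fun ω => A j ω * (if y ω = j then 1 else 0)) P := by
    intro j
    have := (hAint j).indicator (hymeas j)
    refine this.congr (ae_of_all _ fun ω => ?_)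
    by_cases h : y ω = j <;> simp [Set.indicator, h]
  -- The integrand is at least `1` at clean points with `m ≤ M`, nonnegative at the other clean
  -- points, and at least `-3 - F` on the noise. Subtracting `4` on the noise also undoes the
  -- indicator of `m ≤ M` there. The integral is at least `p - 4 * (p / 16) - p / 4`.
  have hsum : p / 2 ≤ ∑ j ∈ J, c j * ∫ ω, A j ω * (if y ω = j then 1 else 0) ∂P := by
    have hMset : MeasurableSet {ω | m ≤ M ω} := measurableSet_le measurable_const hMm
    have hpt : ∀ ω, Set.indicator {ω | m ≤ M ω} 1 ω - 4 * Set.indicator N 1 ω - F ω ≤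
        ∑ j ∈ J, c j * (A j ω * (if y ω = j then 1 else 0)) := by
      intro ω
      have hS : ∑ j ∈ J, c j * (A j ω * (if y ω = j then 1 else 0)) =
          if y ω ∈ J then c (y ω) * A (y ω) ω else 0 := by
        simp [mul_ite, Finset.sum_ite_eq]
      rw [hS]
      by_cases hω : ω ∈ N
      · have h4 : Set.indicator {ω | m ≤ M ω} (1 : Ω → ℝ) ω ≤ 1 :=
          Set.indicator_le_self' (fun _ _ => zero_le_one) ω
        have h5 : -R (-fun j => A j ω) ≤ if y ω ∈ J then c (y ω) * A (y ω) ω else 0 := by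
          split_ifs with hyJ
          · have := hRJ _ hyJ (-fun j => A j ω)
            simp only [Pi.neg_apply] at this
            linarith
          · linarith [hR0 (-fun j => A j ω)]
        have h6 : R (-fun j => A j ω) ≤ 3 + F ω := by
          simp only [F]; split_ifs with h; exacts [by linarith, by linarith]
        rw [Set.indicator_of_mem hω]
        simp only [Pi.one_apply]
        linarith
      · rw [Set.indicator_of_notMem hω]
        by_cases hyi : y ω = i
        · have h4 := hM2 ω hω hyi
          rw [Set.indicator_of_notMem (show ω ∉ {ω | m ≤ M ω} from
            fun (h : m ≤ M ω) => by linarith), if_neg (by rw [hyi]; exact hi)]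
          linarith [hF0 ω]
        · obtain ⟨hyJ, hlt, -⟩ := h1 ω hω hyi
          rw [if_pos hyJ, hcJ _ hyJ, inv_mul_eq_div]
          have hτy := hτ _ hyJ
          by_cases hmM : m ≤ M ω
          · rw [Set.indicator_of_mem (show ω ∈ {ω | m ≤ M ω} from hmM)]
            have : 1 ≤ A (y ω) ω / (τ (y ω) + m) := by
              rw [one_le_div (hD _ hyJ)]; linarith [hM1 ω hω hyi]
            simp only [Pi.one_apply]
            linarith [hF0 ω]
          · rw [Set.indicator_of_notMem (show ω ∉ {ω | m ≤ M ω} from hmM)]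
            have : 0 ≤ A (y ω) ω / (τ (y ω) + m) :=
              div_nonneg (by linarith) (hD _ hyJ).le
            linarith [hF0 ω]
    have hi1 : Integrable (Set.indicator {ω | m ≤ M ω} (1 : Ω → ℝ)) P :=
      (integrable_const (1 : ℝ)).indicator hMset
    have hi2 : Integrable (Set.indicator N (1 : Ω → ℝ)) P := (integrable_const (1 : ℝ)).indicator hN
    have h5 := integral_mono ((hi1.sub (hi2.const_mul 4)).sub hFint)
      (integrable_finsetSum J fun j _ => (hAyint j).const_mul (c j)) hpt
    rw [integral_finsetSum J fun j _ => (hAyint j).const_mul (c j)] at h5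
    simp only [integral_const_mul] at h5
    have h6 : ∫ ω, ((Set.indicator {ω | m ≤ M ω} (1 : Ω → ℝ) - fun ω => 4 * Set.indicator N 1 ω) -
        F : Ω → ℝ) ω ∂P = P.real {ω | m ≤ M ω} - 4 * P.real N - ∫ ω, F ω ∂P := by
      rw [integral_sub' (hi1.sub (hi2.const_mul 4)) hFint, integral_sub' hi1 (hi2.const_mul 4),
        integral_const_mul, integral_indicator_one hMset, integral_indicator_one hN]
    rw [h6] at h5
    linarith
  have hK : (0 : ℝ) < K := by exact_mod_cast i.pos
  -- Some label receives at least its share `p / (2 K)` of the sum, and `e ≤ 100 p`.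
  obtain ⟨j, hj, hjle⟩ : ∃ j ∈ J, e / (200 * K) ≤
      c j * ∫ ω, A j ω * (if y ω = j then 1 else 0) ∂P := by
    by_contra! hcon
    have h6 : ∑ j ∈ J, c j * ∫ ω, A j ω * (if y ω = j then 1 else 0) ∂P ≤
        ∑ _j ∈ J, e / (200 * K) := Finset.sum_le_sum fun j hj => (hcon j hj).le
    have hJne : J.Nonempty := by
      rw [Finset.nonempty_iff_ne_empty]; rintro rfl
      simp at hsum; linarith
    have h7 : ∑ j ∈ J, c j * ∫ ω, A j ω * (if y ω = j then 1 else 0) ∂P <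
        ∑ _j ∈ J, e / (200 * K) := Finset.sum_lt_sum_of_nonempty hJne hcon
    have h8 : (J.card : ℝ) ≤ K := by
      exact_mod_cast (Finset.card_le_univ J).trans_eq (Fintype.card_fin K)
    have h9 : ∑ _j ∈ J, e / (200 * K) ≤ e / 200 := by
      rw [Finset.sum_const, nsmul_eq_mul]
      calc (J.card : ℝ) * (e / (200 * K)) ≤ K * (e / (200 * K)) := by gcongr
        _ = e / 200 := by field_simp
    linarith
  refine ⟨j, hj, m, hm, ?_, ?_⟩
  -- A single rescaled functional exceeds `1` only where `R` does, thus with probability at most `1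
  -- / 100`.
  · refine len_le_of_tail _ (hD j hj) (lt_of_le_of_lt (b := ENNReal.ofReal p) ?_ ?_)
    · rw [← ofReal_measureReal]
      refine ENNReal.ofReal_le_ofReal ((measureReal_mono fun x hx => ?_).trans hR1)
      change 1 < R _
      refine lt_of_lt_of_le ?_ (hRJ j hj _)
      rw [hcJ j hj, inv_mul_eq_div, one_lt_div (hD j hj)]
      exact hx
    · rw [ENNReal.ofReal_lt_ofReal_iff (by norm_num)]; linarith
  · rw [hcJ j hj, inv_mul_eq_div, le_div_iff₀ (hD j hj)] at hjle
    exact hjle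

/-! ### Orthogonal projections -/

/-- Orthonormal families of vectors. -/
def IsOrtho {d k : ℕ} (v : Fin k → Fin d → ℝ) : Prop :=
  ∀ i j, v i ⬝ᵥ v j = if i = j then 1 else 0

/-- The projection onto the span of an orthonormal family. -/
def proj {d k : ℕ} (v : Fin k → Fin d → ℝ) (x : Fin d → ℝ) : Fin d → ℝ :=
  ∑ i, (v i ⬝ᵥ x) • v i

/-- The projection onto the orthogonal complement of the span of an orthonormal family. -/
def perp {d k : ℕ} (v : Fin k → Fin d → ℝ) (x : Fin d → ℝ) : Fin d → ℝ :=
  x - proj v x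

section proj

variable {d k : ℕ} {v : Fin k → Fin d → ℝ}

theorem dot_proj (v : Fin k → Fin d → ℝ) (a x : Fin d → ℝ) :
    a ⬝ᵥ proj v x = ∑ i, (v i ⬝ᵥ a) * (v i ⬝ᵥ x) := by
  simp only [proj, dotProduct_sum, dotProduct_smul, smul_eq_mul]
  exact Finset.sum_congr rfl fun i _ => by rw [dotProduct_comm a, mul_comm]

theorem dot_proj_comm (v : Fin k → Fin d → ℝ) (a x : Fin d → ℝ) :
    a ⬝ᵥ proj v x = proj v a ⬝ᵥ x := by
  rw [dotProduct_comm (proj v a), dot_proj, dot_proj]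
  exact Finset.sum_congr rfl fun i _ => mul_comm _ _

theorem dot_perp_comm (v : Fin k → Fin d → ℝ) (a x : Fin d → ℝ) :
    a ⬝ᵥ perp v x = perp v a ⬝ᵥ x := by
  rw [perp, perp, dotProduct_sub, sub_dotProduct, dot_proj_comm]

theorem proj_add_perp (v : Fin k → Fin d → ℝ) (x : Fin d → ℝ) : proj v x + perp v x = x := by
  simp [perp]

theorem IsOrtho.dot_proj_self (hv : IsOrtho v) (i : Fin k) (x : Fin d → ℝ) :
    v i ⬝ᵥ proj v x = v i ⬝ᵥ x := by
  rw [dot_proj]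
  simp [hv _ i]

theorem IsOrtho.dot_perp_self (hv : IsOrtho v) (i : Fin k) (x : Fin d → ℝ) :
    v i ⬝ᵥ perp v x = 0 := by
  rw [perp, dotProduct_sub, hv.dot_proj_self, sub_self]

theorem IsOrtho.proj_proj (hv : IsOrtho v) (x : Fin d → ℝ) : proj v (proj v x) = proj v x := by
  simp only [proj]
  exact Finset.sum_congr rfl fun i _ => by rw [← proj, hv.dot_proj_self]

theorem IsOrtho.proj_perp (hv : IsOrtho v) (x : Fin d → ℝ) : proj v (perp v x) = 0 := by
  simp [proj, hv.dot_perp_self]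

theorem IsOrtho.proj_dot_perp (hv : IsOrtho v) (x y : Fin d → ℝ) : proj v x ⬝ᵥ perp v y = 0 := by
  rw [dotProduct_comm, dot_proj_comm, hv.proj_perp, zero_dotProduct]

theorem IsOrtho.pythagoras (hv : IsOrtho v) (x : Fin d → ℝ) :
    x ⬝ᵥ x = proj v x ⬝ᵥ proj v x + perp v x ⬝ᵥ perp v x := by
  conv_lhs => rw [← proj_add_perp v x]
  rw [add_dotProduct, dotProduct_add, dotProduct_add, hv.proj_dot_perp,
    dotProduct_comm (perp v x) (proj v x), hv.proj_dot_perp]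
  ring

theorem IsOrtho.proj_dot_proj (hv : IsOrtho v) (x : Fin d → ℝ) :
    proj v x ⬝ᵥ proj v x = ∑ i, (v i ⬝ᵥ x) ^ 2 := by
  rw [← dot_proj_comm, hv.proj_proj, dot_proj]
  exact Finset.sum_congr rfl fun i _ => by ring

/-- Bessel's inequality. -/
theorem IsOrtho.bessel (hv : IsOrtho v) (x : Fin d → ℝ) : ∑ i, (v i ⬝ᵥ x) ^ 2 ≤ x ⬝ᵥ x := by
  rw [← hv.proj_dot_proj, hv.pythagoras x]
  linarith [dotProduct_self_nonneg' (perp v x)]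

theorem IsOrtho.len_proj_le (hv : IsOrtho v) (x : Fin d → ℝ) : len (proj v x) ≤ len x := by
  apply Real.sqrt_le_sqrt
  rw [hv.pythagoras x]
  linarith [dotProduct_self_nonneg' (perp v x)]

@[fun_prop] theorem measurable_proj (v : Fin k → Fin d → ℝ) : Measurable (proj v) := by
  unfold proj; fun_prop

@[fun_prop] theorem measurable_perp (v : Fin k → Fin d → ℝ) : Measurable (perp v) := by
  unfold perp; fun_prop

/-- The reflection at the span of an orthonormal family preserves the normal distribution. -/
theorem IsOrtho.measurePreserving_reflection (hv : IsOrtho v) :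
    MeasurePreserving (fun x => proj v x - perp v x) (stdNormal d) (stdNormal d) := by
  refine measurePreserving_of_dot _ (by fun_prop) (fun a => proj v a - perp v a) (fun a x => ?_)
    fun a => ?_
  · rw [dotProduct_sub, sub_dotProduct, dot_proj_comm, dot_perp_comm]
  · rw [hv.pythagoras a]
    simp only [sub_dotProduct, dotProduct_sub, hv.proj_dot_perp,
      dotProduct_comm (perp v a) (proj v a)]
    ring

end proj

/-! ### Linear classifiers -/

/-- `f` is the linear classifier with weight vectors `w` and thresholds `t`. -/
def IsClassifier {d K : ℕ} (w : Fin K → Fin d → ℝ) (t : Fin K → ℝ)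
    (f : (Fin d → ℝ) → Fin K) : Prop :=
  ∀ x, IsLeast {i | ∀ j, w j ⬝ᵥ x + t j ≤ w i ⬝ᵥ x + t i} (f x)

section classifier

variable {d K : ℕ} {w : Fin K → Fin d → ℝ} {t : Fin K → ℝ} {f : (Fin d → ℝ) → Fin K}

theorem IsClassifier.eq_iff (hf : IsClassifier w t f) (x : Fin d → ℝ) (i : Fin K) :
    f x = i ↔ (∀ j, w j ⬝ᵥ x + t j ≤ w i ⬝ᵥ x + t i) ∧
      ∀ j, (∀ l, w l ⬝ᵥ x + t l ≤ w j ⬝ᵥ x + t j) → i ≤ j := by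
  constructor
  · rintro rfl; exact ⟨(hf x).1, fun j hj => (hf x).2 hj⟩
  · rintro ⟨h1, h2⟩
    exact le_antisymm ((hf x).2 h1) (h2 _ (hf x).1)

theorem IsClassifier.measurable (hf : IsClassifier w t f) : Measurable f := by
  refine measurable_to_countable' fun i => ?_
  have hset : f ⁻¹' {i} = {x | (∀ j, w j ⬝ᵥ x + t j ≤ w i ⬝ᵥ x + t i) ∧
      ∀ j, (∀ l, w l ⬝ᵥ x + t l ≤ w j ⬝ᵥ x + t j) → i ≤ j} := by
    ext x; exact hf.eq_iff x i
  rw [hset]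
  have h1 : ∀ i j, Measurable fun x => w j ⬝ᵥ x + t j ≤ w i ⬝ᵥ x + t i := fun i j =>
    measurableSet_setOfPred.mp (measurableSet_le (by fun_prop) (by fun_prop))
  refine measurableSet_setOfPred.mpr (Measurable.and (Measurable.forall fun j => h1 i j)
    (Measurable.forall fun j => Measurable.imp (Measurable.forall fun l => h1 j l) measurable_const))

/-- The class depends only on the outcomes of the pairwise comparisons, ties included. So it can
change only where some comparison flips. -/
theorem IsClassifier.congr (hf : IsClassifier w t f) {x x' : Fin d → ℝ}
    (h : ∀ a b, w a ⬝ᵥ x + t a ≤ w b ⬝ᵥ x + t b ↔ w a ⬝ᵥ x' + t a ≤ w b ⬝ᵥ x' + t b) :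
    f x = f x' := by
  rw [hf.eq_iff]
  simp only [h]
  exact (hf.eq_iff x' _).mp rfl

/-- The regions of a linear classifier are closed under midpoints. -/
theorem IsClassifier.midpoint (hf : IsClassifier w t f) {x y m : Fin d → ℝ} (hxy : f x = f y)
    (hm : ∀ a : Fin d → ℝ, a ⬝ᵥ m = (a ⬝ᵥ x + a ⬝ᵥ y) / 2) : f m = f x := by
  obtain ⟨h1, h2⟩ := (hf.eq_iff x _).mp rfl
  obtain ⟨h3, h4⟩ := (hf.eq_iff y _).mp hxy.symm
  rw [hf.eq_iff]
  refine ⟨fun j => ?_, fun j hj => h2 j fun l => ?_⟩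
  · have := h1 j
    have := h3 j
    rw [hm, hm]; linarith
  · have e1 := h1 l
    have e2 := h1 j
    have e3 := h3 j
    have e4 := hj (f x)
    rw [hm, hm] at e4
    linarith

/-- The classifier at the projection of a point is, up to a factor two, the best prediction from
the projection. -/
theorem IsClassifier.proj_optimal (hf : IsClassifier w t f) {k : ℕ} {v : Fin k → Fin d → ℝ}
    (hv : IsOrtho v) {h : (Fin d → ℝ) → Fin K} (hh : Measurable h) :
    (stdNormal d).real {x | f x ≠ f (proj v x)} ≤
      2 * (stdNormal d).real {x | f x ≠ h (proj v x)} := by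
  set B := {x | f x ≠ h (proj v x)}
  have hB : MeasurableSet B :=
    (measurableSet_eq_fun hf.measurable (hh.comp (measurable_proj v))).compl
  have hR := hv.measurePreserving_reflection
  have h1 := hR.measureReal_preimage hB.nullMeasurableSet
  have hproj : ∀ x, proj v (proj v x - perp v x) = proj v x := by
    intro x
    have : ∀ a b, proj v (a - b) = proj v a - proj v b := fun a b => by
      simp only [proj, dotProduct_sub, sub_smul, Finset.sum_sub_distrib]
    rw [this, hv.proj_proj, hv.proj_perp, sub_zero]
  -- The point `proj v x` is the midpoint of `x` and its reflection, which have the same projection.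
  -- If `h` predicts both classes correctly, they agree, and by convexity the midpoint has the same
  -- class.
  have hsub : {x | f x ≠ f (proj v x)} ⊆ B ∪ (fun x => proj v x - perp v x) ⁻¹' B := by
    intro x hx
    by_contra hcon
    simp only [Set.mem_union, not_or, B, Set.mem_preimage, Set.mem_ofPred_eq, not_not, hproj]
      at hcon
    refine hx (hf.midpoint (x := x) (y := proj v x - perp v x) ?_ fun a => ?_).symm
    · rw [hcon.1, hcon.2]
    · conv_rhs => rw [← dotProduct_add]
      have : x + (proj v x - perp v x) = (2 : ℝ) • proj v x := by
        rw [perp]; module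
      rw [this, dotProduct_smul, smul_eq_mul]; ring
  calc _ ≤ (stdNormal d).real (B ∪ (fun x => proj v x - perp v x) ⁻¹' B) := measureReal_mono hsub
    _ ≤ _ := measureReal_union_le _ _
    _ = _ := by rw [h1]; ring

/-- A union bound over pairs of labels. -/
theorem measureReal_pairs_le {Ω : Type*} [MeasurableSpace Ω] (P : Measure Ω) [IsFiniteMeasure P]
    {K : ℕ} (S : Fin K → Fin K → Set Ω) {c : ℝ} (h : ∀ a b, P.real (S a b) ≤ c) :
    P.real (⋃ a, ⋃ b, S a b) ≤ K ^ 2 * c := by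
  calc P.real (⋃ a, ⋃ b, S a b) ≤ ∑ a, P.real (⋃ b, S a b) := measureReal_iUnion_fintype_le _
    _ ≤ ∑ _a : Fin K, ∑ _b : Fin K, c := by
        gcongr with a _
        exact (measureReal_iUnion_fintype_le _).trans (Finset.sum_le_sum fun b _ => h a b)
    _ = _ := by simp; ring

/-- Perturbing the projection of a random point rarely changes the class. -/
theorem IsClassifier.proj_stable (hf : IsClassifier w t f) {k : ℕ} (v : Fin k → Fin d → ℝ)
    {r : ℝ} (hr : 0 ≤ r) (G : Set (Fin d → ℝ)) (π : (Fin d → ℝ) → Fin d → ℝ)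
    (hπ : ∀ x ∈ G, ∀ a : Fin d → ℝ, |a ⬝ᵥ (proj v x - π x)| ≤ r * len (proj v a)) :
    (stdNormal d).real {x | x ∈ G ∧ f (proj v x) ≠ f (π x)} ≤ K ^ 2 * r := by
  -- A comparison flips between `proj v x` and `π x` only in a slab around its boundary. The width
  -- is relative to the length of the projected difference, so anti-concentration gives `r` however
  -- short that is. If the projected difference is zero, no flip is possible.
  let S : Fin K → Fin K → Set (Fin d → ℝ) := fun a b =>
    {x | proj v (w b - w a) ≠ 0 ∧ |proj v (w b - w a) ⬝ᵥ x + (t b - t a)| ≤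
      r * len (proj v (w b - w a))}
  refine le_trans (measureReal_mono ?_) (measureReal_pairs_le _ S (c := r) fun a b => ?_)
  · rintro x ⟨hxG, hx⟩
    by_contra hcon
    refine hx (hf.congr fun a b => ?_)
    simp only [Set.mem_iUnion, not_exists, S, Set.mem_ofPred_eq, not_and, not_le] at hcon
    have h1 := hcon a b
    have h2 := hπ x hxG (w b - w a)
    rw [dotProduct_sub, ← dot_proj_comm] at *
    by_cases h0 : proj v (w b - w a) = 0
    · rw [h0, len, zero_dotProduct, Real.sqrt_zero, mul_zero] at h2
      have h3 := abs_nonpos_iff.mp h2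
      rw [sub_dotProduct, sub_dotProduct] at h3
      constructor <;> intro h <;> linarith
    · have h3 := h1 h0
      rw [sub_dotProduct, sub_dotProduct] at h2
      rw [sub_dotProduct] at h3
      rw [abs_le] at h2
      rcases lt_abs.mp h3 with h4 | h4
      · constructor <;> intro h <;> linarith
      · constructor <;> intro h <;> linarith
  · by_cases h0 : proj v (w b - w a) = 0
    · simp [S, h0, hr]
    · refine ENNReal.toReal_le_of_le_ofReal hr (le_trans (measure_mono ?_)
        (stdNormal_slab_le h0 (t b - t a) r))
      exact fun x hx => hx.2

end classifier

/-! ### Approximating a classifier on the cells of a partition -/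

/-- A partition of part of the space into finitely many cells which only depend on the products
with the vectors `v`, each of them with a representative close to the projections of its points. -/
structure CellData {d k : ℕ} (v : Fin k → Fin d → ℝ) (r : ℝ) (ι : Type*) where
  cells : Finset ι
  cell : (Fin d → ℝ) → Option ι
  rep : ι → Fin d → ℝ
  mem_cells : ∀ x j, cell x = some j → j ∈ cells
  exists_eq : ∀ j, ∃ B : Set (Fin k → ℝ), MeasurableSet B ∧
    {x | cell x = some j} = {x | (fun i => v i ⬝ᵥ x) ∈ B}
  close : ∀ x j, cell x = some j → ∀ a : Fin d → ℝ, |a ⬝ᵥ (proj v x - rep j)| ≤ r * len (proj v a)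

section cells

variable {d k K : ℕ} {v : Fin k → Fin d → ℝ} {r : ℝ} {ι : Type*}

/-- The points of a cell. -/
def CellData.cellSet (C : CellData v r ι) (j : ι) : Set (Fin d → ℝ) := {x | C.cell x = some j}

theorem CellData.measurableSet_cellSet (C : CellData v r ι) (j : ι) :
    MeasurableSet (C.cellSet j) := by
  obtain ⟨B, hB, h⟩ := C.exists_eq j
  rw [cellSet, h]
  exact measurableSet_preimage (measurable_pi_lambda _ fun i => measurable_dot_right _) hB

/-- The labelled examples whose point lies in a cell. -/
def CellData.exampleSet (C : CellData v r ι) (K : ℕ) (j : ι) : Set ((Fin d → ℝ) × Fin K) :=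
  Prod.fst ⁻¹' C.cellSet j

theorem CellData.measurableSet_exampleSet (C : CellData v r ι) (j : ι) :
    MeasurableSet (C.exampleSet K j) := measurable_fst (C.measurableSet_cellSet j)

/-- The conditional moment `E[perp v x * 1(y = l) | C]`. -/
noncomputable def condMoment (D : Measure ((Fin d → ℝ) × Fin K)) (v : Fin k → Fin d → ℝ)
    (S : Set ((Fin d → ℝ) × Fin K)) (l : Fin K) : Fin d → ℝ :=
  fun n => ∫ p, perp v p.1 n * (if p.2 = l then 1 else 0) ∂D[|S]

variable {D : Measure ((Fin d → ℝ) × Fin K)}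

theorem measure_fst_preimage (hD : D.map Prod.fst = stdNormal d) {S : Set (Fin d → ℝ)}
    (hS : MeasurableSet S) : D (Prod.fst ⁻¹' S) = stdNormal d S := by
  rw [← hD, Measure.map_apply measurable_fst hS]

theorem measureReal_fst_preimage (hD : D.map Prod.fst = stdNormal d) {S : Set (Fin d → ℝ)}
    (hS : MeasurableSet S) : D.real (Prod.fst ⁻¹' S) = (stdNormal d).real S := by
  rw [measureReal_def, measureReal_def, measure_fst_preimage hD hS]

variable [IsProbabilityMeasure D]

omit [IsProbabilityMeasure D] in
/-- Within a cell, functionals orthogonal to `v` keep their law. -/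
theorem CellData.map_cond (hD : D.map Prod.fst = stdNormal d) (C : CellData v r ι) (j : ι)
    (hj : D (C.exampleSet K j) ≠ 0) {m : ℕ} (a : Fin m → Fin d → ℝ)
    (ha : ∀ i l, v i ⬝ᵥ a l = 0) :
    (D[|C.exampleSet K j]).map (fun p l => a l ⬝ᵥ p.1) =
      (stdNormal d).map fun x l => a l ⬝ᵥ x := by
  have hav : Measurable fun (x : Fin d → ℝ) (l : Fin m) => a l ⬝ᵥ x :=
    measurable_pi_lambda _ fun j => measurable_dot_right _
  have hvv : Measurable fun (x : Fin d → ℝ) (i : Fin k) => v i ⬝ᵥ x :=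
    measurable_pi_lambda _ fun j => measurable_dot_right _
  have hcell := C.measurableSet_cellSet j
  obtain ⟨B, hB, hBeq⟩ := C.exists_eq j
  have hind := indepFun_dot v a ha
  ext S hS
  rw [Measure.map_apply (f := fun p : (Fin d → ℝ) × Fin K => fun l => a l ⬝ᵥ p.1)
    (hav.comp measurable_fst) hS, Measure.map_apply hav hS,
    cond_apply (C.measurableSet_exampleSet j)]
  have h1 : C.exampleSet K j ∩ (fun p : (Fin d → ℝ) × Fin K => fun l => a l ⬝ᵥ p.1) ⁻¹' S =
      Prod.fst ⁻¹' ((fun x i => v i ⬝ᵥ x) ⁻¹' B ∩ (fun x l => a l ⬝ᵥ x) ⁻¹' S) := by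
    rw [exampleSet, cellSet, hBeq]; rfl
  have h2 : C.exampleSet K j = Prod.fst ⁻¹' ((fun x i => v i ⬝ᵥ x) ⁻¹' B) := by
    rw [exampleSet, cellSet, hBeq]; rfl
  rw [h1, measure_fst_preimage hD ((hvv hB).inter (hav hS)), hind.measure_inter_preimage_eq_mul B S hB hS, h2,
    measure_fst_preimage hD (hvv hB), ← mul_assoc, ENNReal.inv_mul_cancel, one_mul]
  · rw [h2, measure_fst_preimage hD (hvv hB)] at hj; exact hj
  · exact measure_ne_top _ _

-- The functional of `a` on the orthogonal part is that of `perp v a`, which is orthogonal to the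
-- family and hence independent of the cell.
omit [IsProbabilityMeasure D] in
theorem CellData.map_cond_perp (hD : D.map Prod.fst = stdNormal d) (hv : IsOrtho v)
    (C : CellData v r ι) (j : ι) (hj : D (C.exampleSet K j) ≠ 0) (a : Fin d → ℝ) :
    (D[|C.exampleSet K j]).map (fun p => a ⬝ᵥ perp v p.1) =
      (stdNormal d).map fun x => perp v a ⬝ᵥ x := by
  have h := C.map_cond hD j hj (fun _ : Fin 1 => perp v a) fun i _ => hv.dot_perp_self i a
  have h2 := congrArg (fun μ => μ.map fun z : Fin 1 → ℝ => z 0) h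
  rw [Measure.map_map (measurable_pi_apply 0) (by fun_prop),
    Measure.map_map (measurable_pi_apply 0) (by fun_prop)] at h2
  simpa only [Function.comp_def, ← dot_perp_comm] using h2

omit [IsProbabilityMeasure D] in
theorem CellData.integral_perp_sq (hD : D.map Prod.fst = stdNormal d) (hv : IsOrtho v)
    (C : CellData v r ι) (j : ι) (hj : D (C.exampleSet K j) ≠ 0) (a : Fin d → ℝ) :
    MemLp (fun p => a ⬝ᵥ perp v p.1) 2 (D[|C.exampleSet K j]) ∧
    ∫ p, (a ⬝ᵥ perp v p.1) ^ 2 ∂(D[|C.exampleSet K j]) = perp v a ⬝ᵥ perp v a := by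
  have h := C.map_cond_perp hD hv j hj a
  have hm : Measurable fun p : (Fin d → ℝ) × Fin K => a ⬝ᵥ perp v p.1 := by fun_prop
  constructor
  · have h1 : MemLp id 2 ((stdNormal d).map fun x => perp v a ⬝ᵥ x) := by
      rw [memLp_map_measure_iff (by fun_prop) (by fun_prop)]
      exact memLp_dot (perp v a)
    rw [← h, memLp_map_measure_iff (by fun_prop) (by fun_prop)] at h1
    exact h1
  · rw [← integral_dot_sq]
    have h1 := integral_map (μ := D[|C.exampleSet K j]) hm.aemeasurable (f := fun z : ℝ => z ^ 2)
      (by fun_prop)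
    have h2 := integral_map (μ := stdNormal d) (measurable_dot_right (perp v a)).aemeasurable
      (f := fun z : ℝ => z ^ 2) (by fun_prop)
    rw [← h1, ← h2, h]

theorem CellData.integrable_perp (hD : D.map Prod.fst = stdNormal d) (hv : IsOrtho v)
    (C : CellData v r ι) (j : ι) (hj : D (C.exampleSet K j) ≠ 0) (a : Fin d → ℝ) (l : Fin K) :
    Integrable (fun p => (a ⬝ᵥ perp v p.1) * (if p.2 = l then 1 else 0))
      (D[|C.exampleSet K j]) := by
  have : IsProbabilityMeasure (D[|C.exampleSet K j]) := cond_isProbabilityMeasure hj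
  have h1 := (C.integral_perp_sq hD hv j hj a).1.integrable (by norm_num)
  have hset : MeasurableSet {p : (Fin d → ℝ) × Fin K | p.2 = l} :=
    measurable_snd (measurableSet_singleton l)
  refine (h1.indicator hset).congr (ae_of_all _ fun p => ?_)
  by_cases h : p.2 = l <;> simp [Set.indicator, h]

theorem CellData.dot_condMoment (hD : D.map Prod.fst = stdNormal d) (hv : IsOrtho v)
    (C : CellData v r ι) (j : ι) (hj : D (C.exampleSet K j) ≠ 0) (a : Fin d → ℝ) (l : Fin K) :
    a ⬝ᵥ condMoment D v (C.exampleSet K j) l =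
      ∫ p, (a ⬝ᵥ perp v p.1) * (if p.2 = l then 1 else 0) ∂D[|C.exampleSet K j] := by
  have hi : ∀ n, Integrable (fun p => perp v p.1 n * (if p.2 = l then 1 else 0))
      (D[|C.exampleSet K j]) := by
    intro n
    simpa using C.integrable_perp hD hv j hj (Pi.single n 1) l
  simp only [dotProduct, condMoment, Finset.sum_mul]
  rw [integral_finsetSum]
  · refine Finset.sum_congr rfl fun n _ => ?_
    rw [← integral_const_mul]
    simp only [mul_assoc]
  · intro n _
    simpa only [mul_assoc] using (hi n).const_mul (a n)

/-- Conditional moments have length at most one. -/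
theorem CellData.condMoment_sq_le (hD : D.map Prod.fst = stdNormal d) (hv : IsOrtho v)
    (C : CellData v r ι) (j : ι) (l : Fin K) :
    condMoment D v (C.exampleSet K j) l ⬝ᵥ condMoment D v (C.exampleSet K j) l ≤ 1 := by
  by_cases hj : D (C.exampleSet K j) = 0
  · have : condMoment D v (C.exampleSet K j) l = 0 := by
      ext n
      simp [condMoment, cond_eq_zero_of_meas_eq_zero hj]
    simp [this]
  have : IsProbabilityMeasure (D[|C.exampleSet K j]) := cond_isProbabilityMeasure hj
  set u := condMoment D v (C.exampleSet K j) l with hu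
  set P := D[|C.exampleSet K j]
  obtain ⟨hL2, hsq⟩ := C.integral_perp_sq hD hv j hj u
  have h1 : u ⬝ᵥ u = ∫ p, (u ⬝ᵥ perp v p.1) * (if p.2 = l then 1 else 0) ∂P :=
    C.dot_condMoment hD hv j hj u l
  -- By `z ≤ (z ^ 2 + 1) / 2` and the unchanged second moment, `u ⬝ᵥ u` is at most `(u ⬝ᵥ u + 1) /
  -- 2`.
  have h2 : ∀ p : (Fin d → ℝ) × Fin K, (u ⬝ᵥ perp v p.1) * (if p.2 = l then 1 else 0) ≤
      ((u ⬝ᵥ perp v p.1) ^ 2 + 1) / 2 := by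
    intro p
    split_ifs
    · nlinarith [sq_nonneg (u ⬝ᵥ perp v p.1 - 1)]
    · nlinarith [sq_nonneg (u ⬝ᵥ perp v p.1)]
  have h3 := integral_mono (C.integrable_perp hD hv j hj u l)
    ((hL2.integrable_sq.add (integrable_const 1)).div_const 2) h2
  have h4 : ∫ p, ((u ⬝ᵥ perp v p.1) ^ 2 + 1) / 2 ∂P = (perp v u ⬝ᵥ perp v u + 1) / 2 := by
    rw [integral_div, integral_add hL2.integrable_sq (integrable_const 1), hsq]
    simp
  have h5 : perp v u ⬝ᵥ perp v u ≤ u ⬝ᵥ u := by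
    rw [hv.pythagoras u]
    linarith [dotProduct_self_nonneg' (proj v u)]
  change _ ≤ ∫ p, (((u ⬝ᵥ perp v p.1) ^ 2 + 1) / 2) ∂P at h3
  rw [h4, ← h1] at h3
  linarith

end cells

/-! ### Cells on which no constant label is good -/

/-- Points at which a perturbation of the classifier may change the class. -/
def unstableSet {d K k : ℕ} (w : Fin K → Fin d → ℝ) (t : Fin K → ℝ) (v : Fin k → Fin d → ℝ)
    (r α : ℝ) : Set (Fin d → ℝ) :=
  (⋃ a, ⋃ b, {x | w b - w a ≠ 0 ∧
      |(w b - w a) ⬝ᵥ x + (t b - t a)| ≤ (r + α) * len (w b - w a)}) ∪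
    ⋃ a, ⋃ b, {x | α⁻¹ * len (perp v (w b - w a)) < |perp v (w b - w a) ⬝ᵥ x|}

/-- Unstable or mislabelled examples. -/
def noiseSet {d K k : ℕ} (w : Fin K → Fin d → ℝ) (t : Fin K → ℝ) (f : (Fin d → ℝ) → Fin K)
    (v : Fin k → Fin d → ℝ) (r α : ℝ) : Set ((Fin d → ℝ) × Fin K) :=
  {p | f p.1 ≠ p.2} ∪ Prod.fst ⁻¹' unstableSet w t v r α

section

variable {d K k : ℕ} {w : Fin K → Fin d → ℝ} {t : Fin K → ℝ} {f : (Fin d → ℝ) → Fin K}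
  {v : Fin k → Fin d → ℝ} {r α : ℝ} {ι : Type*}
  {D : Measure ((Fin d → ℝ) × Fin K)}

theorem measurableSet_unstableSet (w : Fin K → Fin d → ℝ) (t : Fin K → ℝ)
    (v : Fin k → Fin d → ℝ) (r α : ℝ) : MeasurableSet (unstableSet w t v r α) := by
  refine MeasurableSet.union (MeasurableSet.iUnion fun a => MeasurableSet.iUnion fun b => ?_)
    (MeasurableSet.iUnion fun a => MeasurableSet.iUnion fun b => ?_)
  · have h : MeasurableSet {x | |(w b - w a) ⬝ᵥ x + (t b - t a)| ≤ (r + α) * len (w b - w a)} :=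
      measurableSet_le ((measurable_dot_right _).add_const _).abs measurable_const
    exact (MeasurableSet.const (w b - w a ≠ 0)).inter h
  · exact measurableSet_lt measurable_const (measurable_dot_right _).abs

/-- For each of the `K ^ 2` pairs the slab has mass at most `r + α` by anti-concentration, and the
tail at most `α ^ 2 ≤ α` by Chebyshev's inequality. -/
theorem measureReal_unstableSet_le (w : Fin K → Fin d → ℝ) (t : Fin K → ℝ)
    (v : Fin k → Fin d → ℝ) (hr : 0 ≤ r) (hα : 0 < α) (hα1 : α ≤ 1) :
    (stdNormal d).real (unstableSet w t v r α) ≤ K ^ 2 * (r + 2 * α) := by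
  refine (measureReal_union_le _ _).trans ?_
  have h1 := measureReal_pairs_le (stdNormal d) (fun a b : Fin K => {x | w b - w a ≠ 0 ∧
      |(w b - w a) ⬝ᵥ x + (t b - t a)| ≤ (r + α) * len (w b - w a)}) (c := r + α) fun a b => ?_
  · have h2 := measureReal_pairs_le (stdNormal d) (fun a b : Fin K =>
      {x | α⁻¹ * len (perp v (w b - w a)) < |perp v (w b - w a) ⬝ᵥ x|}) (c := α) fun a b => ?_
    · linarith
    · refine ENNReal.toReal_le_of_le_ofReal hα.le ((stdNormal_tail_le _ (inv_pos.mpr hα)).trans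
        (ENNReal.ofReal_le_ofReal ?_))
      simp only [inv_pow, one_div, inv_inv]
      nlinarith
  · by_cases h0 : w b - w a = 0
    · simp only [h0]
      simp; linarith
    · exact ENNReal.toReal_le_of_le_ofReal (by linarith) ((measure_mono fun x hx => hx.2).trans
        (stdNormal_slab_le h0 (t b - t a) (r + α)))

variable [IsProbabilityMeasure D]

theorem IsClassifier.measurableSet_err (hf : IsClassifier w t f) :
    MeasurableSet {p : (Fin d → ℝ) × Fin K | f p.1 ≠ p.2} :=
  (measurableSet_eq_fun (hf.measurable.comp measurable_fst) measurable_snd).compl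

theorem IsClassifier.measurableSet_noiseSet (hf : IsClassifier w t f) :
    MeasurableSet (noiseSet w t f v r α) :=
  hf.measurableSet_err.union (measurable_fst (measurableSet_unstableSet _ _ _ _ _))

omit [IsProbabilityMeasure D] in
theorem measureReal_noiseSet_le (hD : D.map Prod.fst = stdNormal d) (hr : 0 ≤ r) (hα : 0 < α)
    (hα1 : α ≤ 1) :
    D.real (noiseSet w t f v r α) ≤ err D f + K ^ 2 * (r + 2 * α) := by
  refine (measureReal_union_le _ _).trans (add_le_add le_rfl ?_)
  rw [measureReal_fst_preimage hD (measurableSet_unstableSet _ _ _ _ _)]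
  exact measureReal_unstableSet_le _ _ _ hr hα hα1

/-- If a cell contains many examples that are not in the class of its representative, compared to
the noise, then some conditional moment has a large product with a difference of weight vectors. -/
theorem IsClassifier.exists_moment_of_bad_cell (hf : IsClassifier w t f)
    (hD : D.map Prod.fst = stdNormal d) (hv : IsOrtho v) (hr : 0 ≤ r) (hα : 0 < α)
    (C : CellData v r ι) (j : ι) {e : ℝ} (he : 0 < e)
    (hj : D (C.exampleSet K j) ≠ 0)
    (hbad : 1601 * D.real (C.exampleSet K j ∩ noiseSet w t f v r α) +
      e * D.real (C.exampleSet K j) ≤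
      D.real (C.exampleSet K j ∩ {p | f p.1 ≠ f (C.rep j)})) :
    ∃ l a b, w b - w a ≠ 0 ∧ α ^ 2 * e / (200 * K) * len (w b - w a) ≤
      (w b - w a) ⬝ᵥ condMoment D v (C.exampleSet K j) l := by
  classical
  set S := C.exampleSet K j with hS
  have hSm : MeasurableSet S := C.measurableSet_exampleSet j
  have : IsProbabilityMeasure (D[|S]) := cond_isProbabilityMeasure hj
  set P := D[|S] with hP
  set i := f (C.rep j) with hi
  set N := noiseSet w t f v r α with hNdef
  have hNm : MeasurableSet N := hf.measurableSet_noiseSet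
  have hDS : 0 < D.real S := ENNReal.toReal_pos hj (measure_ne_top _ _)
  have hcond : ∀ A : Set ((Fin d → ℝ) × Fin K), P.real A = (D.real S)⁻¹ * D.real (S ∩ A) := by
    intro A
    rw [hP, measureReal_def, cond_apply hSm, ENNReal.toReal_mul, ENNReal.toReal_inv]
    rfl
  -- Within the cell the advantage of `b` over `i` is `a b ⬝ᵥ x - τ b` up to the size of the cell,
  -- and `τ b ≥ 0` because `i` wins at the representative. The set `J` drops the labels whose
  -- difference lies almost inside the subspace: they cannot occur off the noise. For the remaining
  -- ones a bound in terms of `a b` becomes one in terms of `u b`, at the price of `α ^ 2`.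
  let u : Fin K → Fin d → ℝ := fun b => w b - w i
  let a : Fin K → Fin d → ℝ := fun b => perp v (u b)
  let J : Finset (Fin K) := Finset.univ.filter fun b => u b ≠ 0 ∧ α ^ 2 * len (u b) ≤ len (a b)
  let τ : Fin K → ℝ := fun b => -(u b ⬝ᵥ C.rep j + (t b - t i))
  have hτ : ∀ b, 0 ≤ τ b := by
    intro b
    have := ((hf.eq_iff (C.rep j) i).mp hi.symm).1 b
    simp only [τ, u, sub_dotProduct]; linarith
  -- affine functions at a point of the cell
  have hkey : ∀ p ∈ S, ∀ b c : Fin K, |(a c ⬝ᵥ p.1 - τ c) - (a b ⬝ᵥ p.1 - τ b) -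
      ((w c - w b) ⬝ᵥ p.1 + (t c - t b))| ≤ r * len (w c - w b) := by
    intro p hp b c
    have h1 := C.close p.1 j hp (w c - w b)
    have h2 : (a c ⬝ᵥ p.1 - τ c) - (a b ⬝ᵥ p.1 - τ b) - ((w c - w b) ⬝ᵥ p.1 + (t c - t b)) =
        -((w c - w b) ⬝ᵥ (proj v p.1 - C.rep j)) := by
      have e1 : (w c - w b) ⬝ᵥ p.1 = (w c - w b) ⬝ᵥ proj v p.1 + (w c - w b) ⬝ᵥ perp v p.1 := by
        rw [← dotProduct_add, proj_add_perp]
      have e2 : a c ⬝ᵥ p.1 - a b ⬝ᵥ p.1 = (w c - w b) ⬝ᵥ perp v p.1 := by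
        simp only [a, u, ← dot_perp_comm, sub_dotProduct]; ring
      simp only [τ, u]
      rw [e1, dotProduct_sub]
      simp only [sub_dotProduct] at e2 ⊢
      linarith
    rw [h2, abs_neg]
    exact h1.trans (mul_le_mul_of_nonneg_left (hv.len_proj_le _) hr)
  have hai : a i = 0 := by simp [a, u, perp, proj]
  have hτi : τ i = 0 := by simp [τ, u]
  -- off the noise set
  have hclean : ∀ p ∉ N, f p.1 = p.2 ∧ (∀ b c, w c - w b ≠ 0 →
      (r + α) * len (w c - w b) < |(w c - w b) ⬝ᵥ p.1 + (t c - t b)|) ∧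
      ∀ b, |a b ⬝ᵥ p.1| ≤ α⁻¹ * len (a b) := by
    intro p hp
    simp only [hNdef, noiseSet, unstableSet, Set.mem_union, not_or, Set.mem_ofPred_eq, not_not,
      Set.mem_preimage, Set.mem_iUnion, not_exists, not_and, not_le, not_lt] at hp
    exact ⟨hp.1, fun b c => hp.2.1 b c, fun b => hp.2.2 i b⟩
  have hlarge : ∀ p ∉ N, p ∈ S → ∀ b c, w c - w b ≠ 0 →
      0 ≤ (w c - w b) ⬝ᵥ p.1 + (t c - t b) → a b ⬝ᵥ p.1 - τ b < a c ⬝ᵥ p.1 - τ c := by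
    intro p hpN hpS b c hne hnn
    have h1 := (hclean p hpN).2.1 b c hne
    rw [abs_of_nonneg hnn] at h1
    have h2 := abs_le.mp (hkey p hpS b c)
    have h3 : 0 < α * len (w c - w b) := mul_pos hα (len_pos hne)
    linarith
  have hle : ∀ p ∉ N, p ∈ S → ∀ b, a b ⬝ᵥ p.1 - τ b ≤ a p.2 ⬝ᵥ p.1 - τ p.2 := by
    intro p hpN hpS b
    have h1 := ((hf.eq_iff p.1 p.2).mp (hclean p hpN).1).1 b
    have h0 : 0 ≤ (w p.2 - w b) ⬝ᵥ p.1 + (t p.2 - t b) := by rw [sub_dotProduct]; linarith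
    by_cases hne : w p.2 - w b = 0
    · have h2 := abs_le.mp (hkey p hpS b p.2)
      rw [hne] at h2 h0
      simp only [len, zero_dotProduct, Real.sqrt_zero, mul_zero] at h2
      rw [zero_dotProduct] at h0
      linarith
    · exact (hlarge p hpN hpS b p.2 hne h0).le
  -- If the weight vectors of the label and of `i` were equal, the thresholds would be too, since
  -- each label is maximal at some point. The smallest index rule would then select the same label
  -- at both points.
  have hne_i : ∀ p ∉ N, p.2 ≠ i → u p.2 ≠ 0 := by
    intro p hpN hpi h0
    have hw : w p.2 = w i := sub_eq_zero.mp h0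
    obtain ⟨h1, h2⟩ := (hf.eq_iff p.1 p.2).mp (hclean p hpN).1
    obtain ⟨h3, h4⟩ := (hf.eq_iff (C.rep j) i).mp hi.symm
    have e1 := h1 i
    have e2 := h3 p.2
    rw [hw] at e1 e2
    have ht : t p.2 = t i := by linarith
    refine hpi (le_antisymm (h2 i fun l => ?_) (h4 p.2 fun l => ?_))
    · have := h1 l; rw [hw, ht] at this; exact this
    · have := h3 l; rw [hw, ht]; exact this
  have hmain := exists_large_moment P (fun b p => a b ⬝ᵥ p.1) (fun b => by fun_prop) a
    (C.map_cond hD j hj a fun m l => hv.dot_perp_self m (u l)) Prod.snd measurable_snd J i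
    (by simp [J, u]) τ (fun b _ => hτ b) (N ∪ Sᶜ) (hNm.union hSm.compl) ?_ ?_ he ?_
  · obtain ⟨b, hb, m, hm, hlen, hmom⟩ := hmain
    refine ⟨b, i, b, (Finset.mem_filter.mp hb).2.1, ?_⟩
    rw [C.dot_condMoment hD hv j hj]
    have h1 : ∫ p, ((w b - w i) ⬝ᵥ perp v p.1) * (if p.2 = b then 1 else 0) ∂P =
        ∫ p, (a b ⬝ᵥ p.1) * (if p.2 = b then 1 else 0) ∂P := by
      simp only [dot_perp_comm]; rfl
    rw [← hS, ← hP, h1]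
    refine le_trans ?_ hmom
    have h2 : α ^ 2 * len (u b) ≤ τ b + m := (Finset.mem_filter.mp hb).2.2.trans hlen
    calc α ^ 2 * e / (200 * K) * len (w b - w i) = e / (200 * K) * (α ^ 2 * len (u b)) := by
          simp only [u]; ring
      _ ≤ _ := by gcongr
  · intro p hp hpi
    simp only [Set.mem_union, Set.mem_compl_iff, not_or, not_not] at hp
    obtain ⟨hpN, hpS⟩ := hp
    have hne := hne_i p hpN hpi
    obtain ⟨hfp, hslab, hbig⟩ := hclean p hpN
    have h1 := ((hf.eq_iff p.1 p.2).mp hfp).1 i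
    have h0 : 0 ≤ (w p.2 - w i) ⬝ᵥ p.1 + (t p.2 - t i) := by rw [sub_dotProduct]; linarith
    have h2 := hlarge p hpN hpS i p.2 hne h0
    rw [hai, hτi, zero_dotProduct] at h2
    refine ⟨?_, by linarith, fun b _ => hle p hpN hpS b⟩
    refine Finset.mem_filter.mpr ⟨Finset.mem_univ _, hne, ?_⟩
    -- At a clean point a short `a` contributes at most `α⁻¹ * len a < α * len u`. Since `τ ≥ 0`,
    -- this is less than the margin by which the label must beat `i` off the slab.
    by_contra! hlt
    have h3 := hslab i p.2 hne
    rw [abs_of_nonneg h0] at h3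
    have h4 := abs_le.mp (hkey p hpS i p.2)
    rw [hai, hτi, zero_dotProduct] at h4
    have h5 := abs_le.mp (hbig p.2)
    have h6 : α⁻¹ * len (a p.2) < α * len (u p.2) := by
      rw [inv_mul_lt_iff₀ hα]
      calc len (a p.2) < α ^ 2 * len (u p.2) := hlt
        _ = _ := by ring
    have h7 := hτ p.2
    change α⁻¹ * len (a p.2) < α * len (w p.2 - w i) at h6
    linarith
  · intro p hp hpi b hb
    simp only [Set.mem_union, Set.mem_compl_iff, not_or, not_not] at hp
    have h1 := hle p hp.1 hp.2 b
    rw [hpi, hai, hτi, zero_dotProduct] at h1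
    change a b ⬝ᵥ p.1 ≤ τ b
    linarith
  · have h1 : P.real (N ∪ Sᶜ) = (D.real S)⁻¹ * D.real (S ∩ N) := by
      rw [hcond, Set.inter_union_distrib_left, Set.inter_compl_self, Set.union_empty]
    have h2 : P.real {p : (Fin d → ℝ) × Fin K | p.2 ≠ i ∧ p ∉ N ∪ Sᶜ} =
        (D.real S)⁻¹ * D.real (S ∩ {p : (Fin d → ℝ) × Fin K | p.2 ≠ i ∧ p ∉ N ∪ Sᶜ}) := hcond _
    rw [h1, h2]
    -- Replacing the class of `f` by the label costs one more noise mass, which turns `1600` into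
    -- `1601`.
    have h3 : D.real (S ∩ {p | f p.1 ≠ i}) ≤
        D.real (S ∩ {p : (Fin d → ℝ) × Fin K | p.2 ≠ i ∧ p ∉ N ∪ Sᶜ}) + D.real (S ∩ N) := by
      refine (measureReal_mono ?_).trans (measureReal_union_le _ _)
      rintro p ⟨hpS, hpi⟩
      by_cases hpN : p ∈ N
      · exact Or.inr ⟨hpS, hpN⟩
      · refine Or.inl ⟨hpS, ?_, ?_⟩
        · rw [← (hclean p hpN).1]; exact hpi
        · simp [hpN, hpS]
    have h4 : e = (D.real S)⁻¹ * (e * D.real S) := by field_simp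
    rw [h4, ← mul_assoc, mul_comm 1600, mul_assoc, ← mul_add]
    gcongr
    linarith

/-- The cells are disjoint, as `C.cell` assigns at most one index to a point. -/
theorem CellData.sum_measureReal_le (C : CellData v r ι) (J : Finset ι)
    (A : Set ((Fin d → ℝ) × Fin K)) (hA : MeasurableSet A) :
    ∑ j ∈ J, D.real (C.exampleSet K j ∩ A) ≤ D.real A := by
  rw [← measureReal_biUnion_finset]
  · exact measureReal_mono (Set.iUnion₂_subset fun j _ => Set.inter_subset_right)
  · intro i _ j _ hij
    refine Set.disjoint_left.mpr ?_
    rintro p ⟨hp, -⟩ ⟨hp', -⟩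
    have h1 : C.cell p.1 = some i := hp
    have h2 : C.cell p.1 = some j := hp'
    rw [h1] at h2
    exact hij (Option.some.inj h2)
  · exact fun j _ => (C.measurableSet_exampleSet j).inter hA

/-- If predicting the class from the projection is much worse than the classifier, then many cells
are bad. -/
theorem IsClassifier.bad_cells_mass (hf : IsClassifier w t f)
    (hD : D.map Prod.fst = stdNormal d) (hr : 0 ≤ r)
    (C : CellData v r ι) {e : ℝ} (he : 0 < e)
    (hbig : (stdNormal d).real {x | C.cell x = none} + K ^ 2 * r +
      1601 * D.real (noiseSet w t f v r α) + 2 * e ≤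
      (stdNormal d).real {x | f x ≠ f (proj v x)}) (B : Finset ι) (hBsub : B ⊆ C.cells)
    (hB : ∀ j ∈ C.cells, D (C.exampleSet K j) ≠ 0 →
      1601 * D.real (C.exampleSet K j ∩ noiseSet w t f v r α) + e * D.real (C.exampleSet K j) ≤
        D.real (C.exampleSet K j ∩ {p | f p.1 ≠ f (C.rep j)}) → j ∈ B) :
    e ≤ ∑ j ∈ B, D.real (C.exampleSet K j) := by
  classical
  set N := noiseSet w t f v r α
  have hNm : MeasurableSet N := hf.measurableSet_noiseSet
  set G : Set (Fin d → ℝ) := {x | C.cell x ≠ none}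
  let π : (Fin d → ℝ) → Fin d → ℝ := fun x => match C.cell x with
    | some j => C.rep j
    | none => 0
  have hπ : ∀ x j, C.cell x = some j → π x = C.rep j := fun x j h => by simp only [π, h]
  have hstab := hf.proj_stable v hr G π (by
    intro x hx a
    obtain ⟨j, hj⟩ := Option.ne_none_iff_exists'.mp hx
    rw [hπ x j hj]
    exact C.close x j hj a)
  -- A disagreement is charged to a point outside all cells, or to a change of class between the
  -- projection and the representative, or to a disagreement with the representative inside the
  -- cell.
  have h1 : (stdNormal d).real {x | f x ≠ f (proj v x)} ≤
      (stdNormal d).real {x | C.cell x = none} + K ^ 2 * r +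
        ∑ j ∈ C.cells, D.real (C.exampleSet K j ∩ {p | f p.1 ≠ f (C.rep j)}) := by
    have hsub : {x | f x ≠ f (proj v x)} ⊆ ({x | C.cell x = none} ∪
        {x | x ∈ G ∧ f (proj v x) ≠ f (π x)}) ∪
        ⋃ j ∈ C.cells, (C.cellSet j ∩ {x | f x ≠ f (C.rep j)}) := by
      intro x hx
      rcases hc : C.cell x with _ | j
      · exact Or.inl (Or.inl hc)
      · by_cases hfx : f (proj v x) = f (π x)
        · right
          refine Set.mem_iUnion₂.mpr ⟨j, C.mem_cells x j hc, hc, ?_⟩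
          rw [hπ x j hc] at hfx
          change f x ≠ _
          rw [← hfx]; exact hx
        · exact Or.inl (Or.inr ⟨by simp [G, hc], hfx⟩)
    refine (measureReal_mono hsub).trans ((measureReal_union_le _ _).trans (add_le_add
      ((measureReal_union_le _ _).trans (add_le_add le_rfl hstab)) ?_))
    refine (measureReal_biUnion_finset_le _ _).trans (Finset.sum_le_sum fun j _ => le_of_eq ?_)
    exact (measureReal_fst_preimage hD ((C.measurableSet_cellSet j).inter
      (measurableSet_eq_fun hf.measurable measurable_const).compl)).symm
  have h2 := C.sum_measureReal_le (D := D) C.cells N hNm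
  have h3 : ∑ j ∈ C.cells, D.real (C.exampleSet K j) ≤ 1 := by
    have := C.sum_measureReal_le (D := D) C.cells Set.univ MeasurableSet.univ
    simpa using this
  -- The cells outside `B` exceed their share of the noise by at most `e` times their mass, thus by
  -- at most `e` in total. Of the excess `2 e` at least `e` remains for `B`.
  have h4 : ∀ j ∈ C.cells, D.real (C.exampleSet K j ∩ {p | f p.1 ≠ f (C.rep j)}) -
      1601 * D.real (C.exampleSet K j ∩ N) ≤ e * D.real (C.exampleSet K j) +
        if j ∈ B then D.real (C.exampleSet K j) else 0 := by
    intro j hj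
    have hp : 0 ≤ D.real (C.exampleSet K j) := measureReal_nonneg
    have hN0 : 0 ≤ D.real (C.exampleSet K j ∩ N) := measureReal_nonneg
    have hle : D.real (C.exampleSet K j ∩ {p | f p.1 ≠ f (C.rep j)}) ≤ D.real (C.exampleSet K j) :=
      measureReal_mono Set.inter_subset_left
    have hep := mul_nonneg he.le hp
    split_ifs with hjB
    · linarith
    · by_cases h0 : D (C.exampleSet K j) = 0
      · have : D.real (C.exampleSet K j) = 0 := by simp [measureReal_def, h0]
        linarith
      · have := mt (hB j hj h0) hjB
        linarith
  have h5 := Finset.sum_le_sum h4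
  rw [Finset.sum_sub_distrib, ← Finset.mul_sum, Finset.sum_add_distrib, ← Finset.mul_sum,
    Finset.sum_ite_mem, Finset.inter_eq_right.mpr hBsub] at h5
  have h6 : e * ∑ j ∈ C.cells, D.real (C.exampleSet K j) ≤ e := by nlinarith
  linarith

end

/-! ### Eigenvectors with large eigenvalues -/

/-- An orthonormal family of `d` vectors spans `ℝ^d`. -/
theorem IsOrtho.proj_eq_self {d : ℕ} {e : Fin d → Fin d → ℝ} (he : IsOrtho e) (x : Fin d → ℝ) :
    proj e x = x := by
  have h1 : Matrix.of e * (Matrix.of e).transpose = 1 := by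
    ext i j
    simp only [Matrix.mul_apply, Matrix.transpose_apply, Matrix.of_apply, Matrix.one_apply]
    exact he i j
  have h2 := mul_eq_one_comm.mp h1
  have h3 : Matrix.mulVec ((Matrix.of e).transpose * Matrix.of e) x = x := by
    rw [h2, Matrix.one_mulVec]
  rw [← Matrix.mulVec_mulVec] at h3
  conv_rhs => rw [← h3]
  ext n
  simp [proj, Matrix.mulVec, dotProduct, mul_comm]

theorem IsOrtho.parseval {d : ℕ} {e : Fin d → Fin d → ℝ} (he : IsOrtho e) (x : Fin d → ℝ) :
    ∑ r, (e r ⬝ᵥ x) ^ 2 = x ⬝ᵥ x := by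
  rw [← he.proj_dot_proj, he.proj_eq_self]

section spectral

variable {d : ℕ} {ι : Type*} {I : Finset ι} {c : ι → ℝ} {p : ι → Fin d → ℝ}
  {e : Fin d → Fin d → ℝ} {lam : Fin d → ℝ}

/-- The bilinear form of a weighted sum of outer products. Its values at eigenvectors give the
spectral facts below. -/
theorem dot_mulVec_sum_outer (I : Finset ι) (c : ι → ℝ) (p : ι → Fin d → ℝ) (x y : Fin d → ℝ) :
    x ⬝ᵥ Matrix.mulVec (Matrix.of fun a b => ∑ i ∈ I, c i * (p i a * p i b)) y =
      ∑ i ∈ I, c i * ((p i ⬝ᵥ x) * (p i ⬝ᵥ y)) := by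
  have h : Matrix.mulVec (Matrix.of fun a b => ∑ i ∈ I, c i * (p i a * p i b)) y =
      ∑ i ∈ I, (c i * (p i ⬝ᵥ y)) • p i := by
    ext a
    simp only [Matrix.mulVec, dotProduct, Matrix.of_apply, Finset.sum_mul, Finset.sum_apply,
      Pi.smul_apply, smul_eq_mul, Finset.mul_sum]
    rw [Finset.sum_comm]
    exact Finset.sum_congr rfl fun i _ => Finset.sum_congr rfl fun b _ => by ring
  rw [h, dotProduct_sum]
  refine Finset.sum_congr rfl fun i _ => ?_
  rw [dotProduct_smul, dotProduct_comm x, smul_eq_mul]; ring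

variable (he : IsOrtho e)
  (heig : ∀ r, Matrix.mulVec (Matrix.of fun a b => ∑ i ∈ I, c i * (p i a * p i b)) (e r) =
    lam r • e r)

include he heig in
theorem eigenvalue_eq (r : Fin d) : lam r = ∑ i ∈ I, c i * (p i ⬝ᵥ e r) ^ 2 := by
  have h := dot_mulVec_sum_outer I c p (e r) (e r)
  rw [heig, dotProduct_smul, he r r] at h
  simp only [if_true, smul_eq_mul, mul_one] at h
  rw [h]
  exact Finset.sum_congr rfl fun i _ => by ring

include he heig in
theorem quadratic_eq (x : Fin d → ℝ) :
    ∑ i ∈ I, c i * (p i ⬝ᵥ x) ^ 2 = ∑ r, lam r * (e r ⬝ᵥ x) ^ 2 := by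
  have h := dot_mulVec_sum_outer I c p x x
  have h2 : x ⬝ᵥ Matrix.mulVec (Matrix.of fun a b => ∑ i ∈ I, c i * (p i a * p i b)) x =
      ∑ r, lam r * (e r ⬝ᵥ x) ^ 2 := by
    conv_lhs => rw [show Matrix.mulVec (Matrix.of fun a b => ∑ i ∈ I, c i * (p i a * p i b)) x =
      Matrix.mulVec (Matrix.of fun a b => ∑ i ∈ I, c i * (p i a * p i b)) (proj e x) by
        rw [he.proj_eq_self]]
    rw [proj, Matrix.mulVec_sum, dotProduct_sum]
    refine Finset.sum_congr rfl fun r _ => ?_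
    rw [Matrix.mulVec_smul, heig, dotProduct_smul, dotProduct_smul, dotProduct_comm x]
    simp only [smul_eq_mul]; ring
  rw [← h2, h]
  exact Finset.sum_congr rfl fun i _ => by ring

-- Both sides are the trace, by Parseval's identity in the eigenbasis.
include he heig in
theorem eigenvalue_sum : ∑ r, lam r = ∑ i ∈ I, c i * (p i ⬝ᵥ p i) := by
  simp only [eigenvalue_eq he heig]
  rw [Finset.sum_comm]
  refine Finset.sum_congr rfl fun i _ => ?_
  rw [← Finset.mul_sum, ← he.parseval (p i)]
  simp only [dotProduct_comm (p i)]

variable (hc : ∀ i ∈ I, 0 ≤ c i) {T σ : ℝ} (hT : ∑ i ∈ I, c i * (p i ⬝ᵥ p i) ≤ T) (hσ : 0 < σ)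

include he heig hc in
theorem eigenvalue_nonneg (r : Fin d) : 0 ≤ lam r := by
  rw [eigenvalue_eq he heig]
  exact Finset.sum_nonneg fun i hi => mul_nonneg (hc i hi) (sq_nonneg _)

include he heig hc hT in
theorem eigenvalue_le (r : Fin d) : lam r ≤ T := by
  rw [← eigenvalue_sum he heig] at hT
  exact (Finset.single_le_sum (fun r _ => eigenvalue_nonneg he heig hc r)
    (Finset.mem_univ r)).trans hT

-- Markov's inequality for nonnegative eigenvalues with sum at most `T`; it limits how fast the
-- subspace grows.
include he heig hc hT in
theorem card_large_eigenvalues :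
    ((Finset.univ.filter fun r => σ ≤ lam r).card : ℝ) * σ ≤ T := by
  rw [← eigenvalue_sum he heig] at hT
  calc ((Finset.univ.filter fun r => σ ≤ lam r).card : ℝ) * σ
      = ∑ _r ∈ Finset.univ.filter fun r => σ ≤ lam r, σ := by simp
    _ ≤ ∑ r ∈ Finset.univ.filter fun r => σ ≤ lam r, lam r :=
        Finset.sum_le_sum fun r hr => (Finset.mem_filter.mp hr).2
    _ ≤ ∑ r, lam r := Finset.sum_le_sum_of_subset_of_nonneg (Finset.filter_subset _ _)
        fun r _ _ => eigenvalue_nonneg he heig hc r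
    _ ≤ T := hT

include he heig hc hT hσ in
/-- The eigenvectors with large eigenvalues capture vectors on which the quadratic form is
large. -/
theorem large_eigenvectors_capture {κ : Type*} (Q : Finset κ) (q : κ → Fin d → ℝ)
    (hq : ∀ i ∈ Q, q i ⬝ᵥ q i ≤ 1) :
    ∑ j ∈ Q, ∑ i ∈ I, c i * (p i ⬝ᵥ q j) ^ 2 - σ * Q.card ≤
      T * ∑ r ∈ Finset.univ.filter fun r => σ ≤ lam r, ∑ j ∈ Q, (e r ⬝ᵥ q j) ^ 2 := by
  have h1 : ∀ j ∈ Q, ∑ i ∈ I, c i * (p i ⬝ᵥ q j) ^ 2 - σ ≤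
      T * ∑ r ∈ Finset.univ.filter fun r => σ ≤ lam r, (e r ⬝ᵥ q j) ^ 2 := by
    intro j hj
    rw [quadratic_eq he heig, Finset.mul_sum, Finset.sum_filter]
    -- Large eigenvalues are bounded by the trace bound `T`. The others are below `σ`, and by
    -- Parseval their part is at most `σ` for a vector of length at most one.
    have h2 : ∑ r, lam r * (e r ⬝ᵥ q j) ^ 2 ≤
        ∑ r, ((if σ ≤ lam r then T * (e r ⬝ᵥ q j) ^ 2 else 0) + σ * (e r ⬝ᵥ q j) ^ 2) := by
      refine Finset.sum_le_sum fun r _ => ?_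
      have h0 := sq_nonneg (e r ⬝ᵥ q j)
      split_ifs with h
      · have := eigenvalue_le he heig hc hT r
        nlinarith
      · have : lam r ≤ σ := (not_le.mp h).le
        nlinarith
    rw [Finset.sum_add_distrib, ← Finset.mul_sum, he.parseval] at h2
    have := mul_le_mul_of_nonneg_left (hq j hj) hσ.le
    linarith
  have h2 := Finset.sum_le_sum h1
  rw [Finset.sum_sub_distrib, ← Finset.mul_sum, Finset.sum_comm] at h2
  rw [Finset.sum_comm (s := Finset.univ.filter fun r => σ ≤ lam r)]
  simp only [Finset.sum_const, nsmul_eq_mul] at h2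
  rw [Finset.sum_comm] at h2
  linarith

-- An eigenvector with nonzero eigenvalue lies in the span of the `p i`. Hence new directions are
-- automatically orthogonal to the old ones.
include heig in
theorem eigenvector_orthogonal {r : Fin d} (hr : lam r ≠ 0) {x : Fin d → ℝ}
    (hx : ∀ i ∈ I, p i ⬝ᵥ x = 0) : x ⬝ᵥ e r = 0 := by
  have h := dot_mulVec_sum_outer I c p x (e r)
  rw [heig, dotProduct_smul, Finset.sum_eq_zero fun i hi => by rw [hx i hi]; ring] at h
  exact (mul_eq_zero.mp h).resolve_left hr

end spectral

/-! ### Empirical moments and the gain of one round -/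

section round

variable {d k K N : ℕ} {v : Fin k → Fin d → ℝ} {r : ℝ} {ι : Type*}

open Classical in
/-- The number of examples in a set. -/
noncomputable def count {Z : Type*} {N : ℕ} (A : Set Z) (S : Fin N → Z) : ℕ :=
  (Finset.univ.filter fun n => S n ∈ A).card

open Classical in
/-- The empirical conditional moments. -/
noncomputable def empMoment (v : Fin k → Fin d → ℝ) (A : Set ((Fin d → ℝ) × Fin K))
    (S : Fin N → (Fin d → ℝ) × Fin K) (l : Fin K) : Fin d → ℝ :=
  (count A S : ℝ)⁻¹ • ∑ n, if S n ∈ A ∧ (S n).2 = l then perp v (S n).1 else 0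

/-- The examples with label `l` in a cell. -/
def CellData.labelSet (C : CellData v r ι) (K : ℕ) (j : ι) (l : Fin K) :
    Set ((Fin d → ℝ) × Fin K) :=
  C.exampleSet K j ∩ {p | p.2 = l}

/-- Samples that represent a distribution well. -/
structure GoodSample (D : Measure ((Fin d → ℝ) × Fin K)) (C : CellData v r ι)
    (S : Fin N → (Fin d → ℝ) × Fin K) (ξ s : ℝ) : Prop where
  freq : ∀ j ∈ C.cells, ∀ l, |(count (C.labelSet K j l) S : ℝ) / N - D.real (C.labelSet K j l)| ≤ ξ
  moment : ∀ j ∈ C.cells, ∀ l, 0 < count (C.exampleSet K j) S →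
    count (C.exampleSet K j) S *
      ((empMoment v (C.exampleSet K j) S l - condMoment D v (C.exampleSet K j) l) ⬝ᵥ
        (empMoment v (C.exampleSet K j) S l - condMoment D v (C.exampleSet K j) l)) ≤ s

theorem CellData.sum_count_le (C : CellData v r ι) (J : Finset ι)
    (S : Fin N → (Fin d → ℝ) × Fin K) : ∑ j ∈ J, count (C.exampleSet K j) S ≤ N := by
  classical
  unfold count
  rw [← Finset.card_biUnion]
  · exact (Finset.card_le_univ _).trans_eq (Fintype.card_fin N)
  · intro i _ j _ hij
    refine Finset.disjoint_left.mpr fun n hn hn' => hij ?_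
    have h1 : C.cell (S n).1 = some i := (Finset.mem_filter.mp hn).2
    have h2 : C.cell (S n).1 = some j := (Finset.mem_filter.mp hn').2
    rw [h1] at h2
    exact Option.some.inj h2

theorem CellData.sum_count_labelSet (C : CellData v r ι) (j : ι)
    (S : Fin N → (Fin d → ℝ) × Fin K) :
    ∑ l, count (C.labelSet K j l) S = count (C.exampleSet K j) S := by
  classical
  unfold count
  rw [← Finset.card_biUnion]
  · congr 1
    ext n
    simp [labelSet]
  · intro i _ l _ hil
    refine Finset.disjoint_left.mpr fun n hn hn' => hil ?_
    have h1 : (S n).2 = i := (Finset.mem_filter.mp hn).2.2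
    have h2 : (S n).2 = l := (Finset.mem_filter.mp hn').2.2
    rw [← h1, ← h2]

theorem CellData.measureReal_exampleSet (D : Measure ((Fin d → ℝ) × Fin K))
    [IsProbabilityMeasure D] (C : CellData v r ι) (j : ι) :
    ∑ l, D.real (C.labelSet K j l) = D.real (C.exampleSet K j) := by
  rw [← measureReal_iUnion_fintype]
  · congr 1
    ext p
    simp [labelSet]
  · intro i l hil
    refine Set.disjoint_left.mpr ?_
    rintro p ⟨-, h1⟩ ⟨-, h2⟩
    exact hil (h1.symm.trans h2)
  · exact fun l => (C.measurableSet_exampleSet j).inter (measurable_snd (measurableSet_singleton l))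

/-- Write `b ⬝ᵥ q = a ⬝ᵥ q - (a - b) ⬝ᵥ q` and use `(x - y) ^ 2 ≤ 2 x ^ 2 + 2 y ^ 2`. This transfers
a lower bound from the true to the empirical moment. -/
theorem half_sq_sub_le (a b : Fin d → ℝ) {q : Fin d → ℝ} (hq : q ⬝ᵥ q ≤ 1) :
    (b ⬝ᵥ q) ^ 2 / 2 - (a - b) ⬝ᵥ (a - b) ≤ (a ⬝ᵥ q) ^ 2 := by
  have h1 : ((a - b) ⬝ᵥ q) ^ 2 ≤ (a - b) ⬝ᵥ (a - b) := by
    have := abs_dot_le (a - b) q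
    have h2 : len q ≤ 1 := by rw [len]; exact Real.sqrt_le_one.mpr hq
    have h3 : |(a - b) ⬝ᵥ q| ≤ len (a - b) :=
      this.trans (mul_le_of_le_one_right (len_nonneg _) h2)
    rw [← len_sq, ← sq_abs]
    gcongr
  rw [sub_dotProduct] at h1
  nlinarith [sq_nonneg ((a ⬝ᵥ q) - (a ⬝ᵥ q - b ⬝ᵥ q) * 2), sq_nonneg (2 * (a ⬝ᵥ q) - b ⬝ᵥ q)]

theorem dot_self_le_two (a b : Fin d → ℝ) :
    a ⬝ᵥ a ≤ 2 * (b ⬝ᵥ b) + 2 * ((a - b) ⬝ᵥ (a - b)) := by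
  have := dotProduct_self_nonneg' (a - (2 : ℝ) • b)
  simp only [sub_dotProduct, dotProduct_sub, smul_dotProduct, dotProduct_smul, smul_eq_mul] at this ⊢
  rw [dotProduct_comm b a] at *
  linarith

variable {D : Measure ((Fin d → ℝ) × Fin K)} [IsProbabilityMeasure D]
  {S : Fin N → (Fin d → ℝ) × Fin K} {ξ s : ℝ}

/-- The trace of the estimated matrix is small. -/
theorem GoodSample.trace_le (hD : D.map Prod.fst = stdNormal d) (hv : IsOrtho v)
    {C : CellData v r ι} (hS : GoodSample D C S ξ s) (hs : 0 ≤ s) (hN : 0 < N)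
    (hsN : (C.cells.card : ℝ) * K * s ≤ N / 2) (hK : 0 < K) :
    ∑ i ∈ C.cells ×ˢ Finset.univ, ((count (C.exampleSet K i.1) S : ℝ) / N) *
      (empMoment v (C.exampleSet K i.1) S i.2 ⬝ᵥ empMoment v (C.exampleSet K i.1) S i.2) ≤
      3 * K := by
  have hN' : (0 : ℝ) < N := by exact_mod_cast hN
  rw [Finset.sum_product]
  -- A rarely hit cell may have a poor empirical moment, but count times squared deviation is at
  -- most `s` in every cell. Since true moments have length at most one, the total is at most `2 K +
  -- 1`.
  have h1 : ∀ j ∈ C.cells, ∑ l : Fin K, ((count (C.exampleSet K j) S : ℝ) / N) *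
      (empMoment v (C.exampleSet K j) S l ⬝ᵥ empMoment v (C.exampleSet K j) S l) ≤
      2 * K * ((count (C.exampleSet K j) S : ℝ) / N) + 2 * K * (s / N) := by
    intro j hj
    have h2 : ∀ l ∈ (Finset.univ : Finset (Fin K)), ((count (C.exampleSet K j) S : ℝ) / N) *
        (empMoment v (C.exampleSet K j) S l ⬝ᵥ empMoment v (C.exampleSet K j) S l) ≤
        2 * ((count (C.exampleSet K j) S : ℝ) / N) + 2 * (s / N) := by
      intro l _
      rcases Nat.eq_zero_or_pos (count (C.exampleSet K j) S) with h0 | h0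
      · rw [h0]; simp; positivity
      · have h3 := hS.moment j hj l h0
        have h4 := dot_self_le_two (empMoment v (C.exampleSet K j) S l)
          (condMoment D v (C.exampleSet K j) l)
        have h5 := C.condMoment_sq_le hD hv j l
        rw [← mul_div_assoc, ← mul_div_assoc, ← add_div, div_mul_eq_mul_div]
        gcongr
        have h6 : (0 : ℝ) ≤ count (C.exampleSet K j) S := Nat.cast_nonneg _
        nlinarith
    refine (Finset.sum_le_sum h2).trans (le_of_eq ?_)
    simp; ring
  refine (Finset.sum_le_sum h1).trans ?_
  rw [Finset.sum_add_distrib, ← Finset.mul_sum, ← Finset.sum_div, Finset.sum_const, nsmul_eq_mul]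
  have h7 : (∑ j ∈ C.cells, (count (C.exampleSet K j) S : ℝ)) / N ≤ 1 := by
    rw [div_le_one hN']
    exact_mod_cast C.sum_count_le C.cells S
  have h8 : (C.cells.card : ℝ) * (2 * K * (s / N)) ≤ 1 := by
    rw [show (C.cells.card : ℝ) * (2 * K * (s / N)) = 2 * (C.cells.card * K * s) / N by ring,
      div_le_one hN']
    linarith
  have h9 : (1 : ℝ) ≤ K := by exact_mod_cast hK
  nlinarith

/-- The direction of the difference of two weight vectors. -/
noncomputable def unitDir (w : Fin K → Fin d → ℝ) (a b : Fin K) : Fin d → ℝ :=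
  (len (w b - w a))⁻¹ • (w b - w a)

theorem unitDir_sq_le (w : Fin K → Fin d → ℝ) (a b : Fin K) :
    unitDir w a b ⬝ᵥ unitDir w a b ≤ 1 := by
  by_cases h : w b - w a = 0
  · simp [unitDir, h]
  · exact (unit_normalize h).le

/-- The estimated matrix is large in some of the directions `unitDir w a b`. -/
theorem GoodSample.quadratic_ge {C : CellData v r ι} (hS : GoodSample D C S ξ s) (hs : 0 ≤ s)
    (hN : 0 < N) (w : Fin K → Fin d → ℝ) (B : Finset ι) (hB : B ⊆ C.cells) {e β : ℝ}
    (hβ : 0 ≤ β) (hmass : e ≤ ∑ j ∈ B, D.real (C.exampleSet K j))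
    (hmom : ∀ j ∈ B, ∃ l a b, w b - w a ≠ 0 ∧ β * len (w b - w a) ≤
      (w b - w a) ⬝ᵥ condMoment D v (C.exampleSet K j) l)
    (hξ : (C.cells.card : ℝ) * K * ξ ≤ e / 2) (hξ0 : 0 ≤ ξ)
    (hsN : (C.cells.card : ℝ) * s ≤ N * (β ^ 2 * e / 8)) :
    β ^ 2 * e / 8 ≤ ∑ q ∈ (Finset.univ : Finset (Fin K × Fin K)),
      ∑ i ∈ C.cells ×ˢ Finset.univ, ((count (C.exampleSet K i.1) S : ℝ) / N) *
      (empMoment v (C.exampleSet K i.1) S i.2 ⬝ᵥ unitDir w q.1 q.2) ^ 2 := by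
  have hN' : (0 : ℝ) < N := by exact_mod_cast hN
  let F : ι → Fin K → Fin K × Fin K → ℝ := fun j l q =>
    ((count (C.exampleSet K j) S : ℝ) / N) *
      (empMoment v (C.exampleSet K j) S l ⬝ᵥ unitDir w q.1 q.2) ^ 2
  have hF0 : ∀ j l q, 0 ≤ F j l q := fun j l q => by positivity
  -- One label and one pair suffice in each cell of `B`. Passing to the empirical moment costs half
  -- of the square and `s / N`.
  have h1 : ∀ j ∈ B, ((count (C.exampleSet K j) S : ℝ) / N) * (β ^ 2 / 2) - s / N ≤
      ∑ l, ∑ q, F j l q := by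
    intro j hj
    obtain ⟨l, a, b, hne, hge⟩ := hmom j hj
    have h2 : F j l (a, b) ≤ ∑ l, ∑ q, F j l q :=
      (Finset.single_le_sum (fun q _ => hF0 j l q) (Finset.mem_univ (a, b))).trans
        (Finset.single_le_sum (f := fun l => ∑ q, F j l q)
          (fun l _ => Finset.sum_nonneg fun q _ => hF0 j l q) (Finset.mem_univ l))
    refine le_trans ?_ h2
    rcases Nat.eq_zero_or_pos (count (C.exampleSet K j) S) with h0 | h0
    · simp only [F, h0]
      simp; positivity
    · have h3 := hS.moment j (hB hj) l h0
      have h4 := half_sq_sub_le (empMoment v (C.exampleSet K j) S l)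
        (condMoment D v (C.exampleSet K j) l) (unitDir_sq_le w a b)
      have h5 : β ≤ condMoment D v (C.exampleSet K j) l ⬝ᵥ unitDir w a b := by
        rw [dotProduct_comm, unitDir, smul_dotProduct, smul_eq_mul, inv_mul_eq_div,
          le_div_iff₀ (len_pos hne)]
        exact hge
      have h6 : β ^ 2 ≤ (condMoment D v (C.exampleSet K j) l ⬝ᵥ unitDir w a b) ^ 2 := by gcongr
      simp only [F]
      rw [div_mul_eq_mul_div, div_mul_eq_mul_div, ← sub_div]
      gcongr
      have h7 : (0 : ℝ) ≤ count (C.exampleSet K j) S := Nat.cast_nonneg _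
      nlinarith
  -- Frequencies are controlled label by label, so the mass of a cell is known up to `K * ξ`.
  have h8 : ∀ j ∈ B, D.real (C.exampleSet K j) - K * ξ ≤ (count (C.exampleSet K j) S : ℝ) / N := by
    intro j hj
    rw [← C.measureReal_exampleSet D j, ← C.sum_count_labelSet j S]
    push_cast
    rw [Finset.sum_div]
    have h9 : ∑ l, (D.real (C.labelSet K j l) - ξ) ≤
        ∑ l, (count (C.labelSet K j l) S : ℝ) / N :=
      Finset.sum_le_sum fun l _ => by
        have := (abs_le.mp (hS.freq j (hB hj) l)).1
        linarith
    rw [Finset.sum_sub_distrib] at h9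
    simpa using h9
  have h10 : ∑ q, ∑ i ∈ C.cells ×ˢ Finset.univ, F i.1 i.2 q =
      ∑ j ∈ C.cells, ∑ l, ∑ q, F j l q := by
    rw [Finset.sum_comm, Finset.sum_product]
  have h11 : ∑ j ∈ B, ∑ l, ∑ q, F j l q ≤ ∑ j ∈ C.cells, ∑ l, ∑ q, F j l q :=
    Finset.sum_le_sum_of_subset_of_nonneg hB fun j _ _ =>
      Finset.sum_nonneg fun l _ => Finset.sum_nonneg fun q _ => hF0 j l q
  change _ ≤ ∑ q, ∑ i ∈ C.cells ×ˢ Finset.univ, F i.1 i.2 q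
  rw [h10]
  refine le_trans ?_ h11
  refine le_trans ?_ (Finset.sum_le_sum h1)
  rw [Finset.sum_sub_distrib, ← Finset.sum_mul, Finset.sum_const, nsmul_eq_mul]
  have h12 := Finset.sum_le_sum h8
  rw [Finset.sum_sub_distrib, Finset.sum_const, nsmul_eq_mul] at h12
  have h13 : (B.card : ℝ) ≤ C.cells.card := by exact_mod_cast Finset.card_le_card hB
  have h14 : (B.card : ℝ) * (K * ξ) ≤ e / 2 := by
    refine le_trans ?_ hξ
    rw [mul_assoc]
    gcongr
  have h15 : (B.card : ℝ) * (s / N) ≤ β ^ 2 * e / 8 := by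
    rw [← mul_div_assoc, div_le_iff₀ hN', mul_comm (β ^ 2 * e / 8)]
    refine le_trans ?_ hsN
    gcongr
  have h16 : e / 2 * (β ^ 2 / 2) ≤
      (∑ j ∈ B, (count (C.exampleSet K j) S : ℝ) / N) * (β ^ 2 / 2) := by
    gcongr
    linarith
  linarith

/-- A hypothesis that is constant on cells, with a most frequent label of a good sample, is almost
as good as the best such hypothesis. -/
theorem GoodSample.err_le {w : Fin K → Fin d → ℝ} {t : Fin K → ℝ} {f : (Fin d → ℝ) → Fin K}
    (hf : IsClassifier w t f) (hD : D.map Prod.fst = stdNormal d) (hr : 0 ≤ r)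
    {C : CellData v r ι} (hS : GoodSample D C S ξ s) (hN : 0 < N) (h : (Fin d → ℝ) → Fin K)
    (lab : ι → Fin K) (hlab : ∀ j ∈ C.cells, ∀ l, count (C.labelSet K j l) S ≤
      count (C.labelSet K j (lab j)) S) (hh : ∀ x j, C.cell x = some j → h x = lab j) :
    err D h ≤ (stdNormal d).real {x | C.cell x = none} + err D f +
      (stdNormal d).real {x | f x ≠ f (proj v x)} + K ^ 2 * r + 2 * C.cells.card * ξ := by
  classical
  have hN' : (0 : ℝ) < N := by exact_mod_cast hN
  have hnone : MeasurableSet {x | C.cell x = none} := by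
    have : {x | C.cell x = none} = (⋃ j ∈ C.cells, C.cellSet j)ᶜ := by
      ext x
      simp only [CellData.cellSet, Set.mem_ofPred_eq, Set.mem_compl_iff, Set.mem_iUnion, not_exists]
      constructor
      · intro hx j _ hj; rw [hx] at hj; cases hj
      · intro hx
        by_contra hne
        obtain ⟨j, hj⟩ := Option.ne_none_iff_exists'.mp hne
        exact hx j (C.mem_cells x j hj) hj
    rw [this]
    exact (Finset.measurableSet_biUnion _ fun j _ => C.measurableSet_cellSet j).compl
  have h1 : err D h ≤ (stdNormal d).real {x | C.cell x = none} +
      ∑ j ∈ C.cells, D.real (C.exampleSet K j ∩ {p | p.2 ≠ lab j}) := by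
    rw [← measureReal_fst_preimage hD hnone]
    refine (measureReal_mono ?_).trans ((measureReal_union_le _ _).trans
      (add_le_add le_rfl (measureReal_biUnion_finset_le C.cells
        fun j => C.exampleSet K j ∩ {p | p.2 ≠ lab j})))
    intro p hp
    rcases hc : C.cell p.1 with _ | j
    · exact Or.inl hc
    · refine Or.inr (Set.mem_iUnion₂.mpr ⟨j, C.mem_cells _ _ hc, hc, ?_⟩)
      rw [← hh p.1 j hc]
      exact fun h' => hp h'.symm
  have hlabm : ∀ j l, MeasurableSet (C.labelSet K j l) := fun j l =>
    (C.measurableSet_exampleSet j).inter (measurable_snd (measurableSet_singleton l))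
  have hcompl : ∀ j l, D.real (C.exampleSet K j ∩ {p | p.2 ≠ l}) =
      D.real (C.exampleSet K j) - D.real (C.labelSet K j l) := by
    intro j l
    have h := measureReal_sdiff (μ := D) (s₁ := C.exampleSet K j) (s₂ := C.labelSet K j l)
      Set.inter_subset_left (hlabm j l)
    rw [← h]
    congr 1
    ext p
    simp [CellData.labelSet]
  -- The chosen label is at least as frequent in the sample as the class of the representative; each
  -- frequency is off by at most `ξ`.
  have h2 : ∀ j ∈ C.cells, D.real (C.exampleSet K j ∩ {p | p.2 ≠ lab j}) ≤
      D.real (C.exampleSet K j ∩ {p | p.2 ≠ f (C.rep j)}) + 2 * ξ := by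
    intro j hj
    rw [hcompl, hcompl]
    have e1 := (abs_le.mp (hS.freq j hj (lab j))).2
    have e2 := (abs_le.mp (hS.freq j hj (f (C.rep j)))).1
    have e3 : (count (C.labelSet K j (f (C.rep j))) S : ℝ) / N ≤
        (count (C.labelSet K j (lab j)) S : ℝ) / N := by
      gcongr
      exact hlab j hj _
    linarith
  have h3 : ∀ j ∈ C.cells, D.real (C.exampleSet K j ∩ {p | p.2 ≠ f (C.rep j)}) ≤
      D.real (C.exampleSet K j ∩ ({p | f p.1 ≠ p.2} ∪
        Prod.fst ⁻¹' {x | f x ≠ f (proj v x)})) +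
      D.real (Prod.fst ⁻¹' (C.cellSet j ∩ {x | f (proj v x) ≠ f (C.rep j)}) :
        Set ((Fin d → ℝ) × Fin K)) := by
    intro j _
    refine (measureReal_mono ?_).trans (measureReal_union_le _ _)
    rintro p ⟨hp, hne⟩
    by_cases e1 : f p.1 = p.2
    · by_cases e2 : f p.1 = f (proj v p.1)
      · exact Or.inr ⟨hp, fun e3 => hne (by rw [← e1, e2]; exact e3)⟩
      · exact Or.inl ⟨hp, Or.inr e2⟩
    · exact Or.inl ⟨hp, Or.inl e1⟩
  have hfp : Measurable fun x => f (proj v x) := hf.measurable.comp (measurable_proj v)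
  have hBm : MeasurableSet {x | f x ≠ f (proj v x)} :=
    (measurableSet_eq_fun hf.measurable hfp).compl
  have h4 := C.sum_measureReal_le (D := D) C.cells ({p | f p.1 ≠ p.2} ∪
        Prod.fst ⁻¹' {x | f x ≠ f (proj v x)}) (hf.measurableSet_err.union (measurable_fst hBm))
  have h5 : D.real ({p | f p.1 ≠ p.2} ∪ Prod.fst ⁻¹' {x | f x ≠ f (proj v x)}) ≤
      err D f + (stdNormal d).real {x | f x ≠ f (proj v x)} := by
    refine (measureReal_union_le _ _).trans (add_le_add le_rfl ?_)
    rw [measureReal_fst_preimage hD hBm]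
  have h6 : ∑ j ∈ C.cells, D.real (Prod.fst ⁻¹' (C.cellSet j ∩
      {x | f (proj v x) ≠ f (C.rep j)}) : Set ((Fin d → ℝ) × Fin K)) ≤ K ^ 2 * r := by
    let π : (Fin d → ℝ) → Fin d → ℝ := fun x => match C.cell x with
      | some j => C.rep j
      | none => 0
    have hπ : ∀ x j, C.cell x = some j → π x = C.rep j := fun x j h => by simp only [π, h]
    refine le_trans ?_ (hf.proj_stable v hr {x | C.cell x ≠ none} π ?_)
    · have hm : ∀ j, MeasurableSet (C.cellSet j ∩ {x | f (proj v x) ≠ f (C.rep j)}) := fun j =>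
        (C.measurableSet_cellSet j).inter (measurableSet_eq_fun hfp measurable_const).compl
      simp only [measureReal_fst_preimage hD (hm _)]
      rw [← measureReal_biUnion_finset _ fun j _ => hm j]
      · refine measureReal_mono (Set.iUnion₂_subset fun j _ => ?_)
        rintro x ⟨hx, hne⟩
        have hx' : C.cell x = some j := hx
        refine ⟨by simp [hx'], ?_⟩
        rw [hπ x j hx]; exact hne
      · intro i _ j _ hij
        refine Set.disjoint_left.mpr ?_
        rintro x ⟨hx, -⟩ ⟨hx', -⟩
        have e1 : C.cell x = some i := hx
        have e2 : C.cell x = some j := hx'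
        rw [e1] at e2
        exact hij (Option.some.inj e2)
    · intro x hx a
      obtain ⟨j, hj⟩ := Option.ne_none_iff_exists'.mp hx
      rw [hπ x j hj]
      exact C.close x j hj a
  have h7 := Finset.sum_le_sum h2
  have h8 := Finset.sum_le_sum h3
  rw [Finset.sum_add_distrib] at h7 h8
  simp only [Finset.sum_const, nsmul_eq_mul] at h7
  linarith

end round

/-! ### Concentration of the empirical moments -/

/-- For a centred variable the linear term integrates to zero, so that only a second-order quantity
remains. For `|z| ≤ 1` it follows from `exp z ≤ 1 + z + z ^ 2`. -/
theorem exp_le_add_exp_sq (z : ℝ) : Real.exp z ≤ z + Real.exp (z ^ 2) := by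
  have h1 := Real.add_one_le_exp (z ^ 2)
  rcases le_or_gt |z| 1 with h | h
  · have := (abs_le.mp (Real.abs_exp_sub_one_sub_id_le h)).2
    linarith
  · rcases lt_abs.mp h with h | h
    · have : Real.exp z ≤ Real.exp (z ^ 2) := by gcongr; nlinarith
      linarith
    · have : Real.exp z ≤ 1 := Real.exp_le_one_iff.mpr (by linarith)
      nlinarith

theorem lintegral_exp_gaussianReal (s : NNReal) (t : ℝ) :
    ∫⁻ x, ENNReal.ofReal (Real.exp (t * x)) ∂gaussianReal 0 s =
      ENNReal.ofReal (Real.exp (s * t ^ 2 / 2)) := by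
  have h := mgf_gaussianReal (p := gaussianReal 0 s) (X := id) (μ := 0) (v := s) Measure.map_id t
  simp only [mgf, id, zero_mul, zero_add] at h
  rw [← h, ofReal_integral_eq_lintegral_ofReal (integrable_exp_mul_gaussianReal t)]
  exact ae_of_all _ fun _ => (Real.exp_pos _).le

/-- The integral is `(1 - 4 s) ^ (-1 / 2)`, and `(1 - 4 s) * exp (8 s) ≥ (1 - 4 s) * (1 + 8 s) ≥ 1`
for `s ≤ 1 / 8`. -/
theorem lintegral_exp_two_sq_gaussianReal {s : NNReal} (hs : s ≤ 1 / 8) :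
    ∫⁻ x, ENNReal.ofReal (Real.exp (2 * x ^ 2)) ∂gaussianReal 0 s ≤
      ENNReal.ofReal (Real.exp (4 * s)) := by
  have hs' : (s : ℝ) ≤ 1 / 8 := by exact_mod_cast hs
  have hmap : gaussianReal 0 s = (gaussianReal 0 1).map (√s * ·) := by
    rw [gaussianReal_map_const_mul]
    congr 1
    · simp
    · ext; simp
  rw [hmap, lintegral_map (by fun_prop) (by fun_prop)]
  have h : ∀ x : ℝ, 2 * (√(s : ℝ) * x) ^ 2 = (2 * s) * x ^ 2 := fun x => by
    rw [mul_pow, Real.sq_sqrt s.coe_nonneg]; ring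
  simp only [h]
  rw [lintegral_exp_sq_gaussianReal (by linarith)]
  apply ENNReal.ofReal_le_ofReal
  rw [Real.sqrt_le_left (Real.exp_pos _).le, ← Real.exp_nat_mul, div_le_iff₀ (by linarith)]
  have h2 := Real.add_one_le_exp (((2 : ℕ) : ℝ) * (4 * s))
  have h3 : (1 - 2 * (2 * (s : ℝ))) ≥ 1 / 2 := by linarith
  push_cast at h2 ⊢
  nlinarith [s.2]

/-- Domination by a centred Gaussian of variance `s` makes the centred variable subgaussian. For
small `s` the inequality `exp z ≤ z + exp (z ^ 2)` reduces this to a quadratic exponential moment of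
`G`. For `s > 1 / 8` the crude bound by `exp |G|` is enough, because constant factors are absorbed
into `exp (10 s)`. -/
theorem lintegral_exp_sub_integral_le {Ω : Type*} [MeasurableSpace Ω] (P : Measure Ω)
    [IsProbabilityMeasure P] {Y G : Ω → ℝ} (hY : Measurable Y) (hG : Measurable G) {s : NNReal}
    (hlaw : P.map G = gaussianReal 0 s) (hYG : ∀ ω, |Y ω| ≤ |G ω|) :
    ∫⁻ ω, ENNReal.ofReal (Real.exp (Y ω - ∫ ω, Y ω ∂P)) ∂P ≤
      ENNReal.ofReal (Real.exp (10 * s)) := by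
  have hG2 : MemLp G 2 P := by
    have h1 : MemLp id 2 (P.map G) := hlaw ▸ memLp_id_gaussianReal 2
    simpa [Function.comp_def] using (memLp_map_measure_iff (by fun_prop) (by fun_prop)).mp h1
  have hGsq : ∫ ω, G ω ^ 2 ∂P = s := by
    have h1 := integral_map (μ := P) hG.aemeasurable (f := fun z : ℝ => z ^ 2) (by fun_prop)
    rw [← h1, hlaw]
    have h2 := variance_id_gaussianReal (μ := 0) (v := s)
    rw [variance_of_integral_eq_zero (by fun_prop) (by simp)] at h2
    simpa using h2
  have hY2 : MemLp Y 2 P := hG2.mono hY.aestronglyMeasurable (ae_of_all _ hYG)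
  have hYi : Integrable Y P := hY2.integrable (by norm_num)
  set m := ∫ ω, Y ω ∂P with hm
  have hm2 : m ^ 2 ≤ s := by
    have h1 : ∫ ω, 2 * m * Y ω ∂P ≤ ∫ ω, (G ω ^ 2 + m ^ 2) ∂P := by
      refine integral_mono (hYi.const_mul _) (hG2.integrable_sq.add (integrable_const _)) fun ω => ?_
      have := sq_le_sq.mpr (hYG ω)
      change 2 * m * Y ω ≤ G ω ^ 2 + m ^ 2
      nlinarith [sq_nonneg (Y ω - m)]
    rw [integral_const_mul, integral_add hG2.integrable_sq (integrable_const _), hGsq] at h1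
    simp only [integral_const, probReal_univ, smul_eq_mul, one_mul] at h1
    nlinarith
  have hlin : ∀ f : ℝ → ENNReal, Measurable f → ∫⁻ ω, f (G ω) ∂P = ∫⁻ x, f x ∂gaussianReal 0 s :=
    fun f hf => by rw [← hlaw, lintegral_map hf hG]
  have hs0 : (0 : ℝ) ≤ s := s.2
  rcases le_or_gt s (1 / 8) with hs | hs
  · have hsq : ∀ ω, (Y ω - m) ^ 2 ≤ 2 * G ω ^ 2 + 2 * s := fun ω => by
      have := sq_le_sq.mpr (hYG ω)
      nlinarith [sq_nonneg (Y ω + m)]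
    have h1 : ∫⁻ ω, ENNReal.ofReal (Real.exp ((Y ω - m) ^ 2)) ∂P ≤
        ENNReal.ofReal (Real.exp (10 * s)) := by
      calc ∫⁻ ω, ENNReal.ofReal (Real.exp ((Y ω - m) ^ 2)) ∂P
          ≤ ∫⁻ ω, ENNReal.ofReal (Real.exp (2 * s)) *
              ENNReal.ofReal (Real.exp (2 * G ω ^ 2)) ∂P := by
            refine lintegral_mono fun ω => ?_
            rw [← ENNReal.ofReal_mul (Real.exp_pos _).le, ← Real.exp_add]
            apply ENNReal.ofReal_le_ofReal
            gcongr
            linarith [hsq ω]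
        _ = ENNReal.ofReal (Real.exp (2 * s)) *
              ∫⁻ x, ENNReal.ofReal (Real.exp (2 * x ^ 2)) ∂gaussianReal 0 s := by
            rw [lintegral_const_mul _ (by fun_prop),
              hlin (fun x => ENNReal.ofReal (Real.exp (2 * x ^ 2))) (by fun_prop)]
        _ ≤ ENNReal.ofReal (Real.exp (2 * s)) * ENNReal.ofReal (Real.exp (4 * s)) := by
            gcongr
            exact lintegral_exp_two_sq_gaussianReal hs
        _ ≤ ENNReal.ofReal (Real.exp (10 * s)) := by
            rw [← ENNReal.ofReal_mul (Real.exp_pos _).le, ← Real.exp_add]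
            apply ENNReal.ofReal_le_ofReal
            gcongr
            linarith
    have hi2 : Integrable (fun ω => Real.exp ((Y ω - m) ^ 2)) P := by
      refine ⟨by fun_prop, ?_⟩
      rw [hasFiniteIntegral_iff_ofReal (ae_of_all _ fun _ => (Real.exp_pos _).le)]
      exact h1.trans_lt ENNReal.ofReal_lt_top
    have hi1 : Integrable (fun ω => (Y ω - m) + Real.exp ((Y ω - m) ^ 2)) P :=
      (hYi.sub (integrable_const m)).add hi2
    calc ∫⁻ ω, ENNReal.ofReal (Real.exp (Y ω - m)) ∂P
        ≤ ∫⁻ ω, ENNReal.ofReal ((Y ω - m) + Real.exp ((Y ω - m) ^ 2)) ∂P :=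
          lintegral_mono fun ω => ENNReal.ofReal_le_ofReal (exp_le_add_exp_sq _)
      _ = ENNReal.ofReal (∫ ω, ((Y ω - m) + Real.exp ((Y ω - m) ^ 2)) ∂P) := by
          rw [ofReal_integral_eq_lintegral_ofReal hi1]
          exact ae_of_all _ fun ω => (Real.exp_pos _).le.trans (exp_le_add_exp_sq _)
      _ = ENNReal.ofReal (∫ ω, Real.exp ((Y ω - m) ^ 2) ∂P) := by
          have hz : ∫ ω, (Y ω - m) ∂P = 0 := by
            rw [integral_sub hYi (integrable_const m)]
            simp [← hm]
          have ha := integral_add (hYi.sub (integrable_const m)) hi2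
          simp only [Pi.sub_apply] at ha
          rw [ha, hz, zero_add]
      _ = ∫⁻ ω, ENNReal.ofReal (Real.exp ((Y ω - m) ^ 2)) ∂P :=
          ofReal_integral_eq_lintegral_ofReal hi2 (ae_of_all _ fun _ => (Real.exp_pos _).le)
      _ ≤ _ := h1
  · have hs' : (1 / 8 : ℝ) < s := by exact_mod_cast hs
    have hms : -m ≤ 3 * s := by nlinarith [sq_nonneg (m + 3 * s)]
    calc ∫⁻ ω, ENNReal.ofReal (Real.exp (Y ω - m)) ∂P
        ≤ ∫⁻ ω, ENNReal.ofReal (Real.exp (3 * s)) * (ENNReal.ofReal (Real.exp (1 * G ω)) +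
            ENNReal.ofReal (Real.exp (-1 * G ω))) ∂P := by
          refine lintegral_mono fun ω => ?_
          rw [← ENNReal.ofReal_add (Real.exp_pos _).le (Real.exp_pos _).le,
            ← ENNReal.ofReal_mul (Real.exp_pos _).le]
          apply ENNReal.ofReal_le_ofReal
          have h1 : Real.exp (Y ω - m) ≤ Real.exp (3 * s) * Real.exp |G ω| := by
            rw [← Real.exp_add]
            gcongr
            linarith [le_abs_self (Y ω), hYG ω]
          refine h1.trans ?_
          gcongr
          rcases abs_choice (G ω) with h | h <;> rw [h]
          · rw [one_mul]; linarith [Real.exp_pos (-1 * G ω)]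
          · rw [neg_one_mul]; linarith [Real.exp_pos (1 * G ω)]
      _ = ENNReal.ofReal (Real.exp (3 * s)) * (ENNReal.ofReal (Real.exp (s / 2)) +
            ENNReal.ofReal (Real.exp (s / 2))) := by
          rw [lintegral_const_mul _ (by fun_prop), lintegral_add_left (by fun_prop),
            hlin (fun x => ENNReal.ofReal (Real.exp (1 * x))) (by fun_prop),
            hlin (fun x => ENNReal.ofReal (Real.exp (-1 * x))) (by fun_prop),
            lintegral_exp_gaussianReal, lintegral_exp_gaussianReal]
          norm_num
      _ ≤ _ := by
          rw [← ENNReal.ofReal_add (Real.exp_pos _).le (Real.exp_pos _).le,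
            ← ENNReal.ofReal_mul (Real.exp_pos _).le]
          apply ENNReal.ofReal_le_ofReal
          -- The factor `2` is at most `exp 0.8`, and `0.8 ≤ 6.4 s`; the exponents `3 s`, `s / 2`
          -- and `6.4 s` stay below `10 s`.
          have h2 : Real.exp (s / 2 : ℝ) + Real.exp (s / 2) ≤ Real.exp 0.8 * Real.exp (s / 2) := by
            have : (2 : ℝ) ≤ Real.exp 0.8 := by
              have h5 := Real.quadratic_le_exp_of_nonneg (x := 0.8) (by norm_num)
              norm_num at h5 ⊢
              linarith
            nlinarith [Real.exp_pos (s / 2 : ℝ)]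
          refine (mul_le_mul_of_nonneg_left h2 (Real.exp_pos _).le).trans ?_
          rw [← Real.exp_add, ← Real.exp_add]
          gcongr
          linarith

/-! ### Frequencies -/

open Classical in
theorem count_eq_sum {Z : Type*} {N : ℕ} (A : Set Z) (S : Fin N → Z) :
    (count A S : ℝ) = ∑ n, A.indicator 1 (S n) := by
  simp [count, Set.indicator_apply]

/-- Hoeffding's inequality on both sides: a centred indicator is subgaussian with parameter `1 / 4`.
-/
theorem measure_count_deviation_le {Z : Type*} [MeasurableSpace Z] (D : Measure Z)
    [IsProbabilityMeasure D] {A : Set Z} (hA : MeasurableSet A) {N : ℕ} (hN : 0 < N) {ξ : ℝ}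
    (hξ : 0 ≤ ξ) :
    Measure.pi (fun _ : Fin N => D) {S | ¬ |(count A S : ℝ) / N - D.real A| ≤ ξ} ≤
      ENNReal.ofReal (2 * Real.exp (-2 * N * ξ ^ 2)) := by
  have hN' : (0 : ℝ) < N := by exact_mod_cast hN
  set P := Measure.pi (fun _ : Fin N => D)
  have hXm : Measurable (A.indicator (1 : Z → ℝ)) := measurable_one.indicator hA
  have hX : ∀ z, A.indicator (1 : Z → ℝ) z ∈ Set.Icc (0 : ℝ) 1 := fun z => by
    by_cases h : z ∈ A <;> simp [h]
  have hmean : ∫ z, A.indicator (1 : Z → ℝ) z ∂D = D.real A := by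
    rw [integral_indicator_one hA]
  have hsub : HasSubgaussianMGF (fun z => A.indicator (1 : Z → ℝ) z - D.real A) (1 / 4) D := by
    have h := hasSubgaussianMGF_of_mem_Icc (μ := D) hXm.aemeasurable (ae_of_all _ hX)
    rw [hmean] at h
    convert h using 1
    ext; simp; norm_num
  have hsubn : ∀ n : Fin N, HasSubgaussianMGF
      (fun S : Fin N → Z => A.indicator (1 : Z → ℝ) (S n) - D.real A) (1 / 4) P := fun n => by
    have hmp := measurePreserving_eval (fun _ : Fin N => D) n
    exact HasSubgaussianMGF.of_map (Y := fun S : Fin N → Z => S n)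
      (X := fun z => A.indicator (1 : Z → ℝ) z - D.real A) hmp.measurable.aemeasurable
      (by rw [hmp.map_eq]; exact hsub)
  have hind : iIndepFun (fun (n : Fin N) (S : Fin N → Z) =>
      A.indicator (1 : Z → ℝ) (S n) - D.real A) P :=
    iIndepFun_pi (X := fun _ z => A.indicator (1 : Z → ℝ) z - D.real A) fun _ => by fun_prop
  have hindn : iIndepFun (fun (n : Fin N) (S : Fin N → Z) =>
      -(A.indicator (1 : Z → ℝ) (S n) - D.real A)) P :=
    iIndepFun_pi (X := fun _ z => -(A.indicator (1 : Z → ℝ) z - D.real A)) fun _ => by fun_prop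
  have h1 := HasSubgaussianMGF.measure_sum_ge_le_of_iIndepFun hind (s := Finset.univ)
    (fun n _ => hsubn n) (ε := N * ξ) (by positivity)
  have h2 := HasSubgaussianMGF.measure_sum_ge_le_of_iIndepFun hindn (s := Finset.univ)
    (fun n _ => (hsubn n).neg) (ε := N * ξ) (by positivity)
  have hexp : -(N * ξ) ^ 2 / (2 * ((∑ _n : Fin N, (1 / 4 : NNReal) : NNReal) : ℝ)) =
      -2 * N * ξ ^ 2 := by
    simp; field_simp; ring
  rw [hexp] at h1 h2
  rw [← ofReal_measureReal]
  apply ENNReal.ofReal_le_ofReal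
  refine le_trans (b := P.real ({S | N * ξ ≤ ∑ n, (A.indicator (1 : Z → ℝ) (S n) - D.real A)} ∪
    {S | N * ξ ≤ ∑ n, -(A.indicator (1 : Z → ℝ) (S n) - D.real A)})) (measureReal_mono ?_)
    ((measureReal_union_le _ _).trans (by linarith))
  intro S hS
  simp only [Set.mem_ofPred_eq, not_le, Set.mem_union, Finset.sum_neg_distrib,
    Finset.sum_sub_distrib, ← count_eq_sum] at hS ⊢
  simp only [Finset.sum_const, Finset.card_univ, Fintype.card_fin, nsmul_eq_mul]
  have h3 : (count A S : ℝ) - N * D.real A = N * ((count A S : ℝ) / N - D.real A) := by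
    field_simp
  rw [h3, ← mul_neg]
  rcases lt_abs.mp hS with h | h
  · exact Or.inl (by gcongr)
  · exact Or.inr (by gcongr)

/-! ### Vectors -/

/-- Exponential moments in all directions are averaged over a Gaussian direction `g`, which replaces
a covering of the sphere. The average of the exponential of a multiple of `g ⬝ᵥ W` is an exponential
of `W ⬝ᵥ W`, to which Markov's inequality applies. The normalization costs the factor `√2 ^ d`. -/
theorem measure_vector_deviation_le {d : ℕ} {Z : Type*} [MeasurableSpace Z] (D : Measure Z)
    [IsProbabilityMeasure D] {A : Set Z} (hA : MeasurableSet A) {ζ : Z → Fin d → ℝ}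
    (hζ : Measurable ζ)
    (hmgf : ∀ g, ∫⁻ z in A, ENNReal.ofReal (Real.exp (g ⬝ᵥ ζ z)) ∂D ≤
      ENNReal.ofReal (Real.exp (10 * (g ⬝ᵥ g))) * D A) {N m : ℕ} (hm : 0 < m) (s : ℝ) :
    Measure.pi (fun _ : Fin N => D) {S | count A S = m ∧
      m * s < (∑ n, A.indicator ζ (S n)) ⬝ᵥ (∑ n, A.indicator ζ (S n))} ≤
      ENNReal.ofReal (√2 ^ d * Real.exp (-s / 80)) := by
  classical
  have hm' : (0 : ℝ) < m := by exact_mod_cast hm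
  set P := Measure.pi (fun _ : Fin N => D)
  -- With this value the corrections `10 c ^ 2 (g ⬝ᵥ g)` of `m` examples add up to `g ⬝ᵥ g / 4`,
  -- which is compensated in `F`.
  set c : ℝ := (√(40 * m))⁻¹ with hc
  have hc2 : c ^ 2 * (40 * m) = 1 := by
    rw [hc, inv_pow, Real.sq_sqrt (by positivity)]
    exact inv_mul_cancel₀ (by positivity)
  -- Examples outside `A` contribute the factor `1`. So the product has mean at most `1` over the
  -- whole sample, without conditioning on which examples fall into `A`.
  let f : (Fin d → ℝ) → Z → ENNReal := fun g z =>
    if z ∈ A then ENNReal.ofReal (Real.exp (-(10 * c ^ 2 * (g ⬝ᵥ g)))) *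
      ENNReal.ofReal (Real.exp ((c • g) ⬝ᵥ ζ z)) else 1
  let F : (Fin d → ℝ) → (Fin N → Z) → ENNReal := fun g S =>
    ENNReal.ofReal (Real.exp (g ⬝ᵥ g / 4)) * ∏ n, f g (S n)
  have hfm : Measurable (Function.uncurry f) := by
    refine Measurable.ite (measurable_snd hA) ?_ measurable_const
    simp only [dotProduct]
    fun_prop
  have hFm : Measurable (Function.uncurry F) := by
    refine Measurable.mul ?_ (Finset.measurable_prod _ fun n _ => ?_)
    · simp only [dotProduct]
      fun_prop
    · exact hfm.comp (measurable_fst.prodMk ((measurable_pi_apply n).comp measurable_snd))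
  have hf1 : ∀ g, ∫⁻ z, f g z ∂D ≤ 1 := by
    intro g
    rw [← lintegral_add_compl _ hA]
    have h1 : ∫⁻ z in A, f g z ∂D = ∫⁻ z in A, ENNReal.ofReal (Real.exp (-(10 * c ^ 2 * (g ⬝ᵥ g)))) *
        ENNReal.ofReal (Real.exp ((c • g) ⬝ᵥ ζ z)) ∂D :=
      setLIntegral_congr_fun hA fun z hz => by simp only [f, if_pos hz]
    have h2 : ∫⁻ z in Aᶜ, f g z ∂D = ∫⁻ z in Aᶜ, 1 ∂D :=
      setLIntegral_congr_fun hA.compl fun z hz => by simp only [f, if_neg hz]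
    rw [h1, h2, lintegral_const_mul _ (by simp only [dotProduct]; fun_prop), setLIntegral_one,
      ← prob_add_prob_compl (μ := D) hA]
    gcongr
    refine (mul_le_mul_right (hmgf (c • g)) _).trans ?_
    rw [← mul_assoc, ← ENNReal.ofReal_mul (Real.exp_pos _).le, ← Real.exp_add]
    simp only [smul_dotProduct, dotProduct_smul, smul_eq_mul]
    rw [show -(10 * c ^ 2 * (g ⬝ᵥ g)) + 10 * (c * (c * (g ⬝ᵥ g))) = 0 by ring]
    simp
  have hint : ∫⁻ S, ∫⁻ g, F g S ∂stdNormal d ∂P ≤ ENNReal.ofReal (√2 ^ d) := by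
    rw [lintegral_lintegral_swap (f := fun S g => F g S) (hFm.comp measurable_swap).aemeasurable, ← lintegral_exp_norm_sq]
    refine lintegral_mono fun g => ?_
    have hfg : Measurable (f g) := hfm.comp measurable_prodMk_left
    change ∫⁻ S, ENNReal.ofReal (Real.exp (g ⬝ᵥ g / 4)) * ∏ n, f g (S n) ∂P ≤ _
    have hpm : Measurable fun S : Fin N → Z => ∏ n, f g (S n) := by fun_prop
    rw [lintegral_const_mul _ hpm, lintegral_pi_prod D (f g) hfg]
    exact mul_le_of_le_one_right' (pow_le_one' (hf1 g) _)
  have hpt : ∀ S, count A S = m → ∫⁻ g, F g S ∂stdNormal d = ENNReal.ofReal (Real.exp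
      ((∑ n, A.indicator ζ (S n)) ⬝ᵥ (∑ n, A.indicator ζ (S n)) / (80 * m))) := by
    intro S hS
    set W := ∑ n, A.indicator ζ (S n) with hW
    have h1 : ∀ g, F g S = ENNReal.ofReal (Real.exp ((c • W) ⬝ᵥ g)) := by
      intro g
      have h2 : ∀ n, f g (S n) = ENNReal.ofReal (Real.exp
          (-(10 * c ^ 2 * (g ⬝ᵥ g)) * A.indicator 1 (S n) + (c • g) ⬝ᵥ A.indicator ζ (S n))) := by
        intro n
        by_cases h : S n ∈ A
        · simp only [f, if_pos h, Set.indicator_of_mem h, Pi.one_apply, mul_one]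
          rw [Real.exp_add, ENNReal.ofReal_mul (Real.exp_pos _).le]
        · simp [f, h]
      simp only [F, h2]
      rw [← ENNReal.ofReal_prod_of_nonneg (fun _ _ => (Real.exp_pos _).le), ← Real.exp_sum,
        ← ENNReal.ofReal_mul (Real.exp_pos _).le, ← Real.exp_add, Finset.sum_add_distrib,
        ← Finset.mul_sum, ← count_eq_sum, hS, ← dotProduct_sum, ← hW]
      congr 2
      rw [smul_dotProduct, smul_dotProduct, dotProduct_comm g W, smul_eq_mul]
      linear_combination (-(g ⬝ᵥ g) / 4) * hc2
    simp only [h1]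
    rw [lintegral_exp_dot]
    congr 2
    simp only [smul_dotProduct, dotProduct_smul, smul_eq_mul]
    rw [eq_div_iff (by positivity)]
    linear_combination (W ⬝ᵥ W) * hc2
  have hmarkov := mul_meas_ge_le_lintegral₀ (μ := P)
    (f := fun S => ∫⁻ g, F g S ∂stdNormal d)
    (hFm.lintegral_prod_left').aemeasurable (ENNReal.ofReal (Real.exp (s / 80)))
  have hE : {S | count A S = m ∧
      m * s < (∑ n, A.indicator ζ (S n)) ⬝ᵥ (∑ n, A.indicator ζ (S n))} ⊆
      {S | ENNReal.ofReal (Real.exp (s / 80)) ≤ ∫⁻ g, F g S ∂stdNormal d} := by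
    rintro S ⟨hS, hW⟩
    simp only [Set.mem_ofPred_eq]
    rw [hpt S hS]
    refine ENNReal.ofReal_le_ofReal (Real.exp_le_exp.mpr ?_)
    rw [div_le_div_iff₀ (by norm_num) (by positivity)]
    nlinarith
  have h3 := ((mul_le_mul_right (measure_mono hE) _).trans hmarkov).trans hint
  rw [mul_comm] at h3
  have h4 := (ENNReal.le_div_iff_mul_le (Or.inl (by simp [Real.exp_pos]))
    (Or.inl ENNReal.ofReal_ne_top)).mpr h3
  refine h4.trans ?_
  rw [← ENNReal.ofReal_div_of_pos (Real.exp_pos _), div_eq_mul_inv, ← Real.exp_neg, neg_div]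

/-! ### The probability that a sample is good -/

section good

variable {d k K N : ℕ} {v : Fin k → Fin d → ℝ} {r : ℝ} {ι : Type*}
  {D : Measure ((Fin d → ℝ) × Fin K)} [IsProbabilityMeasure D]

/-- The product of a functional of the orthogonal part with the indicator of a label is dominated by
the functional alone, which is Gaussian within the cell. Nothing else about the joint law of points
and labels is used. -/
theorem CellData.lintegral_exp_le (hD : D.map Prod.fst = stdNormal d) (hv : IsOrtho v)
    (C : CellData v r ι) (j : ι) (l : Fin K) (g : Fin d → ℝ) :
    ∫⁻ p in C.exampleSet K j, ENNReal.ofReal (Real.exp (g ⬝ᵥ ((if p.2 = l then perp v p.1 else 0) -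
      condMoment D v (C.exampleSet K j) l))) ∂D ≤
      ENNReal.ofReal (Real.exp (10 * (g ⬝ᵥ g))) * D (C.exampleSet K j) := by
  by_cases hj : D (C.exampleSet K j) = 0
  · rw [setLIntegral_measure_zero _ _ hj]; exact zero_le
  have : IsProbabilityMeasure (D[|C.exampleSet K j]) := cond_isProbabilityMeasure hj
  have hlaw := C.map_cond_perp hD hv j hj g
  rw [map_dot_stdNormal] at hlaw
  have hset : MeasurableSet {p : (Fin d → ℝ) × Fin K | p.2 = l} :=
    measurable_snd (measurableSet_singleton l)
  have h1 := lintegral_exp_sub_integral_le (D[|C.exampleSet K j])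
    (Y := fun p => (g ⬝ᵥ perp v p.1) * (if p.2 = l then 1 else 0))
    (G := fun p => g ⬝ᵥ perp v p.1)
    (Measurable.mul (by fun_prop) (Measurable.ite hset measurable_const measurable_const))
    (by fun_prop) hlaw (fun p => by split_ifs <;> simp)
  rw [← C.dot_condMoment hD hv j hj g l, Real.coe_toNNReal _ (dotProduct_self_nonneg' _)] at h1
  have h2 : ∀ p : (Fin d → ℝ) × Fin K, g ⬝ᵥ ((if p.2 = l then perp v p.1 else 0) -
      condMoment D v (C.exampleSet K j) l) = (g ⬝ᵥ perp v p.1) * (if p.2 = l then 1 else 0) -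
      g ⬝ᵥ condMoment D v (C.exampleSet K j) l := fun p => by
    rw [dotProduct_sub]; split_ifs <;> simp
  simp only [h2]
  have h3 : perp v g ⬝ᵥ perp v g ≤ g ⬝ᵥ g := by
    rw [hv.pythagoras g]
    linarith [dotProduct_self_nonneg' (proj v g)]
  rw [ProbabilityTheory.cond, lintegral_smul_measure, smul_eq_mul,
    ENNReal.inv_mul_le_iff hj (measure_ne_top _ _)] at h1
  refine h1.trans ?_
  rw [mul_comm]
  gcongr

/-- Samples are good with high probability. -/
theorem CellData.measure_not_goodSample_le (hD : D.map Prod.fst = stdNormal d) (hv : IsOrtho v)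
    (C : CellData v r ι) (hN : 0 < N) {ξ s : ℝ} (hξ : 0 ≤ ξ) :
    Measure.pi (fun _ : Fin N => D) {S | ¬ GoodSample D C S ξ s} ≤
      ENNReal.ofReal (C.cells.card * (K * (2 * Real.exp (-2 * N * ξ ^ 2) +
        N * (√2 ^ d * Real.exp (-s / 80))))) := by
  classical
  set P := Measure.pi (fun _ : Fin N => D)
  let ζ : ι → Fin K → (Fin d → ℝ) × Fin K → Fin d → ℝ := fun j l p =>
    (if p.2 = l then perp v p.1 else 0) - condMoment D v (C.exampleSet K j) l
  let W : ι → Fin K → (Fin N → (Fin d → ℝ) × Fin K) → Fin d → ℝ := fun j l S =>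
    ∑ n, (C.exampleSet K j).indicator (ζ j l) (S n)
  have hset : ∀ l, MeasurableSet {p : (Fin d → ℝ) × Fin K | p.2 = l} := fun l =>
    measurable_snd (measurableSet_singleton l)
  have hζ : ∀ j l, Measurable (ζ j l) := fun j l =>
    (Measurable.ite (hset l) (by fun_prop) measurable_const).sub_const _
  -- The union also runs over the possible counts `m` of a cell, whence the factor `N` in the bound.
  have hsub : {S | ¬ GoodSample D C S ξ s} ⊆ ⋃ j ∈ C.cells, ⋃ l ∈ (Finset.univ : Finset (Fin K)),
      ({S | ¬ |(count (C.labelSet K j l) S : ℝ) / N - D.real (C.labelSet K j l)| ≤ ξ} ∪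
      ⋃ m ∈ Finset.Icc 1 N, {S | count (C.exampleSet K j) S = m ∧
        m * s < W j l S ⬝ᵥ W j l S}) := by
    intro S hS
    by_contra hcon
    simp only [Set.mem_iUnion, Set.mem_union, Finset.mem_univ, not_exists, not_or, exists_prop,
      Set.mem_ofPred_eq, not_and, not_not, true_and, not_lt] at hcon
    refine hS ⟨fun j hj l => (hcon j hj l).1, fun j hj l h0 => ?_⟩
    have h1 := (hcon j hj l).2 (count (C.exampleSet K j) S)
      (Finset.mem_Icc.mpr ⟨h0, (Finset.card_le_univ _).trans_eq (Fintype.card_fin N)⟩) rfl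
    have h0' : (0 : ℝ) < count (C.exampleSet K j) S := by exact_mod_cast h0
    have h2 : W j l S = (count (C.exampleSet K j) S : ℝ) •
        (empMoment v (C.exampleSet K j) S l - condMoment D v (C.exampleSet K j) l) := by
      rw [empMoment, smul_sub, smul_smul, mul_inv_cancel₀ h0'.ne', one_smul, count_eq_sum,
        Finset.sum_smul, ← Finset.sum_sub_distrib]
      refine Finset.sum_congr rfl fun n _ => ?_
      by_cases h : S n ∈ C.exampleSet K j <;> simp [h, ζ]
    rw [h2, smul_dotProduct, dotProduct_smul, smul_eq_mul, smul_eq_mul] at h1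
    exact le_of_mul_le_mul_left h1 h0'
  have hbound : ∀ j l, P ({S | ¬ |(count (C.labelSet K j l) S : ℝ) / N -
      D.real (C.labelSet K j l)| ≤ ξ} ∪ ⋃ m ∈ Finset.Icc 1 N, {S | count (C.exampleSet K j) S = m ∧
        m * s < W j l S ⬝ᵥ W j l S}) ≤ ENNReal.ofReal (2 * Real.exp (-2 * N * ξ ^ 2) +
        N * (√2 ^ d * Real.exp (-s / 80))) := by
    intro j l
    rw [ENNReal.ofReal_add (by positivity) (by positivity)]
    refine (measure_union_le _ _).trans (add_le_add ?_ ?_)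
    · exact measure_count_deviation_le D ((C.measurableSet_exampleSet j).inter (hset l)) hN hξ
    · refine (measure_biUnion_finset_le _ _).trans ?_
      refine (Finset.sum_le_sum fun m hm => measure_vector_deviation_le D
        (C.measurableSet_exampleSet j) (hζ j l) (C.lintegral_exp_le hD hv j l)
        (Finset.mem_Icc.mp hm).1 s).trans ?_
      rw [Finset.sum_const, nsmul_eq_mul, ENNReal.ofReal_mul (Nat.cast_nonneg _)]
      simp
  refine (measure_mono hsub).trans ((measure_biUnion_finset_le _ _).trans ?_)
  refine (Finset.sum_le_sum fun j _ => (measure_biUnion_finset_le _ _).trans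
    (Finset.sum_le_sum fun l _ => hbound j l)).trans ?_
  simp only [Finset.sum_const, nsmul_eq_mul, Finset.card_univ, Fintype.card_fin]
  rw [ENNReal.ofReal_mul (Nat.cast_nonneg _), ENNReal.ofReal_mul (Nat.cast_nonneg _)]
  simp

end good

/-! ### Results of programs -/

namespace Prog

variable {α β : Type} (E : EigenSolver)

theorem run_bind (p : Prog ℝ α) (g : α → Prog ℝ β) :
    (p >>= g).run E = (g (p.run E)).run E := by
  change (Prog.bind p g).run E = _
  induction p <;> simp [Prog.bind, run, *]

theorem steps_bind (p : Prog ℝ α) (g : α → Prog ℝ β) :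
    (p >>= g).steps E = p.steps E + (g (p.run E)).steps E := by
  change (Prog.bind p g).steps E = _
  induction p <;> simp [Prog.bind, run, steps, *, add_assoc]

theorem run_pure (a : α) : (pure a : Prog ℝ α).run E = a := rfl
theorem run_charge' (n : ℕ) : (charge' n : Prog ℝ Unit).run E = () := rfl
theorem run_const' (q : ℚ) : (const' q : Prog ℝ ℝ).run E = q := rfl
theorem run_add' (x y : ℝ) : (add' x y).run E = x + y := rfl
theorem run_sub' (x y : ℝ) : (sub' x y).run E = x - y := rfl
theorem run_mul' (x y : ℝ) : (mul' x y).run E = x * y := rfl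
theorem run_div' (x y : ℝ) : (div' x y).run E = x / y := rfl
theorem run_sqrt' (x : ℝ) : (sqrt' x).run E = √x := rfl
theorem run_log' (x : ℝ) : (log' x).run E = Real.log x := rfl
theorem run_ceil' (x : ℝ) : (ceil' x).run E = ⌈x⌉₊ := rfl
theorem run_eigh' {n : ℕ} (M : Fin n → Fin n → ℝ) : (eigh' M).run E = E.solve n M := rfl

open Classical in
theorem run_lt' (x y : ℝ) : (lt' x y).run E = decide (x < y) := by
  simp only [lt', run]

theorem run_forEach {σ : Type} (l : List β) (s : σ) (body : σ → β → Prog ℝ σ) :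
    (forEach l s body).run E = l.foldl (fun s b => (body s b).run E) s := by
  induction l generalizing s with
  | nil => rfl
  | cons b l ih =>
    change ((body s b >>= fun s' => forEach l s' body)).run E = _
    rw [run_bind, ih, List.foldl_cons]

theorem run_tabulate {n : ℕ} (f : Fin n → Prog ℝ β) :
    (tabulate n f).run E = fun i => (f i).run E := by
  induction n with
  | zero => funext i; exact i.elim0
  | succ n ih =>
    change ((f 0 >>= fun b => tabulate n (fun i => f i.succ) >>= fun bs =>
      (pure (Fin.cons b bs : Fin (n + 1) → β) : Prog ℝ _))).run E = _
    rw [run_bind, run_bind, ih, run_pure]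
    funext i
    refine Fin.cases ?_ (fun i => ?_) i <;> simp

end Prog

open Prog

variable (E : EigenSolver)

theorem foldl_add_eq_sum {β M : Type*} [AddCommMonoid M] (l : List β) (f : β → M) (s : M) :
    l.foldl (fun s b => s + f b) s = s + (l.map f).sum := by
  induction l generalizing s with
  | nil => simp
  | cons b l ih => rw [List.foldl_cons, ih, List.map_cons, List.sum_cons, add_assoc]

theorem run_dot {d : ℕ} (x y : Fin d → ℝ) : (dot x y).run E = x ⬝ᵥ y := by
  simp only [dot, run_bind, run_forEach, run_const', run_mul', run_add']
  rw [foldl_add_eq_sum, ← List.ofFn_eq_map, List.sum_ofFn]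
  simp [dotProduct]

/-! ### Cells -/

open Classical in
/-- The index of the first of the intervals `[a + j w, a + (j + 1) w]`, `j < m`, that contains `p`. -/
noncomputable def intervalIndex (a w : ℝ) (m : ℕ) (p : ℝ) : Option ℕ :=
  (List.range m).find? fun j => decide (a + j * w ≤ p ∧ p ≤ a + (j + 1) * w)

/-- The index of the cell of a point. -/
def cellIndex {d : ℕ} (q : ℝ → Option ℕ) (L : List (Fin d → ℝ)) (x : Fin d → ℝ) :
    Option (List ℕ) :=
  L.foldr (fun v found => found.bind fun js => (q (v ⬝ᵥ x)).map fun i => i :: js) (some [])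

/-- The loop has no early exit: once an index is found, the remaining rounds hand it on. The test
`c` signals failure, hence the negation. -/
theorem foldl_find {β : Type*} (l : List β) (c : β → Bool) (o : Option β) :
    l.foldl (fun found j => match found with
      | some i => some i
      | none => if c j then none else some j) o = o.or (l.find? fun j => !c j) := by
  induction l generalizing o with
  | nil => cases o <;> rfl
  | cons b l ih =>
    rw [List.foldl_cons, ih, List.find?_cons]
    cases o with
    | none => cases h : c b <;> simp
    | some i => simp

theorem run_threshold {d : ℕ} (P : Partition ℝ d) (i : ℕ) :
    (threshold P i).run E = P.start + i * P.width := by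
  simp [threshold, run_bind, run_const', run_mul', run_add']

theorem run_intervalOf {d : ℕ} (P : Partition ℝ d) (p : ℝ) :
    (intervalOf P p).run E = intervalIndex P.start P.width P.num p := by
  classical
  rw [intervalOf, run_forEach, intervalIndex]
  have h := foldl_find (List.range P.num)
    (fun j => decide (p < P.start + j * P.width) || decide (P.start + (j + 1) * P.width < p)) none
  rw [Option.none_or] at h
  refine Eq.trans ?_ (h.trans ?_)
  · congr 1
    funext found j
    cases found with
    | some i => rfl
    | none =>
      simp only [run_bind, run_threshold, run_lt', run_pure]
      push_cast
      rfl
  · congr 1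
    funext j
    by_cases h1 : p < P.start + j * P.width <;>
      by_cases h2 : P.start + (j + 1) * P.width < p <;>
      simp [h1, h2, not_lt.mp, not_le]

theorem run_cellOf {d : ℕ} (P : Partition ℝ d) (x : Fin d → ℝ) :
    (cellOf P x).run E = cellIndex (intervalIndex P.start P.width P.num) P.basis x := by
  rw [cellOf, run_forEach, List.foldl_reverse, cellIndex]
  congr 1
  funext v found
  cases found with
  | none => rfl
  | some js => simp only [run_bind, run_dot, run_intervalOf, run_pure, Option.bind_some]

/-- The cell index is determined coordinate by coordinate; one coordinate outside the grid is enough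
for there to be no cell. -/
theorem cellIndex_eq_some_iff {d : ℕ} (q : ℝ → Option ℕ) (L : List (Fin d → ℝ)) (x : Fin d → ℝ)
    (js : List ℕ) : cellIndex q L x = some js ↔
      js.length = L.length ∧ ∀ i : Fin L.length, q (L.get i ⬝ᵥ x) = js[i.1]? := by
  induction L generalizing js with
  | nil =>
    simp only [cellIndex, List.foldr_nil, Option.some.injEq, List.length_nil]
    constructor
    · rintro rfl; exact ⟨rfl, fun i => i.elim0⟩
    · rintro ⟨h, -⟩; exact (List.length_eq_zero_iff.mp h).symm
  | cons v L ih =>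
    have h1 : cellIndex q (v :: L) x =
        (cellIndex q L x).bind fun js => (q (v ⬝ᵥ x)).map fun i => i :: js := rfl
    rw [h1, Option.bind_eq_some_iff]
    constructor
    · rintro ⟨js', h2, h3⟩
      obtain ⟨i, hi, rfl⟩ := Option.map_eq_some_iff.mp h3
      obtain ⟨h4, h5⟩ := (ih js').mp h2
      refine ⟨by simp [h4], ?_⟩
      intro l
      refine Fin.cases ?_ (fun l => ?_) l
      · simpa using hi
      · simpa using h5 l
    · rintro ⟨h2, h3⟩
      cases js with
      | nil => simp at h2
      | cons i js =>
        refine ⟨js, (ih js).mpr ⟨by simpa using h2, fun l => by simpa using h3 l.succ⟩, ?_⟩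
        have := h3 ⟨0, by simp⟩
        simp only [List.get_eq_getElem, List.getElem_cons_zero, List.getElem?_cons_zero] at this
        simp [this]

theorem intervalIndex_eq_some {a w p : ℝ} {m j : ℕ} (h : intervalIndex a w m p = some j) :
    j < m ∧ a + j * w ≤ p ∧ p ≤ a + (j + 1) * w := by
  have h1 := List.mem_of_find?_eq_some h
  have h2 := List.find?_some h
  exact ⟨List.mem_range.mp h1, by simpa using h2⟩

/-- Consecutive intervals share an endpoint. A point beyond the left end that misses the first
intervals therefore lies to the right of all of them. -/
theorem intervalIndex_eq_none {a w p : ℝ} {m : ℕ} (hm : 0 < m)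
    (h : intervalIndex a w m p = none) : p < a ∨ a + m * w < p := by
  by_contra hcon
  rw [not_or, not_lt, not_lt] at hcon
  rw [intervalIndex, List.find?_eq_none] at h
  have h1 : ∀ j, j < m → a + (j + 1 : ℕ) * w < p := by
    intro j
    induction j with
    | zero =>
      intro hj
      have := h 0 (List.mem_range.mpr hj)
      simp only [CharP.cast_eq_zero, zero_mul, add_zero, zero_add, one_mul, decide_eq_true_eq,
        not_and, not_le] at this
      simpa using this hcon.1
    | succ j ih =>
      intro hj
      have := h (j + 1) (List.mem_range.mpr hj)
      simp only [decide_eq_true_eq, not_and, not_le] at this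
      have := this (ih (by omega)).le
      push_cast at this ⊢
      exact this
  have := h1 (m - 1) (by omega)
  rw [Nat.sub_add_cancel hm] at this
  linarith [hcon.2]

theorem measurableSet_intervalIndex (a w : ℝ) (m : ℕ) (o : Option ℕ) :
    MeasurableSet {p | intervalIndex a w m p = o} := by
  classical
  unfold intervalIndex
  induction List.range m with
  | nil => simp
  | cons j l ih =>
    have hj : MeasurableSet {p : ℝ | a + j * w ≤ p ∧ p ≤ a + (j + 1) * w} := measurableSet_Icc
    have : {p | (j :: l).find? (fun j : ℕ => decide (a + j * w ≤ p ∧ p ≤ a + (j + 1) * w)) = o} =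
        ({p | a + j * w ≤ p ∧ p ≤ a + (j + 1) * w} ∩ {_p | some j = o}) ∪
        ({p | a + j * w ≤ p ∧ p ≤ a + (j + 1) * w}ᶜ ∩
          {p | l.find? (fun j : ℕ => decide (a + j * w ≤ p ∧ p ≤ a + (j + 1) * w)) = o}) := by
      ext p
      by_cases h : a + j * w ≤ p ∧ p ≤ a + (j + 1) * w
      · simp [List.find?_cons, h]
      · simp only [Set.mem_ofPred_eq, List.find?_cons, Set.mem_union, Set.mem_inter_iff,
          Set.mem_compl_iff, h]
        simp
    rw [this]
    exact (hj.inter (MeasurableSet.const _)).union (hj.compl.inter ih)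

/-! ### Partitions into boxes -/

/-- The possible indices of boxes. -/
def boxIndices (k m : ℕ) : Finset (List ℕ) :=
  Finset.univ.image fun f : Fin k → Fin m => List.ofFn fun i => (f i : ℕ)

/-- The cells of a partition into boxes. -/
noncomputable def boxCells {d : ℕ} (a w : ℝ) (hw : 0 ≤ w) (m : ℕ) {L : List (Fin d → ℝ)}
    (hL : IsOrtho L.get) : CellData L.get (√L.length * w) (List ℕ) where
  cells := boxIndices L.length m
  cell := cellIndex (intervalIndex a w m) L
  -- The lower corner of the box. The default `0` is never used for the index of an actual cell,
  -- whose length is that of `L`.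
  rep js := ∑ i : Fin L.length, (a + (js.getD i 0) * w) • L.get i
  mem_cells x js h := by
    obtain ⟨h1, h2⟩ := (cellIndex_eq_some_iff _ _ _ _).mp h
    have h3 : ∀ i : Fin L.length, intervalIndex a w m (L.get i ⬝ᵥ x) = some js[i.1] := fun i => by
      rw [h2 i, List.getElem?_eq_getElem]
    refine Finset.mem_image.mpr ⟨fun i => ⟨js[i.1], (intervalIndex_eq_some (h3 i)).1⟩,
      Finset.mem_univ _, ?_⟩
    refine List.ext_getElem (by simp [h1]) fun i _ _ => by simp
  exists_eq js := by
    refine ⟨{_y | js.length = L.length} ∩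
      ⋂ i : Fin L.length, {y | intervalIndex a w m (y i) = js[i.1]?}, ?_, ?_⟩
    · exact (MeasurableSet.const _).inter (MeasurableSet.iInter fun i =>
        (measurable_pi_apply (X := fun _ : Fin L.length => ℝ) i)
          (measurableSet_intervalIndex a w m (js[i.1]?)))
    · ext x
      simp only [Set.mem_ofPred_eq, cellIndex_eq_some_iff, Set.mem_inter_iff, Set.mem_iInter]
  close x js h b := by
    obtain ⟨h1, h2⟩ := (cellIndex_eq_some_iff _ _ _ _).mp h
    have h3 : ∀ i : Fin L.length,
        (L.get i ⬝ᵥ x - (a + (js.getD i 0) * w)) ^ 2 ≤ w ^ 2 := fun i => by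
      have h4 := h2 i
      rw [List.getElem?_eq_getElem (by omega)] at h4
      obtain ⟨-, h5, h6⟩ := intervalIndex_eq_some h4
      rw [List.getD_eq_getElem _ _ (by omega)]
      apply sq_le_sq' <;> linarith
    have h4 : b ⬝ᵥ (proj L.get x - ∑ i : Fin L.length, (a + (js.getD i 0) * w) • L.get i) =
        ∑ i : Fin L.length, (L.get i ⬝ᵥ x - (a + (js.getD i 0) * w)) * (L.get i ⬝ᵥ b) := by
      rw [proj, ← Finset.sum_sub_distrib, dotProduct_sum]
      refine Finset.sum_congr rfl fun i _ => ?_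
      rw [← sub_smul, dotProduct_smul, smul_eq_mul, dotProduct_comm b]
    have h5 : √L.length * w * √(∑ i, (L.get i ⬝ᵥ b) ^ 2) =
        √(L.length * w ^ 2 * ∑ i, (L.get i ⬝ᵥ b) ^ 2) := by
      rw [Real.sqrt_mul (by positivity), Real.sqrt_mul (Nat.cast_nonneg _), Real.sqrt_sq hw]
    rw [h4, len, hL.proj_dot_proj, h5]
    refine Real.abs_le_sqrt ((Finset.sum_mul_sq_le_sq_mul_sq _ _ _).trans ?_)
    refine mul_le_mul_of_nonneg_right ?_ (Finset.sum_nonneg fun i _ => sq_nonneg _)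
    exact (Finset.sum_le_sum fun i _ => h3 i).trans (by simp)

theorem card_boxCells_le {d : ℕ} (a w : ℝ) (hw : 0 ≤ w) (m : ℕ) {L : List (Fin d → ℝ)}
    (hL : IsOrtho L.get) : (boxCells a w hw m hL).cells.card ≤ m ^ L.length := by
  refine Finset.card_image_le.trans ?_
  simp

/-- Few points lie outside of all cells. -/
theorem measureReal_boxCells_none_le {d : ℕ} {L : List (Fin d → ℝ)} (hL : IsOrtho L.get)
    {w τ R : ℝ} (hw : 0 < w) (hτ : 0 ≤ τ) (hR : 0 ≤ R) {m : ℕ} (hm : 0 < m) (hmR : 2 * R ≤ m * w) :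
    (stdNormal d).real {x | (boxCells (-R + τ) w hw.le m hL).cell x = none} ≤
      L.length * (2 * Real.exp (-R ^ 2 / 2) + τ) := by
  -- Besides the two tails of each coordinate there is the strip between `-R` and `-R + τ` that the
  -- offset leaves uncovered. On the right the grid reaches beyond `R`, as `2 R ≤ m w`.
  have hsub : {x | (boxCells (-R + τ) w hw.le m hL).cell x = none} ⊆
      ⋃ i ∈ (Finset.univ : Finset (Fin L.length)), (({x | R ≤ (-L.get i) ⬝ᵥ x} ∪
        {x | R ≤ L.get i ⬝ᵥ x}) ∪ (L.get i ⬝ᵥ ·) ⁻¹' Set.Icc (-R) (-R + τ)) := by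
    intro x hx
    have hx' : cellIndex (intervalIndex (-R + τ) w m) L x = none := hx
    by_contra hcon
    simp only [Set.mem_iUnion, Finset.mem_univ, exists_prop, true_and, not_exists, Set.mem_union,
      not_or, Set.mem_ofPred_eq, not_le, Set.mem_preimage, Set.mem_Icc, not_and,
      neg_dotProduct] at hcon
    have h1 : ∀ i : Fin L.length, ∃ j, intervalIndex (-R + τ) w m (L.get i ⬝ᵥ x) = some j := by
      intro i
      refine Option.ne_none_iff_exists'.mp fun h => ?_
      obtain ⟨⟨h2, h3⟩, h4⟩ := hcon i
      rcases intervalIndex_eq_none hm h with h5 | h5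
      · linarith [h4 (by linarith)]
      · linarith
    choose f hf using h1
    have h2 := (cellIndex_eq_some_iff (intervalIndex (-R + τ) w m) L x (List.ofFn f)).mpr
      ⟨by simp, fun i => by rw [hf i]; simp⟩
    rw [hx'] at h2
    cases h2
  refine (measureReal_mono hsub (measure_ne_top _ _)).trans
    ((measureReal_biUnion_finset_le _ _).trans ?_)
  refine (Finset.sum_le_sum (g := fun _ => 2 * Real.exp (-R ^ 2 / 2) + τ) fun i _ => ?_).trans
    (le_of_eq (by simp; ring))
  have h1 : L.get i ⬝ᵥ L.get i = 1 := by simpa using hL i i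
  have h2 : ∀ {v : Fin d → ℝ}, v ⬝ᵥ v = 1 →
      (stdNormal d).real {x | R ≤ v ⬝ᵥ x} ≤ Real.exp (-R ^ 2 / 2) := fun hv =>
    ENNReal.toReal_le_of_le_ofReal (Real.exp_pos _).le (stdNormal_unit_tail_le hv hR)
  have h3 : (stdNormal d).real ((L.get i ⬝ᵥ ·) ⁻¹' Set.Icc (-R) (-R + τ)) ≤ τ := by
    refine ENNReal.toReal_le_of_le_ofReal hτ ?_
    rw [← Measure.map_apply (measurable_dot_right _) measurableSet_Icc, map_dot_unit h1]
    refine (gaussianReal_Icc_le _ _).trans (ENNReal.ofReal_le_ofReal ?_)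
    linarith
  refine (measureReal_union_le _ _).trans ((add_le_add_left (measureReal_union_le _ _) _).trans ?_)
  linarith [h2 h1, h2 (v := -L.get i) (by simpa using h1)]

/-! ### Approximating partitions -/

/-- The result of `mkPartition`. -/
noncomputable def partitionOf {d : ℕ} (ε' τ : ℝ) (L : List (Fin d → ℝ)) : Partition ℝ d where
  basis := L
  start := -√(2 * Real.log (L.length / ε')) + τ
  width := ε'
  num := ⌈2 * √(2 * Real.log (L.length / ε')) / ε'⌉₊

theorem run_mkPartition {d : ℕ} (ε' τ : ℝ) (L : List (Fin d → ℝ)) :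
    (mkPartition ε' τ L).run E = partitionOf ε' τ L := by
  simp [mkPartition, run_bind, run_const', run_div', run_log', run_mul', run_sqrt', run_ceil',
    run_sub', run_add', run_pure, partitionOf]

/-- The cells of an approximating partition. -/
noncomputable def partitionCells {d : ℕ} {ε' : ℝ} (hε : 0 < ε') (τ : ℝ) {L : List (Fin d → ℝ)}
    (hL : IsOrtho L.get) : CellData L.get (√L.length * ε') (List ℕ) :=
  boxCells (partitionOf ε' τ L).start ε' hε.le (partitionOf ε' τ L).num hL

theorem run_cellOf_partitionOf {d : ℕ} {ε' : ℝ} (hε : 0 < ε') (τ : ℝ) {L : List (Fin d → ℝ)}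
    (hL : IsOrtho L.get) (x : Fin d → ℝ) :
    (cellOf (partitionOf ε' τ L) x).run E = (partitionCells hε τ hL).cell x := by
  rw [run_cellOf]; rfl

/-- The range of the grid makes each of the two tails of a coordinate at most `ε' / k`. Without
coordinates the only cell is the whole space, and this case is separate because `log 0` carries no
information. -/
theorem measureReal_partitionCells_none_le {d : ℕ} {ε' : ℝ} (hε : 0 < ε') (hε1 : ε' < 1) {τ : ℝ}
    (hτ : 0 ≤ τ) {L : List (Fin d → ℝ)} (hL : IsOrtho L.get) :
    (stdNormal d).real {x | (partitionCells hε τ hL).cell x = none} ≤ 2 * ε' + L.length * τ := by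
  rcases Nat.eq_zero_or_pos L.length with h0 | h0
  · have : {x | (partitionCells hε τ hL).cell x = none} = ∅ := by
      ext x
      have : (partitionCells hε τ hL).cell x = some [] :=
        (cellIndex_eq_some_iff _ L x []).mpr ⟨h0.symm, fun i => absurd i.2 (by omega)⟩
      simp [this]
    rw [this]
    simp [h0, hε.le]
  have hk : (1 : ℝ) ≤ L.length := by exact_mod_cast h0
  set R := √(2 * Real.log (L.length / ε')) with hR
  have hlog : 0 < Real.log (L.length / ε') := by
    apply Real.log_pos
    rw [lt_div_iff₀ hε]
    linarith
  have hRpos : 0 < R := Real.sqrt_pos.mpr (by linarith)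
  have hnum : 2 * R / ε' ≤ (partitionOf ε' τ L).num := Nat.le_ceil _
  have h := measureReal_boxCells_none_le hL (w := ε') (τ := τ) (R := R) hε hτ hRpos.le
    (m := (partitionOf ε' τ L).num) (Nat.ceil_pos.mpr (by positivity))
    (by rwa [div_le_iff₀ hε] at hnum)
  refine h.trans (le_of_eq ?_)
  rw [hR, neg_div, Real.sq_sqrt (by linarith), mul_div_cancel_left₀ _ two_ne_zero, Real.exp_neg,
    Real.exp_log (by positivity)]
  field_simp

open Prog

variable (E : EigenSolver)

/-! ### Samples and cells -/

section samples

variable {d K : ℕ}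

theorem foldl_cons_filterMap {α β : Type*} (f : α → Option β) (l : List α) (acc : List β) :
    l.foldl (fun acc a => match f a with | none => acc | some b => b :: acc) acc =
      (l.filterMap f).reverse ++ acc := by
  induction l generalizing acc with
  | nil => simp
  | cons a l ih =>
    rw [List.foldl_cons, ih, List.filterMap_cons]
    cases f a <;> simp

theorem run_locate (P : Partition ℝ d) (S : List (Example ℝ d K)) :
    (locate P S).run E =
      (S.filterMap fun e => ((cellOf P e.1).run E).map fun js => (js, e)).reverse := by
  rw [locate, run_forEach]
  have h := foldl_cons_filterMap (fun e : Example ℝ d K => ((cellOf P e.1).run E).map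
    fun js => (js, e)) S []
  rw [List.append_nil] at h
  rw [← h]
  congr 1
  funext acc e
  rw [run_bind]
  cases (cellOf P e.1).run E <;> rfl

theorem run_sameCell (a b : List ℕ) : (sameCell a b : Prog ℝ Bool).run E = decide (a = b) := rfl

theorem run_occupied (Q : List (List ℕ × Example ℝ d K)) :
    ((occupied Q).run E).Nodup ∧ ∀ js, js ∈ (occupied Q).run E ↔ ∃ q ∈ Q, q.1 = js := by
  have hseen : ∀ (cells : List (List ℕ)) (c : List ℕ) (b : Bool),
      cells.foldl (fun b c' => b || decide (c' = c)) b = (b || decide (c ∈ cells)) := by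
    intro cells c b
    induction cells generalizing b with
    | nil => simp
    | cons a l ih =>
      rw [List.foldl_cons, ih]
      by_cases h : a = c
      · simp [h]
      · simp [h, Ne.symm h]
  rw [occupied, run_forEach]
  have hbody : ∀ (cells : List (List ℕ)) (q : List ℕ × Example ℝ d K),
      (do
        let seen ← forEach cells false fun b c => do
          let s ← sameCell c q.1
          pure (b || s)
        pure (if seen then cells else q.1 :: cells) : Prog ℝ (List (List ℕ))).run E =
      if q.1 ∈ cells then cells else q.1 :: cells := by
    intro cells q
    simp only [run_bind, run_pure, run_forEach, run_sameCell, hseen, Bool.false_or,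
      decide_eq_true_eq]
  simp only [hbody]
  have key : ∀ (acc : List (List ℕ)), acc.Nodup →
      (Q.foldl (fun cells q => if q.1 ∈ cells then cells else q.1 :: cells) acc).Nodup ∧
      ∀ js, js ∈ Q.foldl (fun cells q => if q.1 ∈ cells then cells else q.1 :: cells) acc ↔
        js ∈ acc ∨ ∃ q ∈ Q, q.1 = js := by
    induction Q with
    | nil => simp
    | cons q Q ih =>
      intro acc hacc
      rw [List.foldl_cons]
      split_ifs with h
      · refine ⟨(ih acc hacc).1, fun js => ?_⟩
        rw [(ih acc hacc).2]
        constructor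
        · rintro (h1 | ⟨q', h1, h2⟩)
          · exact Or.inl h1
          · exact Or.inr ⟨q', List.mem_cons_of_mem _ h1, h2⟩
        · rintro (h1 | ⟨q', h1, h2⟩)
          · exact Or.inl h1
          · rcases List.mem_cons.mp h1 with rfl | h3
            · exact Or.inl (h2 ▸ h)
            · exact Or.inr ⟨q', h3, h2⟩
      · have h0 := ih (q.1 :: acc) (List.nodup_cons.mpr ⟨h, hacc⟩)
        refine ⟨h0.1, fun js => ?_⟩
        rw [h0.2]
        constructor
        · rintro (h1 | ⟨q', h1, h2⟩)
          · rcases List.mem_cons.mp h1 with rfl | h3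
            · exact Or.inr ⟨q, List.mem_cons_self, rfl⟩
            · exact Or.inl h3
          · exact Or.inr ⟨q', List.mem_cons_of_mem _ h1, h2⟩
        · rintro (h1 | ⟨q', h1, h2⟩)
          · exact Or.inl (List.mem_cons_of_mem _ h1)
          · rcases List.mem_cons.mp h1 with rfl | h3
            · exact Or.inl (h2 ▸ List.mem_cons_self)
            · exact Or.inr ⟨q', h3, h2⟩
  have := key [] List.nodup_nil
  simpa using this

theorem run_examplesIn (Q : List (List ℕ × Example ℝ d K)) (js : List ℕ) :
    (examplesIn Q js).run E = ((Q.filter fun q => q.1 = js).map Prod.snd).reverse := by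
  rw [examplesIn, run_forEach]
  have h := foldl_cons_filterMap (fun q : List ℕ × Example ℝ d K =>
    if q.1 = js then some q.2 else none) Q []
  have h2 : (Q.filterMap fun q => if q.1 = js then some q.2 else none) =
      (Q.filter fun q => q.1 = js).map Prod.snd := by
    rw [← List.filterMap_eq_map, List.filterMap_filter]
    congr 1
    funext q
    by_cases h : q.1 = js <;> simp [h]
  rw [List.append_nil, h2] at h
  rw [← h]
  congr 1
  funext acc q
  simp only [run_bind, run_sameCell, run_pure, decide_eq_true_eq]
  by_cases h : q.1 = js <;> simp [h]

/-- The examples in a cell, up to their order. -/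
theorem run_examplesIn_locate (P : Partition ℝ d) (S : List (Example ℝ d K)) (js : List ℕ) :
    ((examplesIn ((locate P S).run E) js).run E).Perm
      (S.filter fun e => (cellOf P e.1).run E = some js) := by
  rw [run_examplesIn, run_locate]
  refine (List.reverse_perm _).trans ?_
  rw [List.filter_reverse, List.map_reverse]
  refine (List.reverse_perm _).trans (List.Perm.of_eq ?_)
  induction S with
  | nil => rfl
  | cons e S ih =>
    rw [List.filterMap_cons, List.filter_cons]
    cases h : (cellOf P e.1).run E with
    | none => simpa using ih
    | some js' =>
      simp only [Option.map_some, List.filter_cons]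
      by_cases h' : js' = js <;> simp [h', ih]

theorem mem_run_occupied_locate (P : Partition ℝ d) (S : List (Example ℝ d K)) (js : List ℕ) :
    js ∈ (occupied ((locate P S).run E)).run E ↔ ∃ e ∈ S, (cellOf P e.1).run E = some js := by
  rw [(run_occupied E _).2, run_locate]
  simp

end samples

/-! ### Directions -/

section directions

variable {d K : ℕ}

theorem run_moment (S : List (Example ℝ d K)) (i : Fin K) :
    (moment S i).run E =
      (S.length : ℝ)⁻¹ • (S.map fun e => if e.2 = i then e.1 else 0).sum := by
  have h : ∀ acc : Fin d → ℝ, S.foldl (fun acc e => ((if e.2 = i then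
      tabulate d fun l => add' (acc l) (e.1 l) else pure acc) : Prog ℝ (Fin d → ℝ)).run E) acc =
      acc + (S.map fun e => if e.2 = i then e.1 else 0).sum := by
    intro acc
    rw [← foldl_add_eq_sum]
    congr 1
    funext acc e
    split_ifs
    · rw [run_tabulate]; rfl
    · rw [run_pure, add_zero]
  simp only [moment, run_bind, run_forEach, run_const', h, run_tabulate, run_div']
  funext l
  simp [div_eq_inv_mul]

/-- The inner products are taken with the original vector rather than with the partially reduced
one, so the loop evaluates the projection formula literally. -/
theorem run_projPerp (L : List (Fin d → ℝ)) (u : Fin d → ℝ) :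
    (projPerp L u).run E = perp L.get u := by
  have h : ∀ acc : Fin d → ℝ, L.foldl (fun acc v => acc - (v ⬝ᵥ u) • v) acc =
      acc - (L.map fun v => (v ⬝ᵥ u) • v).sum := by
    intro acc
    have := foldl_add_eq_sum L (fun v => -((v ⬝ᵥ u) • v)) acc
    simp only [← sub_eq_add_neg] at this
    rw [this, sub_eq_add_neg]
    congr 1
    induction L with
    | nil => simp
    | cons v L ih =>
      rw [List.map_cons, List.sum_cons, List.map_cons, List.sum_cons, neg_add, ih]
      exact foldl_add_eq_sum L (fun v => -((v ⬝ᵥ u) • v)) acc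
  have h2 : (L.map fun v => (v ⬝ᵥ u) • v).sum = proj L.get u := by
    conv_lhs => rw [← List.ofFn_get L, List.map_ofFn, List.sum_ofFn]
    rfl
  rw [projPerp, run_forEach, perp, ← h2, ← h]
  congr 1
  funext acc v
  simp only [run_bind, run_dot, run_tabulate, run_mul', run_sub']
  funext l
  simp

/-- The matrix whose eigenvectors are computed. -/
noncomputable def estimatedMatrix (ε' τ : ℝ) (L : List (Fin d → ℝ))
    (S : List (Example ℝ d K)) : Fin d → Fin d → ℝ := fun a b =>
  (((occupied ((locate (partitionOf ε' τ L) S).run E)).run E).map fun js =>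
    ∑ i : Fin K, perp L.get ((moment ((examplesIn ((locate (partitionOf ε' τ L) S).run E) js).run E)
        i).run E) a *
      perp L.get ((moment ((examplesIn ((locate (partitionOf ε' τ L) S).run E) js).run E)
        i).run E) b *
      (((examplesIn ((locate (partitionOf ε' τ L) S).run E) js).run E).length / S.length)).sum

theorem run_relevantDirections (ε' σ τ : ℝ) (L : List (Fin d → ℝ)) (S : List (Example ℝ d K)) :
    (relevantDirections ε' σ τ L S).run E =
      (((List.finRange d).filter fun r =>
        decide (σ ≤ (E.solve d (estimatedMatrix E ε' τ L S) r).1)).map fun r =>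
          (E.solve d (estimatedMatrix E ε' τ L S) r).2).reverse := by
  classical
  have hU : ((((occupied ((locate (partitionOf ε' τ L) S).run E)).run E).foldl (fun U js =>
      (List.finRange K).foldl (fun U i => fun a b => U a b +
        perp L.get ((moment ((examplesIn ((locate (partitionOf ε' τ L) S).run E) js).run E)
        i).run E) a *
      perp L.get ((moment ((examplesIn ((locate (partitionOf ε' τ L) S).run E) js).run E)
        i).run E) b *
      (((examplesIn ((locate (partitionOf ε' τ L) S).run E) js).run E).length / S.length)) U)
      (fun _ _ => (0 : ℝ)))) = estimatedMatrix E ε' τ L S := by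
    have h1 : ∀ (js : List ℕ) (U : Fin d → Fin d → ℝ), (List.finRange K).foldl (fun U i =>
        fun a b => U a b +
        perp L.get ((moment ((examplesIn ((locate (partitionOf ε' τ L) S).run E) js).run E)
        i).run E) a *
      perp L.get ((moment ((examplesIn ((locate (partitionOf ε' τ L) S).run E) js).run E)
        i).run E) b *
      (((examplesIn ((locate (partitionOf ε' τ L) S).run E) js).run E).length / S.length)) U =
      U + fun a b => ∑ i : Fin K,
        perp L.get ((moment ((examplesIn ((locate (partitionOf ε' τ L) S).run E) js).run E)
        i).run E) a *
      perp L.get ((moment ((examplesIn ((locate (partitionOf ε' τ L) S).run E) js).run E)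
        i).run E) b *
      (((examplesIn ((locate (partitionOf ε' τ L) S).run E) js).run E).length / S.length) := by
      intro js U
      have := foldl_add_eq_sum (List.finRange K) (fun i => (fun a b =>
        perp L.get ((moment ((examplesIn ((locate (partitionOf ε' τ L) S).run E) js).run E)
        i).run E) a *
      perp L.get ((moment ((examplesIn ((locate (partitionOf ε' τ L) S).run E) js).run E)
        i).run E) b *
      (((examplesIn ((locate (partitionOf ε' τ L) S).run E) js).run E).length / S.length) :
        Fin d → Fin d → ℝ)) U
      refine this.trans ?_
      rw [← List.ofFn_eq_map, List.sum_ofFn]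
      congr 1
      funext a b
      simp
    simp only [h1]
    rw [foldl_add_eq_sum]
    funext a b
    simp only [estimatedMatrix, Pi.add_apply, zero_add]
    have happ : ∀ (l : List (List ℕ)) (F : List ℕ → Fin d → Fin d → ℝ),
        (l.map F).sum a b = (l.map fun js => F js a b).sum := by
      intro l F
      induction l with
      | nil => rfl
      | cons js l ih => rw [List.map_cons, List.sum_cons, List.map_cons, List.sum_cons, ← ih]; rfl
    rw [happ]
  have hsel : ∀ spec : Fin d → ℝ × (Fin d → ℝ), (List.finRange d).foldl
      (fun dirs r => if (decide ((spec r).1 < σ)) = true then dirs else (spec r).2 :: dirs) [] =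
      (((List.finRange d).filter fun r => decide (σ ≤ (spec r).1)).map
        fun r => (spec r).2).reverse := by
    intro spec
    have h := foldl_cons_filterMap (fun r => if σ ≤ (spec r).1 then some (spec r).2 else none)
      (List.finRange d) []
    have h2 : ((List.finRange d).filterMap
        fun r => if σ ≤ (spec r).1 then some (spec r).2 else none) =
        ((List.finRange d).filter fun r => decide (σ ≤ (spec r).1)).map fun r => (spec r).2 := by
      rw [← List.filterMap_eq_map, List.filterMap_filter]
      congr 1
      funext r
      by_cases h : σ ≤ (spec r).1 <;> simp [h]
    rw [List.append_nil, h2] at h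
    rw [← h]
    congr 1
    funext acc r
    by_cases h : σ ≤ (spec r).1
    · simp [h, not_lt.mpr h]
    · simp [h, not_le.mp h]
  simp only [relevantDirections, run_bind, run_forEach, run_const', run_mkPartition, run_div',
    run_projPerp, run_tabulate, run_mul', run_add', run_eigh', run_lt', run_pure, Rat.cast_natCast,
    Rat.cast_zero]
  rw [hU]
  exact hsel _

end directions

open Prog

variable (E : EigenSolver)

/-! ### Orthonormal lists -/

section lists

variable {d : ℕ}

theorem isOrtho_get_iff (L : List (Fin d → ℝ)) :
    IsOrtho L.get ↔ (∀ v ∈ L, v ⬝ᵥ v = 1) ∧ L.Pairwise fun v w => v ⬝ᵥ w = 0 := by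
  constructor
  · intro h
    refine ⟨fun v hv => ?_, List.pairwise_iff_get.mpr fun i j hij => ?_⟩
    · obtain ⟨i, rfl⟩ := List.get_of_mem hv
      simpa using h i i
    · simpa [hij.ne] using h i j
  · rintro ⟨h1, h2⟩ i j
    rw [List.pairwise_iff_get] at h2
    rcases lt_trichotomy i j with h | rfl | h
    · rw [if_neg h.ne, h2 i j h]
    · rw [if_pos rfl, h1 _ (List.get_mem L i)]
    · rw [if_neg h.ne', dotProduct_comm, h2 j i h]

theorem isOrtho_get_append {L L' : List (Fin d → ℝ)} (h : IsOrtho L.get) (h' : IsOrtho L'.get)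
    (hLL' : ∀ v ∈ L, ∀ w ∈ L', v ⬝ᵥ w = 0) : IsOrtho (L ++ L').get := by
  rw [isOrtho_get_iff] at h h' ⊢
  refine ⟨fun v hv => ?_, List.pairwise_append.mpr ⟨h.2, h'.2, hLL'⟩⟩
  rcases List.mem_append.mp hv with hv | hv
  exacts [h.1 v hv, h'.1 v hv]

/-- Bessel's inequality summed over the standard basis. It bounds the length of the list of
directions on arbitrary data, as the running time requires. -/
theorem IsOrtho.card_le {k : ℕ} {v : Fin k → Fin d → ℝ} (hv : IsOrtho v) : k ≤ d := by
  have h1 : ∑ i, v i ⬝ᵥ v i = (k : ℝ) := by simp [hv _ _]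
  have h2 : ∑ i, v i ⬝ᵥ v i = ∑ a : Fin d, ∑ i, (v i ⬝ᵥ Pi.single a 1) ^ 2 := by
    rw [Finset.sum_comm]
    refine Finset.sum_congr rfl fun i _ => ?_
    have h : ∀ a, v i ⬝ᵥ Pi.single a 1 = v i a := fun a => by simp
    simp only [h]
    simp only [dotProduct, ← sq]
  have h3 : ∑ a : Fin d, ∑ i, (v i ⬝ᵥ Pi.single a 1) ^ 2 ≤ ∑ _a : Fin d, (1 : ℝ) :=
    Finset.sum_le_sum fun a _ => (hv.bessel _).trans (by simp)
  rw [← h2, h1] at h3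
  simpa using h3

theorem proj_get (L : List (Fin d → ℝ)) (x : Fin d → ℝ) :
    proj L.get x = (L.map fun v => (v ⬝ᵥ x) • v).sum := by
  conv_rhs => rw [← List.ofFn_get L, List.map_ofFn, List.sum_ofFn]
  rfl

/-- Projecting to the span of a longer list first does not change the projection. -/
theorem proj_proj_append {L L' : List (Fin d → ℝ)} (h : IsOrtho (L ++ L').get) (x : Fin d → ℝ) :
    proj L.get (proj (L ++ L').get x) = proj L.get x := by
  rw [proj_get L, proj_get L]
  congr 1
  refine List.map_congr_left fun v hv => ?_
  obtain ⟨i, hi⟩ := List.get_of_mem (List.mem_append_left L' hv)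
  rw [← hi, h.dot_proj_self]

end lists

/-! ### One round -/

section round

variable {d K N : ℕ}

open Classical in
theorem length_filter_ofFn {Z : Type*} (S : Fin N → Z) (A : Set Z) :
    ((List.ofFn S).filter fun z => z ∈ A).length = count A S := by
  induction N with
  | zero => simp [count]
  | succ N ih =>
    rw [List.ofFn_succ, List.filter_cons, count, Fin.univ_succ, Finset.filter_cons]
    have h := ih fun i => S i.succ
    rw [count] at h
    by_cases h0 : S 0 ∈ A
    · simp only [h0, decide_true, if_true, List.length_cons, h]
      rw [Finset.card_cons, Finset.filter_map, Finset.card_map]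
      rfl
    · simp only [h0, decide_false]
      rw [if_neg (by simp), if_neg (by simp), h, Finset.filter_map, Finset.card_map]
      rfl

theorem sum_map_filter {Z M : Type*} [AddCommMonoid M] (l : List Z) (p : Z → Prop)
    [DecidablePred p] (f : Z → M) :
    ((l.filter fun z => p z).map f).sum = (l.map fun z => if p z then f z else 0).sum := by
  induction l with
  | nil => rfl
  | cons z l ih => by_cases h : p z <;> simp [h, ih]

theorem perp_smul_sum {k : ℕ} {ι : Type*} (v : Fin k → Fin d → ℝ) (c : ℝ) (I : Finset ι)
    (f : ι → Fin d → ℝ) : perp v (c • ∑ i ∈ I, f i) = c • ∑ i ∈ I, perp v (f i) := by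
  have h : proj v (c • ∑ i ∈ I, f i) = c • ∑ i ∈ I, proj v (f i) := by
    simp only [proj, dotProduct_smul, dotProduct_sum, smul_eq_mul, Finset.smul_sum, mul_smul,
      Finset.sum_smul]
    rw [Finset.sum_comm]
  rw [perp, h, ← smul_sub, ← Finset.sum_sub_distrib]
  rfl

variable {ε' : ℝ} (hε : 0 < ε') (τ : ℝ) {L : List (Fin d → ℝ)} (hL : IsOrtho L.get)
  (S : Fin N → Example ℝ d K)

theorem length_examplesIn (js : List ℕ) :
    ((examplesIn ((locate (partitionOf ε' τ L) (List.ofFn S)).run E) js).run E).length =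
      count ((partitionCells hε τ hL).exampleSet K js) S := by
  classical
  rw [(run_examplesIn_locate E _ _ _).length_eq]
  simp only [run_cellOf_partitionOf E hε τ hL]
  convert length_filter_ofFn S ((partitionCells hε τ hL).exampleSet K js)
  rfl

theorem perp_moment_examplesIn (js : List ℕ) (i : Fin K) :
    perp L.get ((moment ((examplesIn ((locate (partitionOf ε' τ L) (List.ofFn S)).run E) js).run E)
        i).run E) = empMoment L.get ((partitionCells hε τ hL).exampleSet K js) S i := by
  classical
  rw [run_moment, length_examplesIn E hε τ hL,
    ((run_examplesIn_locate E (partitionOf ε' τ L) (List.ofFn S) js).map _).sum_eq, sum_map_filter,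
    List.map_ofFn, List.sum_ofFn, perp_smul_sum, empMoment]
  congr 1
  refine Finset.sum_congr rfl fun n _ => ?_
  simp only [Function.comp_apply, run_cellOf_partitionOf E hε τ hL]
  by_cases h1 : (partitionCells hε τ hL).cell (S n).1 = some js
  · have h1' : S n ∈ (partitionCells hε τ hL).exampleSet K js := h1
    by_cases h2 : (S n).2 = i
    · simp [h1, h1', h2]
    · simp [h1, h2, perp, proj]
  · have h1' : S n ∉ (partitionCells hε τ hL).exampleSet K js := h1
    simp [h1, h1', perp, proj]

/-- The program sums over the occupied cells only. All other cells have weight zero, so the sum may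
run over the whole partition. -/
theorem estimatedMatrix_eq :
    Matrix.of (estimatedMatrix E ε' τ L (List.ofFn S)) = Matrix.of fun a b =>
      ∑ i ∈ (partitionCells hε τ hL).cells ×ˢ Finset.univ,
        ((count ((partitionCells hε τ hL).exampleSet K i.1) S : ℝ) / N) *
        (empMoment L.get ((partitionCells hε τ hL).exampleSet K i.1) S i.2 a *
          empMoment L.get ((partitionCells hε τ hL).exampleSet K i.1) S i.2 b) := by
  classical
  ext a b
  simp only [Matrix.of_apply, estimatedMatrix, perp_moment_examplesIn E hε τ hL,
    length_examplesIn E hε τ hL, List.length_ofFn]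
  rw [← List.sum_toFinset _ (run_occupied E _).1, Finset.sum_product]
  refine (Finset.sum_subset ?_ ?_).trans (Finset.sum_congr rfl fun js _ =>
    Finset.sum_congr rfl fun i _ => by ring)
  · intro js hjs
    obtain ⟨e, -, he⟩ := (mem_run_occupied_locate E _ _ _).mp (List.mem_toFinset.mp hjs)
    rw [run_cellOf_partitionOf E hε τ hL] at he
    exact (partitionCells hε τ hL).mem_cells _ _ he
  · intro js _ hjs
    have h0 : count ((partitionCells hε τ hL).exampleSet K js) S = 0 := by
      rw [count, Finset.card_eq_zero, Finset.filter_eq_empty_iff]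
      intro n _ hn
      refine hjs (List.mem_toFinset.mpr ((mem_run_occupied_locate E _ _ _).mpr
        ⟨S n, List.mem_ofFn.mpr ⟨n, rfl⟩, ?_⟩))
      rw [run_cellOf_partitionOf E hε τ hL]
      exact hn
    simp [h0]

/-- The directions that are added in a round. -/
noncomputable def directions (ε' σ τ : ℝ) (L : List (Fin d → ℝ)) (S : List (Example ℝ d K)) :
    List (Fin d → ℝ) :=
  (relevantDirections ε' σ τ L S).run E

/-- The eigenvectors found in a round. -/
noncomputable def eigenvectors (ε' τ : ℝ) (L : List (Fin d → ℝ)) (S : List (Example ℝ d K)) :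
    Fin d → ℝ × (Fin d → ℝ) :=
  E.solve d (estimatedMatrix E ε' τ L S)

theorem directions_eq (ε' σ τ : ℝ) (L : List (Fin d → ℝ)) (S : List (Example ℝ d K)) :
    directions E ε' σ τ L S = (((List.finRange d).filter fun r =>
        decide (σ ≤ (eigenvectors E ε' τ L S r).1)).map fun r =>
          (eigenvectors E ε' τ L S r).2).reverse :=
  run_relevantDirections E ε' σ τ L S

theorem estimatedMatrix_symm (ε' τ : ℝ) (L : List (Fin d → ℝ)) (S : List (Example ℝ d K))
    (a b : Fin d) : estimatedMatrix E ε' τ L S a b = estimatedMatrix E ε' τ L S b a := by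
  simp only [estimatedMatrix]
  congr 2
  funext js
  exact Finset.sum_congr rfl fun i _ => by ring

theorem isOrtho_eigenvectors (ε' τ : ℝ) (L : List (Fin d → ℝ)) (S : List (Example ℝ d K)) :
    IsOrtho fun r => (eigenvectors E ε' τ L S r).2 :=
  E.orthonormal d _ (estimatedMatrix_symm E ε' τ L S)

theorem mulVec_eigenvectors (r : Fin d) :
    Matrix.mulVec (Matrix.of fun a b =>
      ∑ i ∈ (partitionCells hε τ hL).cells ×ˢ Finset.univ,
        ((count ((partitionCells hε τ hL).exampleSet K i.1) S : ℝ) / N) *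
        (empMoment L.get ((partitionCells hε τ hL).exampleSet K i.1) S i.2 a *
          empMoment L.get ((partitionCells hε τ hL).exampleSet K i.1) S i.2 b))
      (eigenvectors E ε' τ L (List.ofFn S) r).2 =
      (eigenvectors E ε' τ L (List.ofFn S) r).1 • (eigenvectors E ε' τ L (List.ofFn S) r).2 := by
  rw [← estimatedMatrix_eq E hε τ hL S]
  exact E.eigenvector d _ (estimatedMatrix_symm E ε' τ L _) r

theorem sum_directions {M : Type*} [AddCommMonoid M] (σ : ℝ) (f : (Fin d → ℝ) → M)
    (S : List (Example ℝ d K)) :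
    ((directions E ε' σ τ L S).map f).sum =
      ∑ r ∈ Finset.univ.filter fun r => σ ≤ (eigenvectors E ε' τ L S r).1,
        f (eigenvectors E ε' τ L S r).2 := by
  classical
  rw [directions_eq, List.map_reverse, List.sum_reverse, List.map_map, sum_map_filter,
    ← List.ofFn_eq_map, List.sum_ofFn, Finset.sum_filter]
  rfl

theorem length_directions (σ : ℝ) (S : List (Example ℝ d K)) :
    (directions E ε' σ τ L S).length =
      (Finset.univ.filter fun r => σ ≤ (eigenvectors E ε' τ L S r).1).card := by
  have := sum_directions (M := ℕ) E (L := L) (ε' := ε') τ σ (fun _ => 1) S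
  simpa using this

theorem dot_empMoment {k : ℕ} {v : Fin k → Fin d → ℝ} (hv : IsOrtho v) (A : Set (Example ℝ d K))
    (l : Fin K) (i : Fin k) : empMoment v A S l ⬝ᵥ v i = 0 := by
  rw [empMoment, smul_dotProduct, sum_dotProduct, Finset.sum_eq_zero, smul_zero]
  intro n _
  split_ifs
  · rw [dotProduct_comm, hv.dot_perp_self]
  · rw [zero_dotProduct]

-- All summands of the matrix are outer products of vectors orthogonal to `L`, and the selected
-- eigenvalues are nonzero because `σ > 0`.
include hε hL in
theorem isOrtho_append_directions {σ : ℝ} (hσ : 0 < σ) :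
    IsOrtho (L ++ directions E ε' σ τ L (List.ofFn S)).get := by
  have ho := isOrtho_eigenvectors E ε' τ L (List.ofFn S)
  refine isOrtho_get_append hL ?_ ?_
  · rw [isOrtho_get_iff, directions_eq]
    constructor
    · intro v hv
      obtain ⟨r, -, rfl⟩ := List.mem_map.mp (List.mem_reverse.mp hv)
      simpa using ho r r
    · rw [List.pairwise_reverse, List.pairwise_map]
      refine ((List.nodup_finRange d).sublist List.filter_sublist).imp fun {a b} hab => ?_
      simpa [Ne.symm hab] using ho b a
  · intro v hv w hw
    obtain ⟨i, rfl⟩ := List.get_of_mem hv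
    rw [directions_eq] at hw
    obtain ⟨r, hr, rfl⟩ := List.mem_map.mp (List.mem_reverse.mp hw)
    have hr' : σ ≤ (eigenvectors E ε' τ L (List.ofFn S) r).1 := by
      simpa using (List.mem_filter.mp hr).2
    exact eigenvector_orthogonal
      (fun r => mulVec_eigenvectors E hε τ hL S r) (hσ.trans_le hr').ne'
      fun j _ => dot_empMoment S hL _ _ _

variable {S} {D : Measure (Example ℝ d K)} [IsProbabilityMeasure D]
  {ξ s : ℝ}

include hε hL in
/-- In a good round few directions are added. -/
theorem length_directions_le {σ : ℝ} (hD : D.map Prod.fst = stdNormal d)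
    (hS : GoodSample D (partitionCells hε τ hL) S ξ s) (hs : 0 ≤ s) (hN : 0 < N)
    (hsN : ((partitionCells hε τ hL).cells.card : ℝ) * K * s ≤ N / 2) (hK : 0 < K) :
    ((directions E ε' σ τ L (List.ofFn S)).length : ℝ) * σ ≤ 3 * K := by
  rw [length_directions]
  exact card_large_eigenvalues (isOrtho_eigenvectors E ε' τ L _)
    (mulVec_eigenvectors E hε τ hL S) (fun i _ => by positivity)
    (hS.trace_le hD hL hs hN hsN hK)

include hε hL in
/-- In a good round the added directions capture a part of the weight vectors. -/
theorem capture_directions {σ : ℝ} (hσ : 0 < σ) (hD : D.map Prod.fst = stdNormal d)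
    (hS : GoodSample D (partitionCells hε τ hL) S ξ s) (hs : 0 ≤ s) (hN : 0 < N)
    (hsN : ((partitionCells hε τ hL).cells.card : ℝ) * K * s ≤ N / 2) (hK : 0 < K)
    (w : Fin K → Fin d → ℝ) (B : Finset (List ℕ)) (hB : B ⊆ (partitionCells hε τ hL).cells)
    {e β : ℝ} (hβ : 0 ≤ β)
    (hmass : e ≤ ∑ j ∈ B, D.real ((partitionCells hε τ hL).exampleSet K j))
    (hmom : ∀ j ∈ B, ∃ l a b, w b - w a ≠ 0 ∧ β * len (w b - w a) ≤
      (w b - w a) ⬝ᵥ condMoment D L.get ((partitionCells hε τ hL).exampleSet K j) l)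
    (hξ : ((partitionCells hε τ hL).cells.card : ℝ) * K * ξ ≤ e / 2) (hξ0 : 0 ≤ ξ)
    (hsN' : ((partitionCells hε τ hL).cells.card : ℝ) * s ≤ N * (β ^ 2 * e / 8)) :
    β ^ 2 * e / 8 - σ * K ^ 2 ≤ 3 * K * ((directions E ε' σ τ L (List.ofFn S)).map fun v =>
      ∑ q : Fin K × Fin K, (v ⬝ᵥ unitDir w q.1 q.2) ^ 2).sum := by
  have h1 := hS.quadratic_ge hs hN w B hB hβ hmass hmom hξ hξ0 hsN'
  have h2 := large_eigenvectors_capture (isOrtho_eigenvectors E ε' τ L _)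
    (mulVec_eigenvectors E hε τ hL S) (fun i _ => by positivity)
    (hS.trace_le hD hL hs hN hsN hK) hσ Finset.univ
    (fun q : Fin K × Fin K => unitDir w q.1 q.2) fun q _ => unitDir_sq_le w q.1 q.2
  rw [sum_directions]
  refine le_trans ?_ h2
  have h3 : ((Finset.univ : Finset (Fin K × Fin K)).card : ℝ) = K ^ 2 := by simp [sq]
  rw [h3]
  linarith

end round

/-! ### The hypothesis -/

section hypothesis

variable {d K : ℕ} [NeZero K]

theorem run_majority (S : List (Example ℝ d K)) (l : Fin K) :
    (S.filter fun e => e.2 = l).length ≤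
      (S.filter fun e => e.2 = (majority S).run E).length := by
  have hcount : ∀ (i : Fin K) (n : ℕ), S.foldl (fun n e => if e.2 = i then n + 1 else n) n =
      n + (S.filter fun e => e.2 = i).length := by
    intro i n
    induction S generalizing n with
    | nil => rfl
    | cons e S ih =>
      rw [List.foldl_cons, ih]
      by_cases h : e.2 = i <;> simp [h]; omega
  simp only [majority, run_bind, run_forEach, run_pure, hcount, zero_add]
  -- The invariant: the stored number is at most the frequency of the stored label and at least
  -- every frequency seen so far. The start `(0, 0)` satisfies it trivially.
  have key : ∀ (l : List (Fin K)) (best : Fin K × ℕ),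
      best.2 ≤ (S.filter fun e => e.2 = best.1).length →
      let best' := l.foldl (fun best i => if best.2 < (S.filter fun e => e.2 = i).length then
        (i, (S.filter fun e => e.2 = i).length) else best) best
      best'.2 ≤ (S.filter fun e => e.2 = best'.1).length ∧ best.2 ≤ best'.2 ∧
        ∀ i ∈ l, (S.filter fun e => e.2 = i).length ≤ best'.2 := by
    intro l
    induction l with
    | nil => intro best h; exact ⟨h, le_rfl, by simp⟩
    | cons i l ih =>
      intro best h
      simp only [List.foldl_cons]
      split_ifs with h1
      · obtain ⟨h2, h3, h4⟩ := ih (i, (S.filter fun e => e.2 = i).length) le_rfl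
        refine ⟨h2, h1.le.trans h3, fun j hj => ?_⟩
        rcases List.mem_cons.mp hj with rfl | hj
        exacts [h3, h4 j hj]
      · obtain ⟨h2, h3, h4⟩ := ih best h
        refine ⟨h2, h3, fun j hj => ?_⟩
        rcases List.mem_cons.mp hj with rfl | hj
        exacts [(not_lt.mp h1).trans h3, h4 j hj]
  obtain ⟨h1, -, h3⟩ := key (List.finRange K) (0, 0) (Nat.zero_le _)
  exact (h3 l (List.mem_finRange l)).trans h1

/-- The list of directions after some rounds. -/
noncomputable def basisAfter (ε' σ τ : ℝ) (samples : ℕ → List (Example ℝ d K)) :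
    ℕ → List (Fin d → ℝ)
  | 0 => []
  | t + 1 => basisAfter ε' σ τ samples t ++
      directions E ε' σ τ (basisAfter ε' σ τ samples t) (samples t)

/-- The samples in the data. -/
def sampleList {T N : ℕ} (S : Data d K T N) (t : ℕ) : List (Example ℝ d K) :=
  List.ofFn (S (Fin.ofNat (T + 1) t))

theorem run_learnFrom {T N : ℕ} (ε' σ τ : ℝ) (S : Data d K T N) :
    (learnFrom ε' σ τ S).run E =
      { partition := partitionOf ε' τ (basisAfter E ε' σ τ (sampleList S) T)
        table := (((occupied ((locate (partitionOf ε' τ (basisAfter E ε' σ τ (sampleList S) T))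
          (sampleList S T)).run E)).run E).map fun js => (js, (majority ((examplesIn ((locate
          (partitionOf ε' τ (basisAfter E ε' σ τ (sampleList S) T)) (sampleList S T)).run E)
            js).run E)).run E)).reverse } := by
  have hfold : ∀ t, ((List.range t).map (sampleList S)).foldl
      (fun L S => L ++ (relevantDirections ε' σ τ L S).run E) [] =
      basisAfter E ε' σ τ (sampleList S) t := by
    intro t
    induction t with
    | zero => rfl
    | succ t ih =>
      rw [List.range_succ, List.map_append, List.foldl_append, ih]
      rfl
  have hrounds : (List.ofFn fun t : Fin T => List.ofFn (S t.castSucc)) =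
      (List.range T).map (sampleList S) := by
    refine List.ext_getElem (by simp) fun t ht _ => ?_
    simp only [List.getElem_ofFn, List.getElem_map, List.getElem_range, sampleList]
    congr 2
    ext
    simp only [List.length_ofFn] at ht
    simp [Fin.ofNat, Nat.mod_eq_of_lt (show t < T + 1 by omega)]
  have hlast : List.ofFn (S (Fin.last T)) = sampleList S T := by
    rw [sampleList]
    congr 2
    ext
    simp [Fin.ofNat]
  have htable : ∀ (l : List (List ℕ)) (m : List ℕ → Fin K), l.foldl
      (fun table js => (js, m js) :: table) [] = (l.map fun js => (js, m js)).reverse := by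
    intro l m
    simp
  simp only [learnFrom, learn, run_bind, run_forEach, run_pure, run_mkPartition, hrounds, hlast,
    hfold, htable]

/-- All entries for the same cell carry the same label, so it does not matter which of them is read
last. -/
theorem run_predict (H : Hypothesis ℝ d K) (x : Fin d → ℝ) {js : List ℕ}
    (hjs : (cellOf H.partition x).run E = some js) (cells : List (List ℕ)) (m : List ℕ → Fin K)
    (hH : H.table = (cells.map fun js => (js, m js)).reverse) :
    (predict H x).run E = if js ∈ cells then m js else 0 := by
  have hfold : ∀ (l : List (List ℕ)) (i : Fin K), (l.map fun js => (js, m js)).foldl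
      (fun label entry => if entry.1 = js then entry.2 else label) i =
      if js ∈ l then m js else i := by
    intro l
    induction l with
    | nil => intro i; simp
    | cons a l ih =>
      intro i
      rw [List.map_cons, List.foldl_cons, ih]
      by_cases h1 : js ∈ l
      · simp [h1]
      · by_cases h2 : a = js
        · simp [h2]
        · simp [h1, h2, Ne.symm h2]
  simp only [predict, run_bind, hjs, run_forEach, run_sameCell, run_pure, decide_eq_true_eq, hH]
  rw [← List.map_reverse, hfold]
  simp

/-- The hypothesis is constant on the cells, with a most frequent label. -/
theorem learned_spec {T N : ℕ} {ε' : ℝ} (hε : 0 < ε') (σ τ : ℝ) (S : Data d K T N)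
    (hL : IsOrtho (basisAfter E ε' σ τ (sampleList S) T).get) :
    ∃ lab : List ℕ → Fin K,
      (∀ js l, count ((partitionCells hε τ hL).labelSet K js l) (S (Fin.last T)) ≤
        count ((partitionCells hε τ hL).labelSet K js (lab js)) (S (Fin.last T))) ∧
      ∀ x js, (partitionCells hε τ hL).cell x = some js → learned E ε' σ τ S x = lab js := by
  classical
  have hlast : sampleList S T = List.ofFn (S (Fin.last T)) := by
    rw [sampleList]
    congr 2
    ext
    simp [Fin.ofNat]
  set L := basisAfter E ε' σ τ (sampleList S) T with hLdef
  set Q := (locate (partitionOf ε' τ L) (List.ofFn (S (Fin.last T)))).run E with hQ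
  refine ⟨fun js => if js ∈ (occupied Q).run E then
    (majority ((examplesIn Q js).run E)).run E else 0, fun js l => ?_, fun x js hx => ?_⟩
  · have hcount : ∀ l, count ((partitionCells hε τ hL).labelSet K js l) (S (Fin.last T)) =
        (((examplesIn Q js).run E).filter fun e => e.2 = l).length := by
      intro l
      rw [((run_examplesIn_locate E (partitionOf ε' τ L) _ js).filter _).length_eq,
        List.filter_filter, ← length_filter_ofFn]
      congr 2
      funext e
      simp only [run_cellOf_partitionOf E hε τ hL]
      rw [← Bool.decide_and, decide_eq_decide]
      exact and_comm
    by_cases h : js ∈ (occupied Q).run E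
    · simp only [if_pos h]
      rw [hcount, hcount]
      exact run_majority E _ l
    -- In a cell without examples all frequencies vanish, so the default label is a most frequent
    -- one, too.
    · have h0 : (examplesIn Q js).run E = [] := by
        rw [← List.length_eq_zero_iff, length_examplesIn E hε τ hL, count, Finset.card_eq_zero,
          Finset.filter_eq_empty_iff]
        intro n _ hn
        refine h ((mem_run_occupied_locate E _ _ _).mpr
          ⟨S (Fin.last T) n, List.mem_ofFn.mpr ⟨n, rfl⟩, ?_⟩)
        rw [run_cellOf_partitionOf E hε τ hL]
        exact hn
      rw [hcount, hcount, h0]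
      simp
  · rw [learned]
    refine run_predict E ((learnFrom ε' σ τ S).run E) x (js := js) ?_ ((occupied Q).run E)
      (fun js => (majority ((examplesIn Q js).run E)).run E) ?_
    · rw [run_learnFrom, ← hLdef, run_cellOf_partitionOf E hε τ hL]
      exact hx
    · rw [run_learnFrom, ← hLdef, hlast]

end hypothesis

open Prog

variable (E : EigenSolver)

/-! ### The analysis of the algorithm on good samples -/

section analysis

variable {d K : ℕ}

theorem basisAfter_prefix (ε' σ τ : ℝ) (samples : ℕ → List (Example ℝ d K)) {t T : ℕ}
    (h : t ≤ T) : ∃ L', basisAfter E ε' σ τ samples T = basisAfter E ε' σ τ samples t ++ L' := by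
  induction T, h using Nat.le_induction with
  | base => exact ⟨[], (List.append_nil _).symm⟩
  | succ T _ ih =>
    obtain ⟨L', h⟩ := ih
    exact ⟨L' ++ _, by rw [basisAfter, h, List.append_assoc]⟩

theorem isOrtho_basisAfter {N : ℕ} {ε' σ : ℝ} (hε : 0 < ε') (hσ : 0 < σ) (τ : ℝ)
    (S : ℕ → Fin N → Example ℝ d K) (t : ℕ) :
    IsOrtho (basisAfter E ε' σ τ (fun t => List.ofFn (S t)) t).get := by
  induction t with
  | zero => exact fun i => i.elim0
  | succ t ih => exact isOrtho_append_directions E hε τ ih (S t) hσ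

/-- Bessel's inequality for each of the `K ^ 2` vectors. This limits the number of rounds with a
large projection error. -/
theorem potential_le {L : List (Fin d → ℝ)} (hL : IsOrtho L.get) (w : Fin K → Fin d → ℝ) :
    (L.map fun v => ∑ q : Fin K × Fin K, (v ⬝ᵥ unitDir w q.1 q.2) ^ 2).sum ≤ K ^ 2 := by
  have h1 : (L.map fun v => ∑ q : Fin K × Fin K, (v ⬝ᵥ unitDir w q.1 q.2) ^ 2).sum =
      ∑ i, ∑ q : Fin K × Fin K, (L.get i ⬝ᵥ unitDir w q.1 q.2) ^ 2 := by
    conv_lhs => rw [← List.ofFn_get L, List.map_ofFn, List.sum_ofFn]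
    rfl
  rw [h1, Finset.sum_comm]
  refine (Finset.sum_le_sum (g := fun _ => 1) fun q _ =>
    (hL.bessel _).trans (unitDir_sq_le w q.1 q.2)).trans (le_of_eq ?_)
  simp [sq]

theorem partitionCells_card_le {ε' : ℝ} (hε : 0 < ε') (τ : ℝ) {L : List (Fin d → ℝ)}
    (hL : IsOrtho L.get) : (partitionCells hε τ hL).cells.card ≤
      ⌈2 * √(2 * Real.log (L.length / ε')) / ε'⌉₊ ^ L.length :=
  card_boxCells_le _ _ _ _ hL

variable {N T : ℕ} {D : Measure (Example ℝ d K)} [IsProbabilityMeasure D]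
  {ε' σ τ : ℝ} {kmax : ℕ} {M ξ s e α η : ℝ} {w : Fin K → Fin d → ℝ} {t : Fin K → ℝ}
  {f : (Fin d → ℝ) → Fin K}

/-- A bound for the error made by projecting, after some round. -/
noncomputable def projectionError (K kmax : ℕ) (ε' e α η : ℝ) : ℝ :=
  (2 + kmax) * ε' + K ^ 2 * (√kmax * ε') + 1601 * (η + K ^ 2 * (√kmax * ε' + 2 * α)) + 2 * e

/-- As long as projecting makes a large error, the potential increases. -/
theorem potential_increase (hε : 0 < ε') (hε1 : ε' < 1) (hσ : 0 < σ) (hτ : 0 < τ) (hτε : τ < ε')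
    {L : List (Fin d → ℝ)} (hL : IsOrtho L.get) (hk : L.length ≤ kmax)
    (hM : ((partitionCells hε τ hL).cells.card : ℝ) ≤ M)
    (hD : D.map Prod.fst = stdNormal d) (hf : IsClassifier w t f) (hη : err D f ≤ η)
    {S : Fin N → Example ℝ d K} (hS : GoodSample D (partitionCells hε τ hL) S ξ s)
    (hs : 0 ≤ s) (hξ : 0 ≤ ξ) (hN : 0 < N) (hK : 0 < K) (hα : 0 < α) (hα1 : α ≤ 1) (he : 0 < e)
    (c1 : M * K * s ≤ N / 2) (c2 : M * K * ξ ≤ e / 2)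
    (c3 : M * s ≤ N * ((α ^ 2 * e / (200 * K)) ^ 2 * e / 8))
    (c4 : σ * K ^ 2 ≤ (α ^ 2 * e / (200 * K)) ^ 2 * e / 16)
    (hbig : projectionError K kmax ε' e α η ≤ (stdNormal d).real {x | f x ≠ f (proj L.get x)}) :
    (α ^ 2 * e / (200 * K)) ^ 2 * e / 16 ≤
      3 * K * ((directions E ε' σ τ L (List.ofFn S)).map fun v =>
        ∑ q : Fin K × Fin K, (v ⬝ᵥ unitDir w q.1 q.2) ^ 2).sum := by
  classical
  set C := partitionCells hε τ hL with hC
  have hk' : (L.length : ℝ) ≤ kmax := by exact_mod_cast hk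
  have hr0 : 0 ≤ √L.length * ε' := by positivity
  have hr : √L.length * ε' ≤ √kmax * ε' := by gcongr
  have hout : (stdNormal d).real {x | C.cell x = none} ≤ (2 + kmax) * ε' := by
    refine (measureReal_partitionCells_none_le hε hε1 hτ.le hL).trans ?_
    rw [add_mul]
    gcongr
  have hnoise := measureReal_noiseSet_le (D := D) (w := w) (t := t) (f := f) (v := L.get) hD hr0
    hα hα1
  have hK2 : (0 : ℝ) ≤ K ^ 2 := by positivity
  have h1 : (K : ℝ) ^ 2 * (√L.length * ε') ≤ K ^ 2 * (√kmax * ε') := by gcongr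
  have h2 : (stdNormal d).real {x | C.cell x = none} + K ^ 2 * (√L.length * ε') +
      1601 * D.real (noiseSet w t f L.get (√L.length * ε') α) + 2 * e ≤
      (stdNormal d).real {x | f x ≠ f (proj L.get x)} := by
    refine le_trans ?_ hbig
    rw [projectionError]
    linarith
  set B := C.cells.filter fun j => D (C.exampleSet K j) ≠ 0 ∧
      1601 * D.real (C.exampleSet K j ∩ noiseSet w t f L.get (√L.length * ε') α) +
        e * D.real (C.exampleSet K j) ≤ D.real (C.exampleSet K j ∩ {p | f p.1 ≠ f (C.rep j)})
    with hB
  have hmass := hf.bad_cells_mass hD hr0 C he h2 B (Finset.filter_subset _ _)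
    fun j hj h3 h4 => Finset.mem_filter.mpr ⟨hj, h3, h4⟩
  have h3 := capture_directions E hε τ hL (σ := σ) hσ hD hS hs hN
    (le_trans (by gcongr) c1) hK w B (Finset.filter_subset _ _) (e := e)
    (β := α ^ 2 * e / (200 * K)) (by positivity) hmass
    (fun j hj => by
      obtain ⟨-, h3, h4⟩ := Finset.mem_filter.mp hj
      exact hf.exists_moment_of_bad_cell hD hL hr0 hα C j he h3 h4)
    (le_trans (by gcongr) c2) hξ (le_trans (by gcongr) c3)
  -- By `c4` the small eigenvalues lose at most half of the gain.
  linarith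

/-- The error of the hypothesis that is returned, if all samples are good. -/
theorem err_learned_le [NeZero K] (hε : 0 < ε') (hε1 : ε' < 1) (hσ : 0 < σ) (hτ : 0 < τ)
    (hτε : τ < ε') (hM : ∀ k ≤ kmax, (⌈2 * √(2 * Real.log (k / ε')) / ε'⌉₊ ^ k : ℝ) ≤ M)
    (hD : D.map Prod.fst = stdNormal d) (hf : IsClassifier w t f) (hη : err D f ≤ η)
    (S : Data d K T N)
    (hS : ∀ n ≤ T, ∀ hL : IsOrtho (basisAfter E ε' σ τ (sampleList S) n).get,
      (basisAfter E ε' σ τ (sampleList S) n).length ≤ kmax →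
        GoodSample D (partitionCells hε τ hL) (S (Fin.ofNat (T + 1) n)) ξ s)
    (hs : 0 ≤ s) (hξ : 0 ≤ ξ) (hN : 0 < N) (hα : 0 < α) (hα1 : α ≤ 1) (he : 0 < e)
    (hkmax : T * (3 * K) ≤ kmax * σ)
    (c1 : M * K * s ≤ N / 2) (c2 : M * K * ξ ≤ e / 2)
    (c3 : M * s ≤ N * ((α ^ 2 * e / (200 * K)) ^ 2 * e / 8))
    (c4 : σ * K ^ 2 ≤ (α ^ 2 * e / (200 * K)) ^ 2 * e / 16)
    (c5 : 3 * K * K ^ 2 < T * ((α ^ 2 * e / (200 * K)) ^ 2 * e / 16)) :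
    err D (learned E ε' σ τ S) ≤ (2 + kmax) * ε' + η +
      2 * projectionError K kmax ε' e α η + K ^ 2 * (√kmax * ε') + e := by
  classical
  have hK : 0 < K := Nat.pos_of_ne_zero (NeZero.ne K)
  have hK1 : (1 : ℝ) ≤ K := by exact_mod_cast hK
  set L := basisAfter E ε' σ τ (sampleList S) with hLdef
  have hL : ∀ n, IsOrtho (L n).get := fun n =>
    isOrtho_basisAfter E hε hσ τ (fun n => S (Fin.ofNat (T + 1) n)) n
  have hcard : ∀ n, (L n).length ≤ kmax → ((partitionCells hε τ (hL n)).cells.card : ℝ) ≤ M := by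
    intro n hn
    refine le_trans ?_ (hM _ hn)
    exact_mod_cast partitionCells_card_le hε τ (hL n)
  have hlenT : ∀ n, ((L n).length : ℝ) * σ ≤ n * (3 * K) → n ≤ T → (L n).length ≤ kmax := by
    intro n h1 h2
    have h3 : (n : ℝ) * (3 * K) ≤ T * (3 * K) := by gcongr
    exact_mod_cast le_of_mul_le_mul_right (h1.trans (h3.trans hkmax)) hσ
  -- Samples are known to be good only for lists of length at most `kmax`, so the growth of the list
  -- has to be followed round by round.
  have hlen : ∀ n ≤ T, ((L n).length : ℝ) * σ ≤ n * (3 * K) := by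
    intro n
    induction n with
    | zero => intro _; simp [hLdef, basisAfter]
    | succ n ih =>
      intro hn
      have h1 := ih (by omega)
      have h2 := hlenT n h1 (by omega)
      have h3 := length_directions_le E hε τ (hL n) (σ := σ) hD (hS n (by omega) (hL n) h2) hs hN
        (le_trans (by gcongr; exact hcard n h2) c1) hK
      have h4 : (L (n + 1)).length = (L n).length +
          (directions E ε' σ τ (L n) (List.ofFn (S (Fin.ofNat (T + 1) n)))).length := by
        rw [← List.length_append]; rfl
      rw [h4]
      push_cast
      linarith
  have hkm : ∀ n ≤ T, (L n).length ≤ kmax := fun n hn => hlenT n (hlen n hn) hn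
  have hgood : ∀ n ≤ T, GoodSample D (partitionCells hε τ (hL n)) (S (Fin.ofNat (T + 1) n)) ξ s :=
    fun n hn => hS n hn (hL n) (hkm n hn)
  -- If the projection error were large in all `T` rounds, the potential would exceed its bound, by
  -- `c5`.
  obtain ⟨n, hnT, hn⟩ : ∃ n < T, (stdNormal d).real {x | f x ≠ f (proj (L n).get x)} ≤
      projectionError K kmax ε' e α η := by
    by_contra! hcon
    have hpot : ∀ n ≤ T, n * ((α ^ 2 * e / (200 * K)) ^ 2 * e / 16) ≤
        3 * K * ((L n).map fun v => ∑ q : Fin K × Fin K, (v ⬝ᵥ unitDir w q.1 q.2) ^ 2).sum := by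
      intro n
      induction n with
      | zero => intro _; simp [hLdef, basisAfter]
      | succ n ih =>
        intro hn
        have h1 := ih (by omega)
        have h2 := potential_increase E hε hε1 hσ hτ hτε (hL n) (hkm n (by omega))
          (hcard n (hkm n (by omega))) hD hf hη (hgood n (by omega)) hs hξ hN hK hα hα1 he c1 c2
          c3 c4 (hcon n (by omega)).le
        have h3 : L (n + 1) = L n ++
          directions E ε' σ τ (L n) (List.ofFn (S (Fin.ofNat (T + 1) n))) := rfl
        rw [h3, List.map_append, List.sum_append]
        push_cast
        linarith
    have h1 := hpot T le_rfl
    have h2 : 3 * K * ((L T).map fun v =>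
        ∑ q : Fin K × Fin K, (v ⬝ᵥ unitDir w q.1 q.2) ^ 2).sum ≤ 3 * K * (K : ℝ) ^ 2 := by
      gcongr
      exact potential_le (hL T) w
    linarith
  have hproj : (stdNormal d).real {x | f x ≠ f (proj (L T).get x)} ≤
      2 * projectionError K kmax ε' e α η := by
    obtain ⟨L', hL'⟩ := basisAfter_prefix E ε' σ τ (sampleList S) hnT.le
    -- The prediction from the smaller subspace of round `n` is also a function of the projection to
    -- the final one. Up to the factor two it cannot beat `f` at the final projection.
    have h1 := hf.proj_optimal (hL T) (h := fun y => f (proj (L n).get y))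
      (hf.measurable.comp (measurable_proj _))
    have h2 : ∀ x, proj (L n).get (proj (L T).get x) = proj (L n).get x := by
      intro x
      have h3 : L T = L n ++ L' := hL'
      have h4 := hL T
      rw [h3] at h4 ⊢
      exact proj_proj_append h4 x
    simp only [h2] at h1
    linarith
  obtain ⟨lab, hlab, hh⟩ := learned_spec E hε σ τ S (hL T)
  have hlast : Fin.ofNat (T + 1) T = Fin.last T := by ext; simp [Fin.ofNat]
  have hgT := hgood T le_rfl
  rw [hlast] at hgT
  have hk' : ((L T).length : ℝ) ≤ kmax := by exact_mod_cast hkm T le_rfl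
  have hfin := hgT.err_le hf hD (by positivity) hN (learned E ε' σ τ S) lab
    (fun j _ l => hlab j l) hh
  have hout : (stdNormal d).real {x | (partitionCells hε τ (hL T)).cell x = none} ≤
      (2 + kmax) * ε' := by
    refine (measureReal_partitionCells_none_le hε hε1 hτ.le (hL T)).trans ?_
    rw [add_mul]
    gcongr
  have h1 : (K : ℝ) ^ 2 * (√(L T).length * ε') ≤ K ^ 2 * (√kmax * ε') := by gcongr
  have h2 : 2 * ((partitionCells hε τ (hL T)).cells.card : ℝ) * ξ ≤ e := by
    have h3 : ((partitionCells hε τ (hL T)).cells.card : ℝ) * ξ ≤ M * K * ξ := by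
      gcongr
      refine (hcard T (hkm T le_rfl)).trans (le_mul_of_one_le_right ?_ hK1)
      exact (Nat.cast_nonneg _).trans (hcard T (hkm T le_rfl))
    linarith
  linarith

end analysis

open Prog

variable (E : EigenSolver)

/-! ### Measurability of the directions found -/

section measurability

variable {d K N : ℕ} {Ω : Type*} [MeasurableSpace Ω]

/-- Lists of vectors that depend measurably on a parameter. -/
def MeasurableList (f : Ω → List (Fin d → ℝ)) : Prop :=
  Measurable (fun ω => (f ω).length) ∧ ∀ i, Measurable fun ω => (f ω).getD i 0

/-- Meant for the set of selected eigenvectors: it takes countably many values, and for a fixed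
value the list has a fixed shape. -/
theorem MeasurableList.of_countable {ι : Type*} [Countable ι] [MeasurableSpace ι]
    [MeasurableSingletonClass ι] {A : Ω → ι} (hA : Measurable A)
    {F : ι → Ω → List (Fin d → ℝ)} (hF : ∀ a, MeasurableList (F a)) :
    MeasurableList fun ω => F (A ω) ω :=
  ⟨(measurable_from_prod_countable_right (f := fun p : ι × Ω => (F p.1 p.2).length)
    fun a => (hF a).1).comp (hA.prodMk measurable_id),
  fun i => (measurable_from_prod_countable_right (f := fun p : ι × Ω => (F p.1 p.2).getD i 0)
    fun a => (hF a).2 i).comp (hA.prodMk measurable_id)⟩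

/-- There are countably many lengths, so it suffices to treat tuples of each fixed length. -/
theorem MeasurableList.measurable_comp {f : Ω → List (Fin d → ℝ)} (hf : MeasurableList f)
    {Z β : Type*} [MeasurableSpace Z] [MeasurableSpace β] {h : Ω → Z} (hh : Measurable h)
    {g : List (Fin d → ℝ) → Z → β}
    (hg : ∀ k, Measurable fun p : (Fin k → Fin d → ℝ) × Z => g (List.ofFn p.1) p.2) :
    Measurable fun ω => g (f ω) (h ω) := by
  have h1 : ∀ ω, f ω = List.ofFn fun i : Fin (f ω).length => (f ω).getD i 0 := fun ω => by
    refine List.ext_getElem (by simp) fun i h1 h2 => ?_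
    simp
  have h2 : Measurable fun p : ℕ × Ω =>
      g (List.ofFn fun i : Fin p.1 => (f p.2).getD i 0) (h p.2) := by
    refine measurable_from_prod_countable_right fun k => ?_
    have hv : Measurable fun ω => (fun i : Fin k => (f ω).getD i 0) :=
      measurable_pi_lambda _ fun i => hf.2 i
    exact (hg k).comp (hv.prodMk hh)
  have h3 : (fun ω => g (f ω) (h ω)) = (fun p : ℕ × Ω =>
      g (List.ofFn fun i : Fin p.1 => (f p.2).getD i 0) (h p.2)) ∘ fun ω => ((f ω).length, ω) := by
    funext ω
    change _ = g (List.ofFn fun i : Fin (f ω).length => (f ω).getD i 0) (h ω)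
    rw [← h1]
  rw [h3]
  exact h2.comp (hf.1.prodMk measurable_id)

theorem MeasurableList.append {f f' : Ω → List (Fin d → ℝ)} (hf : MeasurableList f)
    (hf' : MeasurableList f') : MeasurableList fun ω => f ω ++ f' ω := by
  constructor
  · simp only [List.length_append]
    exact hf.1.add hf'.1
  · intro i
    have h1 : ∀ ω, (f ω ++ f' ω).getD i 0 =
        if i < (f ω).length then (f ω).getD i 0 else (f' ω).getD (i - (f ω).length) 0 := by
      intro ω
      split_ifs with h
      · rw [List.getD_append _ _ _ _ h]
      · rw [List.getD_append_right _ _ _ _ (not_lt.mp h)]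
    simp only [h1]
    refine Measurable.ite (measurableSet_lt measurable_const hf.1) (hf.2 i) ?_
    exact (measurable_from_prod_countable_right (f := fun p : ℕ × Ω => (f' p.2).getD (i - p.1) 0)
      fun a => hf'.2 (i - a)).comp (hf.1.prodMk measurable_id)

theorem measurableList_map {ι : Type*} (l : List ι) {F : ι → Ω → Fin d → ℝ}
    (hF : ∀ r, Measurable (F r)) : MeasurableList fun ω => l.map fun r => F r ω := by
  refine ⟨by simp, fun i => ?_⟩
  induction l generalizing i with
  | nil => simp
  | cons r l ih =>
    cases i with
    | zero => simpa using hF r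
    | succ i => simpa using ih i

theorem perp_get_ofFn {k : ℕ} (v : Fin k → Fin d → ℝ) : perp (List.ofFn v).get = perp v := by
  funext x
  rw [perp, proj_get, List.map_ofFn, List.sum_ofFn]
  rfl

theorem isOrtho_get_ofFn {k : ℕ} (v : Fin k → Fin d → ℝ) :
    IsOrtho (List.ofFn v).get ↔ IsOrtho v := by
  constructor
  · intro h i j
    simpa [Fin.ext_iff] using h ⟨i, by simp⟩ ⟨j, by simp⟩
  · intro h i j
    simpa [Fin.ext_iff] using h ⟨i, by simpa using i.2⟩ ⟨j, by simpa using j.2⟩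

theorem measurableSet_isOrtho (k : ℕ) : MeasurableSet {v : Fin k → Fin d → ℝ | IsOrtho v} := by
  simp only [IsOrtho, Set.ofPred_forall]
  refine MeasurableSet.iInter fun i => MeasurableSet.iInter fun j => ?_
  refine measurableSet_eq_fun ?_ measurable_const
  simp only [dotProduct]
  fun_prop

theorem cellIndex_ofFn_eq_some_iff {k : ℕ} (q : ℝ → Option ℕ) (v : Fin k → Fin d → ℝ)
    (x : Fin d → ℝ) (js : List ℕ) : cellIndex q (List.ofFn v) x = some js ↔
      js.length = k ∧ ∀ i : Fin k, q (v i ⬝ᵥ x) = js[i.1]? := by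
  rw [cellIndex_eq_some_iff]
  refine and_congr (by rw [List.length_ofFn]) ⟨fun h i => ?_, fun h i => ?_⟩
  · simpa using h ⟨i, by simp⟩
  · simpa using h ⟨i, by simpa using i.2⟩

/-- The examples in a cell of the approximating partition. -/
def boxExamples (ε' τ : ℝ) (L : List (Fin d → ℝ)) (K : ℕ) (js : List ℕ) :
    Set (Example ℝ d K) :=
  {p | cellIndex (intervalIndex (partitionOf ε' τ L).start ε' (partitionOf ε' τ L).num) L p.1 =
    some js}

theorem measurableSet_boxExamples (ε' τ : ℝ) (k : ℕ) (js : List ℕ) :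
    MeasurableSet {p : (Fin k → Fin d → ℝ) × Example ℝ d K |
      p.2 ∈ boxExamples ε' τ (List.ofFn p.1) K js} := by
  have h0 : {p : (Fin k → Fin d → ℝ) × Example ℝ d K |
      p.2 ∈ boxExamples ε' τ (List.ofFn p.1) K js} = {_p | js.length = k} ∩ ⋂ i : Fin k,
      {p | intervalIndex (-√(2 * Real.log (k / ε')) + τ) ε' ⌈2 * √(2 * Real.log (k / ε')) / ε'⌉₊
        (p.1 i ⬝ᵥ p.2.1) = js[i.1]?} := by
    ext p
    simp only [boxExamples, Set.mem_ofPred_eq, partitionOf, List.length_ofFn,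
      cellIndex_ofFn_eq_some_iff, Set.mem_inter_iff, Set.mem_iInter]
  rw [h0]
  refine (MeasurableSet.const _).inter (MeasurableSet.iInter fun i => ?_)
  have h : Measurable fun p : (Fin k → Fin d → ℝ) × Example ℝ d K => p.1 i ⬝ᵥ p.2.1 := by
    simp only [dotProduct]
    fun_prop
  exact h (measurableSet_intervalIndex _ _ _ _)

theorem measurableSet_label (l : Fin K) : MeasurableSet {p : Example ℝ d K | p.2 = l} :=
  measurable_snd (measurableSet_singleton l)

theorem measurable_count {V Z : Type*} [MeasurableSpace V] [MeasurableSpace Z] {A : V → Set Z}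
    (hA : MeasurableSet {p : V × Z | p.2 ∈ A p.1}) :
    Measurable fun p : V × (Fin N → Z) => (count (A p.1) p.2 : ℝ) := by
  simp only [count_eq_sum]
  refine Finset.measurable_fun_sum _ fun n _ => ?_
  have h1 : Measurable fun p : V × Z => {p : V × Z | p.2 ∈ A p.1}.indicator (1 : V × Z → ℝ) p :=
    measurable_one.indicator hA
  exact h1.comp (measurable_fst.prodMk ((measurable_pi_apply n).comp measurable_snd))

theorem measurable_perp_uncurry (k : ℕ) :
    Measurable fun p : (Fin k → Fin d → ℝ) × (Fin d → ℝ) => perp p.1 p.2 := by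
  simp only [perp, proj, dotProduct]
  fun_prop

theorem measurable_empMoment {k : ℕ} {A : (Fin k → Fin d → ℝ) → Set (Example ℝ d K)}
    (hA : MeasurableSet {p : (Fin k → Fin d → ℝ) × Example ℝ d K | p.2 ∈ A p.1}) (l : Fin K) :
    Measurable fun p : (Fin k → Fin d → ℝ) × (Fin N → Example ℝ d K) =>
      empMoment p.1 (A p.1) p.2 l := by
  classical
  simp only [empMoment]
  refine (measurable_count hA).inv.smul (Finset.measurable_fun_sum _ fun n _ => ?_)
  have h1 : Measurable fun p : (Fin k → Fin d → ℝ) × Example ℝ d K =>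
      if p.2 ∈ A p.1 ∧ p.2.2 = l then perp p.1 p.2.1 else 0 :=
    Measurable.ite (hA.inter (measurable_snd (measurableSet_label l)))
      ((measurable_perp_uncurry k).comp (measurable_fst.prodMk (measurable_fst.comp measurable_snd)))
      measurable_const
  exact h1.comp (measurable_fst.prodMk ((measurable_pi_apply n).comp measurable_snd))

/-- The moment is a normalizing factor times the integral of an indicator against the fixed measure
`D`, so it is measurable in the parameter as a partial integral. -/
theorem measurable_condMoment (D : Measure (Example ℝ d K)) [IsProbabilityMeasure D] {k : ℕ}
    {A : (Fin k → Fin d → ℝ) → Set (Example ℝ d K)}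
    (hA : MeasurableSet {p : (Fin k → Fin d → ℝ) × Example ℝ d K | p.2 ∈ A p.1}) (l : Fin K) :
    Measurable fun v : Fin k → Fin d → ℝ => condMoment D v (A v) l := by
  refine measurable_pi_lambda _ fun n => ?_
  have hAv : ∀ v, MeasurableSet (A v) := fun v => measurable_prodMk_left hA
  have h1 : ∀ v, condMoment D v (A v) l n = (D (A v))⁻¹.toReal *
      ∫ p, (A v).indicator (fun p => perp v p.1 n * (if p.2 = l then 1 else 0)) p ∂D := fun v => by
    rw [condMoment, ProbabilityTheory.cond, integral_smul_measure, integral_indicator (hAv v),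
      smul_eq_mul]
  simp only [h1]
  refine (measurable_measure_prodMk_left hA).inv.ennreal_toReal.mul ?_
  have h2 : Measurable fun p : (Fin k → Fin d → ℝ) × Example ℝ d K =>
      {p : (Fin k → Fin d → ℝ) × Example ℝ d K | p.2 ∈ A p.1}.indicator
        (fun p => perp p.1 p.2.1 n * (if p.2.2 = l then 1 else 0)) p := by
    refine Measurable.indicator (Measurable.mul ?_ ?_) hA
    · exact (measurable_pi_apply n).comp ((measurable_perp_uncurry k).comp
        (measurable_fst.prodMk (measurable_fst.comp measurable_snd)))
    · exact Measurable.ite (measurable_snd (measurableSet_label l)) measurable_const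
        measurable_const
  exact h2.stronglyMeasurable.integral_prod_right'.measurable

variable {ε' : ℝ} (hε : 0 < ε') (τ : ℝ)

-- The formula for the matrix in terms of cells is available for orthonormal lists only, hence the
-- case distinction. All lists that occur are orthonormal.
open Classical in
include hε in
theorem measurable_estimatedMatrix (k : ℕ) :
    Measurable fun p : (Fin k → Fin d → ℝ) × (Fin N → Example ℝ d K) =>
      if IsOrtho (List.ofFn p.1).get then
        estimatedMatrix E ε' τ (List.ofFn p.1) (List.ofFn p.2) else 0 := by
  have h1 : ∀ p : (Fin k → Fin d → ℝ) × (Fin N → Example ℝ d K),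
      (if IsOrtho (List.ofFn p.1).get then
        estimatedMatrix E ε' τ (List.ofFn p.1) (List.ofFn p.2) else 0) =
      if IsOrtho p.1 then fun a b =>
        ∑ i ∈ boxIndices k ⌈2 * √(2 * Real.log (k / ε')) / ε'⌉₊ ×ˢ (Finset.univ : Finset (Fin K)),
        ((count (boxExamples ε' τ (List.ofFn p.1) K i.1) p.2 : ℝ) / N) *
        (empMoment p.1 (boxExamples ε' τ (List.ofFn p.1) K i.1) p.2 i.2 a *
          empMoment p.1 (boxExamples ε' τ (List.ofFn p.1) K i.1) p.2 i.2 b) else 0 := by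
    intro p
    by_cases h : IsOrtho p.1
    · have hL := (isOrtho_get_ofFn p.1).mpr h
      rw [if_pos h, if_pos hL]
      have h2 := estimatedMatrix_eq E hε τ hL p.2
      rw [Matrix.of.injective.eq_iff] at h2
      rw [h2]
      have h3 : (partitionCells hε τ hL).cells =
          boxIndices k ⌈2 * √(2 * Real.log (k / ε')) / ε'⌉₊ := by
        simp only [partitionCells, boxCells, partitionOf, List.length_ofFn]
      rw [h3]
      simp only [empMoment, perp_get_ofFn]
      rfl
    · rw [if_neg h, if_neg (fun h' => h ((isOrtho_get_ofFn p.1).mp h'))]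
  simp only [h1]
  refine Measurable.ite (measurable_fst (measurableSet_isOrtho k)) ?_ measurable_const
  refine measurable_pi_lambda _ fun a => measurable_pi_lambda _ fun b =>
    Finset.measurable_fun_sum _ fun i _ => ?_
  have h2 := measurable_empMoment (N := N) (A := fun v => boxExamples ε' τ (List.ofFn v) K i.1)
    (measurableSet_boxExamples (d := d) (K := K) ε' τ k i.1) i.2
  exact ((measurable_count (A := fun v => boxExamples ε' τ (List.ofFn v) K i.1)
    (measurableSet_boxExamples ε' τ k i.1)).div_const _).mul
    (((measurable_pi_apply a).comp h2).mul ((measurable_pi_apply b).comp h2))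

include hε in
theorem measurableList_directions (σ : ℝ) {f : Ω → List (Fin d → ℝ)}
    (hf : MeasurableList f) (hfo : ∀ ω, IsOrtho (f ω).get) {h : Ω → Fin N → Example ℝ d K}
    (hh : Measurable h) :
    MeasurableList fun ω => directions E ε' σ τ (f ω) (List.ofFn (h ω)) := by
  classical
  have h1 : Measurable fun ω => estimatedMatrix E ε' τ (f ω) (List.ofFn (h ω)) := by
    have := hf.measurable_comp hh (g := fun L (S : Fin N → Example ℝ d K) =>
      if IsOrtho L.get then estimatedMatrix E ε' τ L (List.ofFn S) else 0)
      (measurable_estimatedMatrix E hε τ)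
    simpa only [if_pos (hfo _)] using this
  have h2 : Measurable fun ω => eigenvectors E ε' τ (f ω) (List.ofFn (h ω)) :=
    (E.measurable_solve d).comp h1
  have h3 : ∀ r, Measurable fun ω => eigenvectors E ε' τ (f ω) (List.ofFn (h ω)) r := fun r =>
    (measurable_pi_apply r).comp h2
  simp only [directions_eq]
  have hA : Measurable fun ω (r : Fin d) =>
      decide (σ ≤ (eigenvectors E ε' τ (f ω) (List.ofFn (h ω)) r).1) := by
    refine measurable_pi_lambda _ fun r => measurable_to_bool ?_
    have : (fun ω => decide (σ ≤ (eigenvectors E ε' τ (f ω) (List.ofFn (h ω)) r).1)) ⁻¹' {true} =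
        {ω | σ ≤ (eigenvectors E ε' τ (f ω) (List.ofFn (h ω)) r).1} := by
      ext ω; simp
    rw [this]
    exact measurableSet_le measurable_const (measurable_fst.comp (h3 r))
  refine MeasurableList.of_countable hA (F := fun (a : Fin d → Bool) ω =>
    (((List.finRange d).filter fun r => a r).map fun r =>
      (eigenvectors E ε' τ (f ω) (List.ofFn (h ω)) r).2).reverse) fun a => ?_
  simp only [← List.map_reverse]
  exact measurableList_map _ fun r => measurable_snd.comp (h3 r)

include hε in
theorem measurableList_basisAfter {T : ℕ} {σ : ℝ} (hσ : 0 < σ) (t : ℕ) :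
    MeasurableList fun S : Data d K T N => basisAfter E ε' σ τ (sampleList S) t := by
  induction t with
  | zero => exact ⟨measurable_const, fun i => measurable_const⟩
  | succ t ih =>
    exact ih.append (measurableList_directions E hε τ σ ih
      (fun S => isOrtho_basisAfter E hε hσ τ (fun n => S (Fin.ofNat (T + 1) n)) t)
      (measurable_pi_apply _))

/-- Samples that are good for the partition of a list. -/
def GoodFor (D : Measure (Example ℝ d K)) (hε : 0 < ε') (τ : ℝ) (kmax : ℕ) (ξ s : ℝ)
    (L : List (Fin d → ℝ)) (S : Fin N → Example ℝ d K) : Prop :=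
  ∀ hL : IsOrtho L.get, L.length ≤ kmax → GoodSample D (partitionCells hε τ hL) S ξ s

theorem measurable_goodFor (D : Measure (Example ℝ d K)) [IsProbabilityMeasure D] (kmax : ℕ)
    (ξ s : ℝ) (k : ℕ) : Measurable fun p : (Fin k → Fin d → ℝ) × (Fin N → Example ℝ d K) =>
      GoodFor D hε τ kmax ξ s (List.ofFn p.1) p.2 := by
  -- The condition on moments applies to nonempty cells only. For an empty cell the left side is
  -- zero, so the condition can be stated for all cells with the bound `0` there.
  have h1 : ∀ p : (Fin k → Fin d → ℝ) × (Fin N → Example ℝ d K),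
      GoodFor D hε τ kmax ξ s (List.ofFn p.1) p.2 ↔ (¬ IsOrtho p.1) ∨ (¬ k ≤ kmax) ∨
        ∀ j ∈ boxIndices k ⌈2 * √(2 * Real.log (k / ε')) / ε'⌉₊, ∀ l : Fin K,
          |(count (boxExamples ε' τ (List.ofFn p.1) K j ∩ {z | z.2 = l}) p.2 : ℝ) / N -
            D.real (boxExamples ε' τ (List.ofFn p.1) K j ∩ {z | z.2 = l})| ≤ ξ ∧
          (count (boxExamples ε' τ (List.ofFn p.1) K j) p.2 : ℝ) *
            ((empMoment p.1 (boxExamples ε' τ (List.ofFn p.1) K j) p.2 l -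
              condMoment D p.1 (boxExamples ε' τ (List.ofFn p.1) K j) l) ⬝ᵥ
            (empMoment p.1 (boxExamples ε' τ (List.ofFn p.1) K j) p.2 l -
              condMoment D p.1 (boxExamples ε' τ (List.ofFn p.1) K j) l)) ≤
            if 0 < (count (boxExamples ε' τ (List.ofFn p.1) K j) p.2 : ℝ) then s else 0 := by
    intro p
    by_cases h : IsOrtho p.1
    · have hL := (isOrtho_get_ofFn p.1).mpr h
      have hcells : (partitionCells hε τ hL).cells =
          boxIndices k ⌈2 * √(2 * Real.log (k / ε')) / ε'⌉₊ := by
        simp only [partitionCells, boxCells, partitionOf, List.length_ofFn]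
      have hset : ∀ j, (partitionCells hε τ hL).exampleSet K j =
        boxExamples ε' τ (List.ofFn p.1) K j := fun j => rfl
      have hemp : ∀ A l, empMoment (List.ofFn p.1).get A p.2 l = empMoment p.1 A p.2 l :=
        fun A l => by simp only [empMoment, perp_get_ofFn]
      have hcond : ∀ A (l : Fin K), condMoment D (List.ofFn p.1).get A l = condMoment D p.1 A l :=
        fun A l => by funext n; simp only [condMoment, perp_get_ofFn]
      by_cases hk : k ≤ kmax
      · simp only [h, hk, not_true_eq_false, false_or]
        constructor
        · intro hg j hj l
          obtain ⟨h2, h3⟩ := hg hL (by simpa using hk)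
          refine ⟨h2 j (hcells ▸ hj) l, ?_⟩
          split_ifs with h0
          · have := h3 j (hcells ▸ hj) l (by exact_mod_cast h0)
            simpa only [hemp, hcond, hset] using this
          · have h0' := le_antisymm (not_lt.mp h0) (Nat.cast_nonneg _)
            rw [h0', zero_mul]
        · intro hg _ _
          refine ⟨fun j hj l => ?_, fun j hj l h0 => ?_⟩
          · exact (hg j (hcells ▸ hj) l).1
          · have := (hg j (hcells ▸ hj) l).2
            rw [if_pos (by exact_mod_cast h0)] at this
            simpa only [hemp, hcond, hset] using this
      · simp only [hk, not_false_eq_true, true_or, or_true, iff_true]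
        exact fun _ h' => absurd (by simpa using h') hk
    · simp only [h, not_false_eq_true, true_or, iff_true]
      exact fun hL => absurd ((isOrtho_get_ofFn p.1).mp hL) h
  refine measurableSet_setOfPred.mp ?_
  simp only [h1, Set.ofPred_or]
  refine (measurable_fst (measurableSet_isOrtho k)).compl.union ((MeasurableSet.const _).union ?_)
  simp only [Set.ofPred_forall, Set.ofPred_and]
  refine Finset.measurableSet_biInter _ fun j _ => MeasurableSet.iInter fun l => ?_
  have hA := measurableSet_boxExamples (d := d) (K := K) ε' τ k j
  have hAl : MeasurableSet {p : (Fin k → Fin d → ℝ) × Example ℝ d K |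
      p.2 ∈ boxExamples ε' τ (List.ofFn p.1) K j ∩ {z | z.2 = l}} :=
    hA.inter (measurable_snd (measurableSet_label l))
  have hcount := measurable_count (N := N) (A := fun v => boxExamples ε' τ (List.ofFn v) K j) hA
  have hdiff : Measurable fun p : (Fin k → Fin d → ℝ) × (Fin N → Example ℝ d K) =>
      empMoment p.1 (boxExamples ε' τ (List.ofFn p.1) K j) p.2 l -
        condMoment D p.1 (boxExamples ε' τ (List.ofFn p.1) K j) l :=
    (measurable_empMoment (A := fun v => boxExamples ε' τ (List.ofFn v) K j) hA l).sub
      ((measurable_condMoment D (A := fun v => boxExamples ε' τ (List.ofFn v) K j) hA l).comp measurable_fst)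
  refine MeasurableSet.inter (measurableSet_le ?_ measurable_const) (measurableSet_le ?_ ?_)
  · exact (((measurable_count (A := fun v =>
      boxExamples ε' τ (List.ofFn v) K j ∩ {z | z.2 = l}) hAl).div_const _).sub
      ((measurable_measure_prodMk_left hAl).ennreal_toReal.comp measurable_fst)).abs
  · refine hcount.mul ?_
    simp only [dotProduct]
    exact Finset.measurable_fun_sum _ fun n _ =>
      ((measurable_pi_apply n).comp hdiff).mul ((measurable_pi_apply n).comp hdiff)
  · exact Measurable.ite (measurableSet_lt measurable_const hcount) measurable_const
      measurable_const

end measurability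

/-! ### The probability of good samples -/

section probability

variable {d K N T : ℕ}

theorem basisAfter_congr (ε' σ τ : ℝ) {samples samples' : ℕ → List (Example ℝ d K)} {t : ℕ}
    (h : ∀ n < t, samples n = samples' n) :
    basisAfter E ε' σ τ samples t = basisAfter E ε' σ τ samples' t := by
  induction t with
  | zero => rfl
  | succ t ih =>
    simp only [basisAfter]
    rw [ih fun n hn => h n (by omega), h t (by omega)]

/-- The list of round `t` is determined by the earlier samples. Given all other samples, sample `t`
is fresh, and the bound for a fixed list applies; Fubini's theorem combines these bounds. -/
theorem measure_not_goodFor_le [NeZero K] (D : Measure (Example ℝ d K)) [IsProbabilityMeasure D]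
    {ε' σ : ℝ} (hε : 0 < ε') (hσ : 0 < σ) (τ : ℝ) (kmax : ℕ) (ξ s : ℝ) {δ : ENNReal}
    (hδ : ∀ L : List (Fin d → ℝ),
      Measure.pi (fun _ : Fin N => D) {S | ¬ GoodFor D hε τ kmax ξ s L S} ≤ δ)
    {t : ℕ} (ht : t ≤ T) :
    dataLaw D T N {S | ¬ GoodFor D hε τ kmax ξ s (basisAfter E ε' σ τ (sampleList S) t)
      (S (Fin.ofNat (T + 1) t))} ≤ δ := by
  set i : Fin (T + 1) := Fin.ofNat (T + 1) t with hi
  set μ : Fin (T + 1) → Measure (Fin N → Example ℝ d K) := fun _ => Measure.pi fun _ => D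
  have hmp := measurePreserving_piFinSuccAbove μ i
  let z0 : Fin N → Example ℝ d K := fun _ => (0, 0)
  let B : Set ((Fin N → Example ℝ d K) × (Fin T → Fin N → Example ℝ d K)) :=
    {p | ¬ GoodFor D hε τ kmax ξ s (basisAfter E ε' σ τ
      (sampleList (i.insertNth z0 p.2 : Data d K T N)) t) p.1}
  have hins : Measurable fun p : (Fin N → Example ℝ d K) × (Fin T → Fin N → Example ℝ d K) =>
      (i.insertNth z0 p.2 : Data d K T N) := by
    refine measurable_pi_lambda _ fun n => ?_
    refine Fin.succAboveCases i ?_ (fun m => ?_) n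
    · simp
    · simp only [Fin.insertNth_apply_succAbove]
      exact (measurable_pi_apply m).comp measurable_snd
  have hlist : MeasurableList fun p : (Fin N → Example ℝ d K) × (Fin T → Fin N → Example ℝ d K) =>
      basisAfter E ε' σ τ (sampleList (i.insertNth z0 p.2 : Data d K T N)) t := by
    have := measurableList_basisAfter E hε τ (d := d) (K := K) (N := N) (T := T) hσ t
    exact ⟨this.1.comp hins, fun n => (this.2 n).comp hins⟩
  have hB : MeasurableSet B :=
    (measurableSet_setOfPred.mpr (hlist.measurable_comp measurable_fst
      (g := fun L S => GoodFor D hε τ kmax ξ s L S)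
      (measurable_goodFor hε τ D kmax ξ s))).compl
  have hpre : {S : Data d K T N | ¬ GoodFor D hε τ kmax ξ s
      (basisAfter E ε' σ τ (sampleList S) t) (S i)} ⊆
      MeasurableEquiv.piFinSuccAbove (fun _ => Fin N → Example ℝ d K) i ⁻¹' B := by
    intro S hS
    have h1 : basisAfter E ε' σ τ (sampleList S) t = basisAfter E ε' σ τ
        (sampleList (i.insertNth z0 (fun j => S (i.succAbove j)) : Data d K T N)) t := by
      refine basisAfter_congr E ε' σ τ fun n hn => ?_
      have hne : Fin.ofNat (T + 1) n ≠ i := by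
        rw [hi, Ne, Fin.ext_iff]
        simp only [Fin.ofNat]
        rw [Nat.mod_eq_of_lt (by omega), Nat.mod_eq_of_lt (by omega)]
        omega
      obtain ⟨m, hm⟩ := Fin.exists_succAbove_eq hne
      simp only [sampleList]
      rw [← hm, Fin.insertNth_apply_succAbove]
    change ¬ GoodFor D hε τ kmax ξ s (basisAfter E ε' σ τ (sampleList S) t) (S i) at hS
    rw [h1] at hS
    exact hS
  refine (measure_mono hpre).trans ?_
  rw [dataLaw, hmp.measure_preimage hB.nullMeasurableSet, Measure.prod_apply_symm hB]
  refine le_trans (b := ∫⁻ _p, δ ∂Measure.pi fun j => μ (i.succAbove j))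
    (lintegral_mono fun p => ?_) (by simp)
  exact hδ (basisAfter E ε' σ τ (sampleList (i.insertNth z0 p : Data d K T N)) t)

end probability

open Prog

variable (E : EigenSolver)

/-! ### Running times -/

namespace Prog

variable {α β : Type}

theorem steps_pure (a : α) : (pure a : Prog ℝ α).steps E = 0 := rfl
theorem steps_charge' (n : ℕ) : (charge' n : Prog ℝ Unit).steps E = n := rfl
theorem steps_const' (q : ℚ) : (const' q : Prog ℝ ℝ).steps E = 1 := rfl
theorem steps_add' (x y : ℝ) : (add' x y).steps E = 1 := rfl
theorem steps_sub' (x y : ℝ) : (sub' x y).steps E = 1 := rfl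
theorem steps_mul' (x y : ℝ) : (mul' x y).steps E = 1 := rfl
theorem steps_div' (x y : ℝ) : (div' x y).steps E = 1 := rfl
theorem steps_sqrt' (x : ℝ) : (sqrt' x).steps E = 1 := rfl
theorem steps_log' (x : ℝ) : (log' x).steps E = 1 := rfl
theorem steps_lt' (x y : ℝ) : (lt' x y).steps E = 1 := rfl
theorem steps_ceil' (x : ℝ) : (ceil' x).steps E = ⌈x⌉₊ + 1 := rfl
theorem steps_eigh' {n : ℕ} (M : Fin n → Fin n → ℝ) : (eigh' M).steps E = n ^ 3 + 1 := rfl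

/-- The running time of a loop, with an invariant. -/
theorem steps_forEach_le {σ : Type} (Inv : σ → Prop) (l : List β) (s : σ)
    (body : σ → β → Prog ℝ σ) (c : ℕ) (h0 : Inv s)
    (hb : ∀ s, ∀ b ∈ l, Inv s → (body s b).steps E ≤ c ∧ Inv ((body s b).run E)) :
    (forEach l s body).steps E ≤ l.length * (c + 1) ∧ Inv ((forEach l s body).run E) := by
  induction l generalizing s with
  | nil => exact ⟨Nat.zero_le _, h0⟩
  | cons b l ih =>
    obtain ⟨h1, h2⟩ := hb s b List.mem_cons_self h0
    obtain ⟨h3, h4⟩ := ih ((body s b).run E) h2 fun s b' hb' => hb s b' (List.mem_cons_of_mem _ hb')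
    have h5 : (forEach (b :: l) s body).steps E =
        1 + (body s b >>= fun s' => forEach l s' body).steps E := rfl
    have h6 : (forEach (b :: l) s body).run E =
        (body s b >>= fun s' => forEach l s' body).run E := rfl
    rw [h5, h6, steps_bind, run_bind, List.length_cons, add_mul]
    exact ⟨by omega, h4⟩

theorem steps_forEach_le' {σ : Type} (l : List β) (s : σ)
    (body : σ → β → Prog ℝ σ) (c : ℕ) (hb : ∀ s, ∀ b ∈ l, (body s b).steps E ≤ c) :
    (forEach l s body).steps E ≤ l.length * (c + 1) :=
  (steps_forEach_le E (fun _ => True) l s body c trivial fun s b h _ => ⟨hb s b h, trivial⟩).1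

theorem steps_tabulate_le {n : ℕ} (f : Fin n → Prog ℝ β) (c : ℕ) (hf : ∀ i, (f i).steps E ≤ c) :
    (tabulate n f).steps E ≤ n * (c + 1) := by
  induction n with
  | zero => exact Nat.zero_le _
  | succ n ih =>
    have h1 : (tabulate (n + 1) f).steps E =
      1 + (f 0 >>= fun b => tabulate n (fun i => f i.succ) >>= fun bs =>
      (pure (Fin.cons b bs : Fin (n + 1) → β) : Prog ℝ _)).steps E := rfl
    rw [h1, steps_bind, steps_bind, steps_pure]
    have h2 := ih (fun i => f i.succ) fun i => hf i.succ
    have h3 := hf 0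
    rw [add_mul]
    omega

end Prog

section steps

variable {d K X : ℕ}

theorem steps_dot_le (x y : Fin d → ℝ) : (dot x y).steps E ≤ 1 + d * 3 := by
  simp only [dot, steps_bind, steps_const']
  have := steps_forEach_le' E (List.finRange d) ((const' 0 : Prog ℝ ℝ).run E) (fun acc i => do
    let p ← mul' (x i) (y i)
    add' acc p) 2 fun s b _ => le_of_eq (by simp only [steps_bind, steps_mul', steps_add'])
  rw [List.length_finRange] at this
  omega

theorem steps_threshold (P : Partition ℝ d) (i : ℕ) : (threshold P i).steps E = 3 := by
  simp only [threshold, steps_bind, steps_const', steps_mul', steps_add']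

theorem steps_intervalOf_le (P : Partition ℝ d) (p : ℝ) :
    (intervalOf P p).steps E ≤ P.num * 9 := by
  have := steps_forEach_le' E (List.range P.num) (none : Option ℕ) (fun found j =>
    match found with
    | some i => pure (some i)
    | none => do
        let lo ← threshold P j
        let hi ← threshold P (j + 1)
        let below ← lt' p lo
        let above ← lt' hi p
        pure (if below || above then none else some j)) 8 fun s b _ => by
    cases s with
    | some i => exact Nat.zero_le _
    | none =>
      simp only [steps_bind, steps_threshold, steps_lt', steps_pure]
      omega
  rwa [List.length_range] at this

theorem steps_cellOf_le (P : Partition ℝ d) (x : Fin d → ℝ) (hX : 1 ≤ X) (hd : d ≤ X)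
    (hb : P.basis.length ≤ X) (hn : P.num ≤ X) : (cellOf P x).steps E ≤ 14 * X ^ 2 := by
  have := steps_forEach_le' E P.basis.reverse (some [] : Option (List ℕ)) (fun found v =>
    match found with
    | none => pure none
    | some js => do
        let p ← dot v x
        let j ← intervalOf P p
        pure (j.map fun i => i :: js)) (1 + X * 3 + X * 9) fun s v _ => by
    cases s with
    | none => exact Nat.zero_le _
    | some js =>
      simp only [steps_bind, steps_pure]
      have h1 := steps_dot_le E v x
      have h2 := steps_intervalOf_le E P ((dot v x).run E)
      omega
  rw [List.length_reverse] at this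
  refine this.trans ((Nat.mul_le_mul_right _ hb).trans ?_)
  nlinarith

theorem steps_mkPartition (ε' τ : ℝ) (L : List (Fin d → ℝ)) :
    (mkPartition ε' τ L).steps E = L.length + (partitionOf ε' τ L).num + 12 := by
  simp only [mkPartition, steps_bind, steps_const', steps_charge', steps_div', steps_log',
    steps_mul', steps_sqrt', steps_ceil', steps_sub', steps_add', steps_pure, run_const',
    run_div', run_log', run_mul', run_sqrt', partitionOf, Rat.cast_natCast, Rat.cast_ofNat]
  omega

theorem steps_locate_le (P : Partition ℝ d) (S : List (Example ℝ d K)) (hX : 1 ≤ X) (hd : d ≤ X)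
    (hb : P.basis.length ≤ X) (hn : P.num ≤ X) (hS : S.length ≤ X) :
    (locate P S).steps E ≤ 15 * X ^ 3 := by
  have := steps_forEach_le' E S ([] : List (List ℕ × Example ℝ d K)) (fun acc e => do
    let c ← cellOf P e.1
    match c with
    | none => pure acc
    | some js => pure ((js, e) :: acc)) (14 * X ^ 2) fun s e _ => by
    rw [steps_bind]
    have := steps_cellOf_le E P e.1 hX hd hb hn
    cases (cellOf P e.1).run E <;> simpa only [steps_pure, add_zero] using this
  refine this.trans ((Nat.mul_le_mul_right _ hS).trans ?_)
  have h2 : X ≤ X ^ 3 := Nat.le_self_pow (by norm_num) X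
  nlinarith

theorem length_run_locate_le (P : Partition ℝ d) (S : List (Example ℝ d K)) :
    ((locate P S).run E).length ≤ S.length := by
  rw [run_locate, List.length_reverse]
  exact List.length_filterMap_le _ _

theorem length_index_run_locate (P : Partition ℝ d) (S : List (Example ℝ d K))
    {q : List ℕ × Example ℝ d K} (hq : q ∈ (locate P S).run E) :
    q.1.length = P.basis.length := by
  rw [run_locate, List.mem_reverse, List.mem_filterMap] at hq
  obtain ⟨e, -, he⟩ := hq
  obtain ⟨js, hjs, rfl⟩ := Option.map_eq_some_iff.mp he
  rw [run_cellOf] at hjs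
  exact ((cellIndex_eq_some_iff _ _ _ _).mp hjs).1

theorem steps_sameCell (a b : List ℕ) :
    (sameCell a b : Prog ℝ Bool).steps E = a.length + b.length + 1 := by
  simp only [sameCell, steps_bind, steps_charge', steps_pure, add_zero]

/-- Lists of located examples of a bounded size. -/
structure Located (X : ℕ) (Q : List (List ℕ × Example ℝ d K)) : Prop where
  length_le : Q.length ≤ X
  index_le : ∀ q ∈ Q, q.1.length ≤ X

theorem occupied_bounds {Q : List (List ℕ × Example ℝ d K)} (hQ : Located X Q) :
    ((occupied Q).run E).length ≤ X ∧ ∀ c ∈ (occupied Q).run E, c.length ≤ X := by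
  obtain ⟨h1, h2⟩ := run_occupied E Q
  have hsub : (occupied Q).run E ⊆ Q.map Prod.fst := fun c hc => by
    obtain ⟨q, hq, rfl⟩ := (h2 c).mp hc
    exact List.mem_map_of_mem hq
  refine ⟨((List.subperm_of_subset h1 hsub).length_le.trans_eq (List.length_map _)).trans
    hQ.length_le, fun c hc => ?_⟩
  obtain ⟨q, hq, rfl⟩ := (h2 c).mp hc
  exact hQ.index_le q hq

/-- The invariant that the cells collected so far are distinct and come from `Q` bounds their
number, so there are at most `X ^ 2` comparisons, each linear in `X`. -/
theorem steps_occupied_le {Q : List (List ℕ × Example ℝ d K)} (hQ : Located X Q) (hX : 1 ≤ X) :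
    (occupied Q).steps E ≤ 5 * X ^ 3 := by
  have h := (steps_forEach_le E (fun cells : List (List ℕ) => cells.Nodup ∧
      cells ⊆ Q.map Prod.fst) Q [] (fun cells q => do
    let seen ← forEach cells false fun b c => do
      let s ← sameCell c q.1
      pure (b || s)
    pure (if seen then cells else q.1 :: cells)) (X * (2 * X + 2)) ⟨List.nodup_nil, by simp⟩
    fun cells q hq ⟨hnd, hsub⟩ => ?_).1
  · refine h.trans ((Nat.mul_le_mul_right _ hQ.length_le).trans ?_)
    have h2 : X ≤ X ^ 3 := Nat.le_self_pow (by norm_num) X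
    have h3 : X ^ 2 ≤ X ^ 3 := Nat.pow_le_pow_right hX (by norm_num)
    nlinarith
  · have hlen : cells.length ≤ X :=
      ((List.subperm_of_subset hnd hsub).length_le.trans_eq (List.length_map _)).trans
        hQ.length_le
    have hcell : ∀ c ∈ cells, c.length ≤ X := fun c hc => by
      obtain ⟨q', hq', rfl⟩ := List.mem_map.mp (hsub hc)
      exact hQ.index_le q' hq'
    have hinner := steps_forEach_le' E cells false (fun b c => do
      let s ← sameCell c q.1
      pure (b || s)) (2 * X + 1) fun b c hc => by
        simp only [steps_bind, steps_sameCell, steps_pure]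
        have := hcell c hc
        have := hQ.index_le q hq
        omega
    have hseen : ∀ (cells : List (List ℕ)) (c : List ℕ) (b : Bool),
        cells.foldl (fun b c' => b || decide (c' = c)) b = (b || decide (c ∈ cells)) := by
      intro cells c b
      induction cells generalizing b with
      | nil => simp
      | cons a l ih =>
        rw [List.foldl_cons, ih]
        by_cases h : a = c
        · simp [h]
        · simp [h, Ne.symm h]
    constructor
    · simp only [steps_bind, steps_pure, add_zero]
      exact hinner.trans (Nat.mul_le_mul_right _ hlen)
    · simp only [run_bind, run_pure, run_forEach, run_sameCell, hseen, Bool.false_or,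
        decide_eq_true_eq]
      split_ifs with h
      · exact ⟨hnd, hsub⟩
      · exact ⟨List.nodup_cons.mpr ⟨h, hnd⟩,
          List.cons_subset.mpr ⟨List.mem_map_of_mem hq, hsub⟩⟩

theorem steps_examplesIn_le {Q : List (List ℕ × Example ℝ d K)} (hQ : Located X Q) (hX : 1 ≤ X)
    {js : List ℕ} (hjs : js.length ≤ X) : (examplesIn Q js).steps E ≤ 4 * X ^ 2 := by
  have := steps_forEach_le' E Q ([] : List (Example ℝ d K)) (fun acc q => do
    let s ← sameCell q.1 js
    pure (if s then q.2 :: acc else acc)) (2 * X + 1) fun s q hq => by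
      simp only [steps_bind, steps_sameCell, steps_pure]
      have := hQ.index_le q hq
      omega
  refine this.trans ((Nat.mul_le_mul_right _ hQ.length_le).trans ?_)
  nlinarith

theorem length_run_examplesIn_le {Q : List (List ℕ × Example ℝ d K)} (hQ : Located X Q)
    (js : List ℕ) : ((examplesIn Q js).run E).length ≤ X := by
  rw [run_examplesIn, List.length_reverse, List.length_map]
  exact (List.length_filter_le _ _).trans hQ.length_le

theorem steps_moment_le {S : List (Example ℝ d K)} (hS : S.length ≤ X) (hX : 1 ≤ X) (hd : d ≤ X)
    (i : Fin K) : (moment S i).steps E ≤ 8 * X ^ 2 := by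
  simp only [moment, steps_bind, steps_const', steps_charge']
  have h1 := steps_forEach_le' E S (fun _ : Fin d => (const' 0 : Prog ℝ ℝ).run E) (fun acc e =>
    if e.2 = i then tabulate d fun l => add' (acc l) (e.1 l) else pure acc) (X * 2) fun s e _ => by
      split_ifs
      · exact (steps_tabulate_le E _ 1 fun l => le_of_eq (steps_add' E _ _)).trans
          (Nat.mul_le_mul_right _ hd)
      · exact Nat.zero_le _
  have h2 := fun total : Fin d → ℝ => (steps_tabulate_le E
    (fun l => div' (total l) ((const' (S.length : ℚ) : Prog ℝ ℝ).run E)) 1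
    fun l => le_of_eq (steps_div' E _ _)).trans (Nat.mul_le_mul_right _ hd)
  refine (Nat.add_le_add_left (Nat.add_le_add_left (Nat.add_le_add_left
    (Nat.add_le_add (h1.trans (Nat.mul_le_mul_right _ hS)) (h2 _)) _) _) _).trans ?_
  nlinarith

theorem steps_projPerp_le {L : List (Fin d → ℝ)} (hL : L.length ≤ X) (hX : 1 ≤ X) (hd : d ≤ X)
    (u : Fin d → ℝ) : (projPerp L u).steps E ≤ 8 * X ^ 2 := by
  have := steps_forEach_le' E L u (fun acc v => do
    let c ← dot v u
    tabulate d fun l => do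
      let m ← mul' c (v l)
      sub' (acc l) m) (1 + X * 3 + X * 3) fun s v _ => by
      rw [steps_bind]
      refine Nat.add_le_add ((steps_dot_le E v u).trans
        (Nat.add_le_add_left (Nat.mul_le_mul_right _ hd) _)) ?_
      refine (steps_tabulate_le E _ 2 fun l => ?_).trans (Nat.mul_le_mul_right _ hd)
      simp only [steps_bind, steps_mul', steps_sub', le_refl]
  refine this.trans ((Nat.mul_le_mul_right _ hL).trans ?_)
  nlinarith

theorem located_locate (ε' τ : ℝ) {L : List (Fin d → ℝ)} (hL : L.length ≤ X)
    {S : List (Example ℝ d K)} (hS : S.length ≤ X) :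
    Located X ((locate (partitionOf ε' τ L) S).run E) :=
  ⟨(length_run_locate_le E _ S).trans hS, fun _ hq =>
    (length_index_run_locate E _ S hq).trans_le hL⟩

theorem steps_relevantDirections_le (ε' σ τ : ℝ) {L : List (Fin d → ℝ)} (hL : L.length ≤ X)
    (hX : 1 ≤ X) (hd : d ≤ X) (hK : K ≤ X) {S : List (Example ℝ d K)} (hS : S.length ≤ X)
    (hn : (partitionOf ε' τ L).num ≤ X) :
    (relevantDirections ε' σ τ L S).steps E ≤ 80 * X ^ 4 := by
  have hQ := located_locate E ε' τ hL hS
  obtain ⟨hc1, hc2⟩ := occupied_bounds E hQ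
  have p2 : X ≤ X ^ 2 := Nat.le_self_pow (by norm_num) X
  have p3 : X ^ 2 ≤ X ^ 3 := Nat.pow_le_pow_right hX (by norm_num)
  have p4 : X ^ 3 ≤ X ^ 4 := Nat.pow_le_pow_right hX (by norm_num)
  have hbody := fun (N U0 : ℝ) => steps_forEach_le' E
    ((occupied ((locate (partitionOf ε' τ L) S).run E)).run E)
    (fun (_ _ : Fin d) => U0) (fun U js => do
    let C ← examplesIn ((locate (partitionOf ε' τ L) S).run E) js
    charge' C.length
    let n ← const' (C.length : ℚ)
    let weight ← div' n N
    forEach (List.finRange K) U fun U i => do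
      let u ← moment C i
      let p ← projPerp L u
      tabulate d fun a => tabulate d fun b => do
        let m ← mul' (p a) (p b)
        let m' ← mul' m weight
        add' (U a b) m') (29 * X ^ 3) fun U js hjs => by
      simp only [steps_bind, steps_charge', steps_const', steps_div']
      have h1 := steps_examplesIn_le E hQ hX (hc2 js hjs)
      have h2 := length_run_examplesIn_le E hQ js
      have h3 := fun weight : ℝ => steps_forEach_le' E (List.finRange K) U (fun U i => do
        let u ← moment ((examplesIn ((locate (partitionOf ε' τ L) S).run E) js).run E) i
        let p ← projPerp L u
        tabulate d fun a => tabulate d fun b => do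
          let m ← mul' (p a) (p b)
          let m' ← mul' m weight
          add' (U a b) m') (8 * X ^ 2 + (8 * X ^ 2 + X * (X * 4 + 1))) fun U i _ => by
          simp only [steps_bind]
          refine Nat.add_le_add (steps_moment_le E h2 hX hd i)
            (Nat.add_le_add (steps_projPerp_le E hL hX hd _) ?_)
          refine (steps_tabulate_le E _ (X * 4) fun a => ?_).trans (Nat.mul_le_mul_right _ hd)
          refine (steps_tabulate_le E _ 3 fun b => ?_).trans (Nat.mul_le_mul_right _ hd)
          simp only [steps_bind, steps_mul', steps_add']
          omega
      rw [List.length_finRange] at h3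
      refine (Nat.add_le_add h1 (Nat.add_le_add h2 (Nat.add_le_add_left (Nat.add_le_add_left
        ((h3 _).trans (Nat.mul_le_mul_right _ hK)) _) _))).trans ?_
      nlinarith
  have hsel := fun spec : Fin d → ℝ × (Fin d → ℝ) => steps_forEach_le' E (List.finRange d)
    ([] : List (Fin d → ℝ)) (fun dirs r => do
    let small ← lt' (spec r).1 σ
    pure (if small then dirs else (spec r).2 :: dirs)) 1 fun s r _ => by
      simp only [steps_bind, steps_lt', steps_pure, le_refl]
  rw [List.length_finRange] at hsel
  simp only [relevantDirections, steps_bind, steps_const', steps_charge', steps_mkPartition,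
    steps_eigh', run_mkPartition]
  have h1 := steps_locate_le E (partitionOf ε' τ L) S hX hd hL hn hS
  have h2 := steps_occupied_le E hQ hX
  have h3 : d ^ 3 ≤ X ^ 3 := Nat.pow_le_pow_left hd 3
  refine (Nat.add_le_add_left (Nat.add_le_add hS (Nat.add_le_add_left (Nat.add_le_add
    (Nat.add_le_add_right (Nat.add_le_add hL hn) 12) (Nat.add_le_add h1 (Nat.add_le_add h2
    (Nat.add_le_add ((hbody _ _).trans (Nat.mul_le_mul_right _ hc1))
    (Nat.add_le_add (Nat.add_le_add_right h3 1)
    ((hsel _).trans (Nat.mul_le_mul_right _ hd))))))) _)) _).trans ?_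
  nlinarith

theorem steps_majority_le [NeZero K] {S : List (Example ℝ d K)} (hS : S.length ≤ X) (hX : 1 ≤ X)
    (hK : K ≤ X) : (majority S).steps E ≤ 2 * X ^ 2 := by
  simp only [majority, steps_bind, steps_pure, add_zero]
  have := steps_forEach_le' E (List.finRange K) ((0 : Fin K), (0 : ℕ)) (fun best i => do
    let n ← forEach S (0 : ℕ) fun n e => pure (if e.2 = i then n + 1 else n)
    pure (if best.2 < n then (i, n) else best)) X fun best i _ => by
      simp only [steps_bind, steps_pure, add_zero]
      have := steps_forEach_le' E S (0 : ℕ) (fun n e => pure (if e.2 = i then n + 1 else n)) 0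
        fun s e _ => Nat.zero_le _
      omega
  rw [List.length_finRange] at this
  refine this.trans ((Nat.mul_le_mul_right _ hK).trans ?_)
  nlinarith

/-- The running time of the learner is polynomial. -/
theorem steps_learnFrom_le [NeZero K] {N T : ℕ} {ε' σ : ℝ} (hε : 0 < ε') (hσ : 0 < σ) (τ : ℝ)
    (hX : 1 ≤ X) (hd : d ≤ X) (hK : K ≤ X) (hN : N ≤ X) (hT : T ≤ X)
    (hnum : ∀ k ≤ d, ⌈2 * √(2 * Real.log (k / ε')) / ε'⌉₊ ≤ X) (S : Data d K T N) :
    (learnFrom ε' σ τ S).steps E ≤ 130 * X ^ 5 := by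
  have p2 : X ≤ X ^ 2 := Nat.le_self_pow (by norm_num) X
  have p3 : X ^ 2 ≤ X ^ 3 := Nat.pow_le_pow_right hX (by norm_num)
  have p4 : X ^ 3 ≤ X ^ 4 := Nat.pow_le_pow_right hX (by norm_num)
  have p5 : X ^ 4 ≤ X ^ 5 := Nat.pow_le_pow_right hX (by norm_num)
  -- The list stays orthonormal on all possible data, good or not, and therefore never has more than
  -- `d` entries.
  have hrounds := steps_forEach_le E (fun L : List (Fin d → ℝ) => IsOrtho L.get)
    (List.ofFn fun t : Fin T => List.ofFn (S t.castSucc)) [] (fun L S => do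
    let dirs ← relevantDirections ε' σ τ L S
    charge' (L.length + dirs.length)
    pure (L ++ dirs)) (82 * X ^ 4) (fun i => i.elim0) fun L S' hS' hL => by
      obtain ⟨t, rfl⟩ := List.mem_ofFn.mp hS'
      have hL' := isOrtho_append_directions E hε τ hL (S t.castSucc) hσ
      have hlen := hL'.card_le
      rw [List.length_append] at hlen
      refine ⟨?_, by rw [run_bind, run_bind, run_pure]; exact hL'⟩
      simp only [steps_bind, steps_charge', steps_pure]
      have := steps_relevantDirections_le E ε' σ τ (L := L) (S := List.ofFn (S t.castSucc))
        (by omega) hX hd hK (by simpa using hN) (hnum _ hL.card_le)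
      have h2 : (directions E ε' σ τ L (List.ofFn (S t.castSucc))).length =
        ((relevantDirections ε' σ τ L (List.ofFn (S t.castSucc))).run E).length := rfl
      omega
  obtain ⟨h1, h2⟩ := hrounds
  rw [List.length_ofFn] at h1
  simp only [learnFrom, learn, steps_bind, steps_mkPartition, run_mkPartition, steps_pure,
    add_zero]
  set L := (forEach (List.ofFn fun t : Fin T => List.ofFn (S t.castSucc)) [] (fun L S => do
    let dirs ← relevantDirections ε' σ τ L S
    charge' (L.length + dirs.length)
    pure (L ++ dirs))).run E
  have hL : L.length ≤ X := h2.card_le.trans hd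
  have hnL : (partitionOf ε' τ L).num ≤ X := hnum _ h2.card_le
  have hS : (List.ofFn (S (Fin.last T))).length ≤ X := by simpa using hN
  have hQ := located_locate E ε' τ hL hS
  obtain ⟨hc1, hc2⟩ := occupied_bounds E hQ
  have h3 := steps_locate_le E (partitionOf ε' τ L) _ hX hd hL hnL hS
  have h4 := steps_occupied_le E hQ hX
  have h5 := steps_forEach_le' E
    ((occupied ((locate (partitionOf ε' τ L) (List.ofFn (S (Fin.last T)))).run E)).run E)
    ([] : List (List ℕ × Fin K)) (fun table js => do
    let C ← examplesIn ((locate (partitionOf ε' τ L) (List.ofFn (S (Fin.last T)))).run E) js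
    let label ← majority C
    pure ((js, label) :: table)) (4 * X ^ 2 + 2 * X ^ 2) fun s js hjs => by
      simp only [steps_bind, steps_pure, add_zero]
      exact Nat.add_le_add (steps_examplesIn_le E hQ hX (hc2 js hjs))
        (steps_majority_le E (length_run_examplesIn_le E hQ js) hX hK)
  refine (Nat.add_le_add (h1.trans (Nat.mul_le_mul_right _ hT)) (Nat.add_le_add
    (Nat.add_le_add_right (Nat.add_le_add hL hnL) 12) (Nat.add_le_add h3 (Nat.add_le_add h4
      (h5.trans (Nat.mul_le_mul_right _ hc1)))))).trans ?_
  nlinarith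

end steps

open Prog

/-! ### Putting the parts together -/

theorem linearClassifiers_nonempty (d K : ℕ) [NeZero K] : (linearClassifiers d K).Nonempty :=
  ⟨fun _ => 0, 0, 0, fun x => ⟨fun j => by simp, fun j _ => Fin.zero_le j⟩⟩

/-- The infimum need not be attained; the slack `η` is absorbed into `ε` at the end. -/
theorem exists_classifier_err_le {d K : ℕ} [NeZero K] (D : Measure ((Fin d → ℝ) × Fin K)) {η : ℝ}
    (hη : 0 < η) : ∃ w t f, IsClassifier w t f ∧ err D f ≤ opt D + η := by
  obtain ⟨-, ⟨f, ⟨w, t, hf⟩, rfl⟩, h⟩ := exists_lt_of_csInf_lt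
    ((linearClassifiers_nonempty d K).image (err D)) (lt_add_of_pos_right (opt D) hη)
  exact ⟨w, t, f, hf, h.le⟩

/-- The learner succeeds with high probability. -/
theorem measure_err_learned_le (E : EigenSolver) {d K N T : ℕ} [NeZero K]
    (D : Measure ((Fin d → ℝ) × Fin K)) [IsProbabilityMeasure D]
    (hD : D.map Prod.fst = stdNormal d) {ε' σ τ : ℝ} {kmax : ℕ} {M ξ s e α η δ : ℝ}
    (hε : 0 < ε') (hε1 : ε' < 1) (hσ : 0 < σ) (hτ : 0 < τ) (hτε : τ < ε')
    (hM : ∀ k ≤ kmax, (⌈2 * √(2 * Real.log (k / ε')) / ε'⌉₊ ^ k : ℝ) ≤ M)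
    (hη : 0 < η) (hs : 0 ≤ s) (hξ : 0 ≤ ξ) (hN : 0 < N) (hα : 0 < α) (hα1 : α ≤ 1)
    (he : 0 < e) (hkmax : T * (3 * K) ≤ kmax * σ)
    (c1 : M * K * s ≤ N / 2) (c2 : M * K * ξ ≤ e / 2)
    (c3 : M * s ≤ N * ((α ^ 2 * e / (200 * K)) ^ 2 * e / 8))
    (c4 : σ * K ^ 2 ≤ (α ^ 2 * e / (200 * K)) ^ 2 * e / 16)
    (c5 : 3 * K * K ^ 2 < T * ((α ^ 2 * e / (200 * K)) ^ 2 * e / 16))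
    (c6 : M * (K * (2 * Real.exp (-2 * N * ξ ^ 2) + N * (√2 ^ d * Real.exp (-s / 80)))) ≤
      δ / (T + 1)) :
    dataLaw D T N {S | (2 + kmax) * ε' + (opt D + η) + 2 * projectionError K kmax ε' e α (opt D + η) +
      K ^ 2 * (√kmax * ε') + e < err D (learned E ε' σ τ S)} ≤ ENNReal.ofReal δ := by
  obtain ⟨w, t, f, hf, hferr⟩ := exists_classifier_err_le D hη
  have hround : ∀ L : List (Fin d → ℝ), Measure.pi (fun _ : Fin N => D)
      {S | ¬ GoodFor D hε τ kmax ξ s L S} ≤ ENNReal.ofReal (δ / (T + 1)) := by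
    intro L
    by_cases hL : IsOrtho L.get ∧ L.length ≤ kmax
    · refine (measure_mono (t := {S | ¬ GoodSample D (partitionCells hε τ hL.1) S ξ s})
        fun S hS => by
          rw [Set.mem_ofPred_eq] at hS ⊢
          exact fun h => hS fun _ _ => h).trans ?_
      refine ((partitionCells hε τ hL.1).measure_not_goodSample_le hD hL.1 hN hξ).trans
        (ENNReal.ofReal_le_ofReal (le_trans ?_ c6))
      have hcard : ((partitionCells hε τ hL.1).cells.card : ℝ) ≤ M := by
        refine le_trans ?_ (hM _ hL.2)
        exact_mod_cast partitionCells_card_le hε τ hL.1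
      gcongr
    · have : {S : Fin N → Example ℝ d K | ¬ GoodFor D hε τ kmax ξ s L S} = ∅ := by
        ext S
        simp only [Set.mem_ofPred_eq, Set.mem_empty_iff_false, iff_false, not_not]
        exact fun h1 h2 => absurd ⟨h1, h2⟩ hL
      rw [this]
      simp
  -- Only an inclusion into a union of bad events is used, so the failure event itself need not be
  -- measurable.
  have hsub : {S : Data d K T N | (2 + kmax) * ε' + (opt D + η) +
      2 * projectionError K kmax ε' e α (opt D + η) + K ^ 2 * (√kmax * ε') + e <
        err D (learned E ε' σ τ S)} ⊆ ⋃ n ∈ Finset.range (T + 1), {S | ¬ GoodFor D hε τ kmax ξ s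
          (basisAfter E ε' σ τ (sampleList S) n) (S (Fin.ofNat (T + 1) n))} := by
    intro S hS
    by_contra hcon
    simp only [Set.mem_iUnion, Finset.mem_range, exists_prop, not_exists, not_and,
      Set.mem_ofPred_eq, not_not] at hcon
    rw [Set.mem_ofPred_eq] at hS
    refine absurd hS (not_lt.mpr ?_)
    exact err_learned_le E hε hε1 hσ hτ hτε hM hD hf hferr S
      (fun n hn hL hk => hcon n (by omega) hL hk) hs hξ hN hα hα1 he hkmax c1 c2 c3 c4 c5
  refine (measure_mono hsub).trans ((measure_biUnion_finset_le _ _).trans ?_)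
  refine (Finset.sum_le_sum fun n hn => measure_not_goodFor_le E D hε hσ τ kmax ξ s hround
    (Nat.lt_succ_iff.mp (Finset.mem_range.mp hn))).trans ?_
  rw [Finset.sum_const, Finset.card_range, nsmul_eq_mul, ← ENNReal.ofReal_natCast,
    ← ENNReal.ofReal_mul (Nat.cast_nonneg _)]
  apply ENNReal.ofReal_le_ofReal
  push_cast
  rw [mul_div_cancel₀ _ (by positivity)]

/-! ### Numerical estimates -/

/-- The crude bound `log x ≤ x - 1` suffices, as only polynomial growth matters. -/
theorem boxNumber_le (k : ℕ) {ε' : ℝ} (hε : 0 < ε') (hε1 : ε' ≤ 1) :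
    (⌈2 * √(2 * Real.log (k / ε')) / ε'⌉₊ : ℝ) ≤ 4 * k * (1 / ε') ^ 2 + 1 := by
  refine (Nat.ceil_lt_add_one (by positivity)).le.trans ?_
  gcongr
  rcases Nat.eq_zero_or_pos k with rfl | hk
  · simp
  · have hk1 : (1 : ℝ) ≤ k := by exact_mod_cast hk
    have h1 : 1 ≤ k / ε' := by rw [le_div_iff₀ hε]; linarith
    have h2 := Real.log_le_sub_one_of_pos (zero_lt_one.trans_le h1)
    have h3 : √(2 * Real.log (k / ε')) ≤ 2 * (k / ε') := by
      rw [Real.sqrt_le_left (by positivity)]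
      nlinarith
    calc 2 * √(2 * Real.log (k / ε')) / ε' ≤ 2 * (2 * (k / ε')) / ε' := by gcongr
      _ = 4 * k * (1 / ε') ^ 2 := by field_simp; ring

theorem half_le_log_two_div {δ : ℝ} (hδ : 0 < δ) (hδ1 : δ < 1) : 1 / 2 ≤ Real.log (2 / δ) := by
  have h1 : Real.log 2 ≤ Real.log (2 / δ) := by
    apply Real.log_le_log (by norm_num)
    rw [le_div_iff₀ hδ]
    linarith
  linarith [Real.log_two_gt_d9]

/-- A form of `z ≤ exp z`, used to absorb the factor `N` of the union bound. -/
theorem mul_exp_neg_div_le {n Y : ℝ} (hY : 0 < Y) : n * Real.exp (-(n / Y)) ≤ Y := by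
  have h := Real.add_one_le_exp (n / Y)
  have h2 : n ≤ Y * Real.exp (n / Y) := by
    have : n = Y * (n / Y) := by field_simp
    nlinarith
  calc n * Real.exp (-(n / Y)) ≤ Y * Real.exp (n / Y) * Real.exp (-(n / Y)) := by gcongr
    _ = Y := by rw [mul_assoc, ← Real.exp_add]; simp

theorem sqrt_two_pow_le (d : ℕ) : √2 ^ d ≤ Real.exp (d / 2) := by
  have h : √2 ≤ Real.exp (1 / 2) := by
    rw [Real.sqrt_le_left (Real.exp_pos _).le, ← Real.exp_nat_mul]
    have := Real.add_one_le_exp (1 : ℝ)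
    norm_num at this ⊢
    linarith
  calc √2 ^ d ≤ Real.exp (1 / 2) ^ d := by gcongr
    _ = Real.exp (d / 2) := by rw [← Real.exp_nat_mul]; congr 1; ring

/-- One part of the exponent gives `exp (-Λ) = δ / 2`, the other absorbs the prefactor through `Q *
exp (-Q) ≤ 1`. -/
theorem exp_neg_le_div {δ Q Λ x : ℝ} (hδ : 0 < δ) (hQ : 0 < Q) (hΛ : Λ = Real.log (2 / δ))
    (hx : Λ + Q ≤ x) : Q * Real.exp (-x) ≤ δ / 2 := by
  have h1 : Real.exp (-x) ≤ Real.exp (-Λ) * Real.exp (-Q) := by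
    rw [← Real.exp_add]
    gcongr
    linarith
  have h2 : Real.exp (-Λ) = δ / 2 := by
    rw [hΛ, Real.exp_neg, Real.exp_log (by positivity), inv_div]
  have h3 : Q * Real.exp (-Q) ≤ 1 := by
    have := mul_exp_neg_div_le (n := Q) one_pos
    simpa using this
  calc Q * Real.exp (-x) ≤ Q * (Real.exp (-Λ) * Real.exp (-Q)) := by gcongr
    _ = δ / 2 * (Q * Real.exp (-Q)) := by rw [h2]; ring
    _ ≤ δ / 2 * 1 := by gcongr
    _ = δ / 2 := mul_one _

set_option maxHeartbeats 1000000 in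
/-- With sufficiently many examples the deviations are unlikely. -/
theorem deviation_bound {d K T N : ℕ} {M G δ ξ s : ℝ} (hT : (10 : ℝ) ^ 6 ≤ T) (hM : 1 ≤ M)
    (hK : 1 ≤ (K : ℝ)) (hKT : (K : ℝ) ≤ T) (hd : 1 ≤ (d : ℝ)) (hδ : 0 < δ) (hδ1 : δ < 1)
    (hG : M ^ 3 * T ^ 33 ≤ G) (hN : d * G * Real.log (2 / δ) ≤ N)
    (hξ : 1 / (100 * M * T ^ 2) ≤ ξ) (hs : N / (M * T ^ 15) ≤ s) :
    M * (K * (2 * Real.exp (-2 * N * ξ ^ 2) + N * (√2 ^ d * Real.exp (-s / 80)))) ≤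
      δ / (T + 1) := by
  set Λ := Real.log (2 / δ) with hΛ
  have hΛ2 := half_le_log_two_div hδ hδ1
  rw [← hΛ] at hΛ2
  have hT1 : (1 : ℝ) ≤ T := le_trans (by norm_num) hT
  have hT0 : (0 : ℝ) < T := by linarith
  have hG0 : 0 < G := lt_of_lt_of_le (by positivity) hG
  have hN0 : (0 : ℝ) < N := lt_of_lt_of_le (by positivity) hN
  have hTp : ∀ m : ℕ, (1 : ℝ) ≤ T ^ m := fun m => one_le_pow₀ hT1
  have hdG : M ^ 3 * T ^ 33 * Λ ≤ N := by
    refine le_trans ?_ hN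
    have : G * Λ ≤ d * G * Λ := by nlinarith [mul_pos hG0 (show 0 < Λ by linarith)]
    refine le_trans ?_ this
    gcongr
  have first : 4 * M * K * (T + 1) * Real.exp (-2 * N * ξ ^ 2) ≤ δ / 2 := by
    have hQ : 4 * M * K * (T + 1) ≤ 8 * M * T ^ 2 := by
      calc 4 * M * K * (T + 1) ≤ 4 * M * T * (T + T) := by gcongr
        _ = 8 * M * T ^ 2 := by ring
    have h1 : Λ + 4 * M * K * (T + 1) ≤ 2 * N * ξ ^ 2 := by
      have h2 : 1 / (100 * M * T ^ 2) ^ 2 ≤ ξ ^ 2 := by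
        rw [← one_div_pow]
        gcongr
      have h3 : M ^ 3 * T ^ 33 * Λ * (1 / (100 * M * T ^ 2) ^ 2) ≤ N * ξ ^ 2 := by gcongr
      have h4 : M ^ 3 * T ^ 33 * Λ * (1 / (100 * M * T ^ 2) ^ 2) =
          (M * T ^ 2) * (Λ * (T ^ 27 / 10 ^ 4)) := by
        field_simp
        ring
      have h5 : (17 : ℝ) ≤ 2 * (T ^ 27 / 10 ^ 4) := by
        have : (T : ℝ) ^ 1 ≤ T ^ 27 := pow_le_pow_right₀ hT1 (by norm_num)
        rw [pow_one] at this
        rw [mul_div_assoc', le_div_iff₀ (by norm_num)]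
        linarith
      have h6 : 1 ≤ M * T ^ 2 := by nlinarith [hTp 2]
      have h7 : Λ * 17 ≤ 2 * (Λ * (T ^ 27 / 10 ^ 4)) := by nlinarith
      have h8 : M * T ^ 2 * (Λ * 17) ≤ M * T ^ 2 * (2 * (Λ * (T ^ 27 / 10 ^ 4))) := by gcongr
      have h9 : Λ ≤ M * T ^ 2 * Λ := le_mul_of_one_le_left (by linarith) h6
      have h10 : M * T ^ 2 * 1 ≤ M * T ^ 2 * (2 * Λ) := by gcongr; linarith
      linarith
    have := exp_neg_le_div hδ (by positivity) hΛ h1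
    rwa [show -(2 * (N : ℝ) * ξ ^ 2) = -2 * N * ξ ^ 2 by ring] at this
  -- The exponent `s / 80` is at least `2 N / Y`. One half absorbs the factor `N`, the other has to
  -- outweigh `√2 ^ d`, the prefactor and `2 / δ`.
  set Y : ℝ := 160 * M * T ^ 15 with hY
  have hY0 : 0 < Y := by positivity
  have hsY : 2 * (N / Y) ≤ s / 80 := by
    rw [le_div_iff₀ (by norm_num)]
    refine le_trans (le_of_eq ?_) hs
    rw [hY]
    field_simp
    norm_num
  have second : 2 * M * K * (T + 1) * (N * (√2 ^ d * Real.exp (-s / 80))) ≤ δ / 2 := by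
    have h1 : Real.exp (-s / 80) ≤ Real.exp (-(N / Y)) * Real.exp (-(N / Y)) := by
      rw [← Real.exp_add, neg_div]
      gcongr
      linarith
    have hQ : 2 * M * K * (T + 1) * Y ≤ 640 * M ^ 2 * T ^ 17 := by
      calc 2 * M * K * (T + 1) * Y ≤ 2 * M * T * (T + T) * Y := by gcongr
        _ = 640 * M ^ 2 * T ^ 17 := by rw [hY]; ring
    have h2 : Λ + 2 * M * K * (T + 1) * Y ≤ N / Y - d / 2 := by
      have h3 : d * Λ * (M ^ 2 * T ^ 17 * (T / 160)) ≤ N / Y := by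
        rw [le_div_iff₀ hY0]
        refine le_trans ?_ hN
        have e1 : d * Λ * (M ^ 2 * T ^ 17 * (T / 160)) * Y = d * (M ^ 3 * T ^ 33) * Λ := by
          rw [hY]; ring
        rw [e1]
        gcongr
      have h4 : (1300 : ℝ) ≤ T / 160 := by
        rw [le_div_iff₀ (by norm_num)]
        linarith
      have h5 : 1 ≤ M ^ 2 * T ^ 17 := by
        have := one_le_pow₀ (n := 2) hM
        nlinarith [hTp 17]
      have h6 : d * Λ * (M ^ 2 * T ^ 17 * 1300) ≤ d * Λ * (M ^ 2 * T ^ 17 * (T / 160)) := by gcongr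
      have h7 : 1 / 2 ≤ d * Λ := by nlinarith
      have h8 : (1 / 2) * (M ^ 2 * T ^ 17) ≤ d * Λ * (M ^ 2 * T ^ 17) := by gcongr
      have h9 : d * Λ * 1 ≤ d * Λ * (M ^ 2 * T ^ 17) := by gcongr
      have h10 : Λ ≤ d * Λ := le_mul_of_one_le_left (by linarith) hd
      have h11 : (d : ℝ) / 2 ≤ d * Λ := by nlinarith
      linarith
    have h3 := exp_neg_le_div hδ (by positivity) hΛ h2
    have h4 : √2 ^ d * Real.exp (-(N / Y)) ≤ Real.exp (-(N / Y - d / 2)) := by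
      refine (mul_le_mul_of_nonneg_right (sqrt_two_pow_le d) (Real.exp_pos _).le).trans
        (le_of_eq ?_)
      rw [← Real.exp_add]
      congr 1
      ring
    calc 2 * M * K * (T + 1) * (N * (√2 ^ d * Real.exp (-s / 80)))
        ≤ 2 * M * K * (T + 1) * (N * (√2 ^ d *
            (Real.exp (-(N / Y)) * Real.exp (-(N / Y))))) := by gcongr
      _ = 2 * M * K * (T + 1) * (N * Real.exp (-(N / Y))) *
            (√2 ^ d * Real.exp (-(N / Y))) := by ring
      _ ≤ 2 * M * K * (T + 1) * Y * Real.exp (-(N / Y - d / 2)) := by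
          gcongr
          exact mul_exp_neg_div_le hY0
      _ ≤ δ / 2 := h3
  rw [le_div_iff₀ (by positivity)]
  linarith

/-- The potential gained in a round, up to a constant. -/
theorem gain_eq {K ε : ℝ} (hK : 0 < K) (hε : 0 < ε) :
    ((ε / (10 ^ 5 * K ^ 2)) ^ 2 * (ε / 50) / (200 * K)) ^ 2 * (ε / 50) / 16 =
      1 / (8 * 10 ^ 30 * K ^ 3 * (K / ε) ^ 7) := by
  field_simp
  norm_num

/-! ### The choice of the parameters -/

section parameters

variable {a b c d K T N : ℕ} {ε δ : ℝ}

theorem one_le_ratio [NeZero K] (hε : 0 < ε) (hε1 : ε < 1) : 1 ≤ K / ε ∧ K ≤ K / ε := by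
  have hK : (1 : ℝ) ≤ K := by exact_mod_cast NeZero.one_le
  have h : (K : ℝ) ≤ K / ε := by
    rw [le_div_iff₀ hε]
    nlinarith
  exact ⟨hK.trans h, h⟩

theorem numRounds_bounds [NeZero K] (hε : 0 < ε) (hε1 : ε < 1) (ha : 1 ≤ a) :
    a * (K / ε) ^ a ≤ numRounds a K ε ∧ numRounds a K ε ≤ 2 * (a * (K / ε) ^ a) := by
  have h1 := one_le_pow₀ (n := a) (one_le_ratio (K := K) hε hε1).1
  have h2 : (1 : ℝ) ≤ a := by exact_mod_cast ha
  have h3 : 1 ≤ a * (K / ε) ^ a := by nlinarith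
  refine ⟨Nat.le_ceil _, (Nat.ceil_lt_add_one (by positivity)).le.trans (by linarith)⟩

theorem le_batchSize : d * 2 ^ (T ^ c) * Real.log (2 / δ) ≤ batchSize c d T δ :=
  Nat.le_ceil _

/-- The total number of examples. -/
theorem sampleSize_le [NeZero K] [NeZero d] {A : ℕ} (hε : 0 < ε) (hε1 : ε < 1) (hδ : 0 < δ)
    (hδ1 : δ < 1) (ha : 2 ≤ a) (hc : 1 ≤ c) (hA : 3 * (2 * a) ^ c ≤ A) (hA' : a * c ≤ A)
    (hT : T = numRounds a K ε) :
    (((T + 1) * batchSize c d T δ : ℕ) : ℝ) ≤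
      d * (2 : ℝ) ^ ((A : ℝ) * ((K : ℝ) / ε) ^ A) * Real.log (2 / δ) := by
  obtain ⟨hρ, -⟩ := one_le_ratio (K := K) hε hε1
  obtain ⟨hT1, hT2⟩ := numRounds_bounds (K := K) hε hε1 (a := a) (by omega)
  rw [← hT] at hT1 hT2
  set ρ : ℝ := K / ε
  have hΛ := half_le_log_two_div hδ hδ1
  set Λ := Real.log (2 / δ) with hΛdef
  have ha2 : (2 : ℝ) ≤ a := by exact_mod_cast ha
  have hTr : (2 : ℝ) ≤ T := by
    have := one_le_pow₀ (n := a) hρ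
    nlinarith
  have hT3 : 2 ≤ T := by exact_mod_cast hTr
  have hd : (1 : ℝ) ≤ d := by exact_mod_cast NeZero.one_le
  have hexp : 3 * (T : ℝ) ^ c ≤ A * ρ ^ A := by
    calc 3 * (T : ℝ) ^ c ≤ 3 * (2 * (a * ρ ^ a)) ^ c := by gcongr
      _ = (3 * (2 * a) ^ c : ℝ) * ρ ^ (a * c) := by rw [pow_mul]; ring
      _ ≤ A * ρ ^ A := by
        gcongr
        exact_mod_cast hA
  have hpow : (2 : ℝ) ^ (3 * T ^ c) ≤ (2 : ℝ) ^ ((A : ℝ) * ρ ^ A) := by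
    rw [← Real.rpow_natCast]
    apply Real.rpow_le_rpow_of_exponent_le (by norm_num)
    exact_mod_cast hexp
  have h2 : (1 : ℝ) ≤ 2 ^ T ^ c := one_le_pow₀ (by norm_num)
  -- The number that is rounded up is at least `1 / 2`, so rounding at most triples it.
  have hN : (batchSize c d T δ : ℝ) ≤ 3 * (d * 2 ^ T ^ c * Λ) := by
    refine (Nat.ceil_lt_add_one (by positivity)).le.trans ?_
    rw [← hΛdef]
    have : 1 ≤ d * (2 : ℝ) ^ T ^ c := by nlinarith
    nlinarith
  have hTc : T ≤ T ^ c := Nat.le_self_pow (by omega) T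
  have h3 : ((T : ℝ) + 1) * 3 ≤ 2 ^ (2 * T ^ c) := by
    have h4 : T + 1 ≤ 2 ^ T := Nat.lt_two_pow_self
    have h5 : (T + 1) * 3 ≤ 2 ^ (2 * T ^ c) := by
      calc (T + 1) * 3 ≤ 2 ^ T * 2 ^ 2 := Nat.mul_le_mul h4 (by norm_num)
        _ = 2 ^ (T + 2) := (pow_add _ _ _).symm
        _ ≤ 2 ^ (2 * T ^ c) := Nat.pow_le_pow_right (by norm_num) (by omega)
    exact_mod_cast h5
  push_cast
  calc ((T : ℝ) + 1) * batchSize c d T δ ≤ (T + 1) * (3 * (d * 2 ^ T ^ c * Λ)) := by gcongr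
    _ = ((T + 1) * 3) * (d * 2 ^ T ^ c * Λ) := by ring
    _ ≤ 2 ^ (2 * T ^ c) * (d * 2 ^ T ^ c * Λ) := by gcongr
    _ = d * 2 ^ (3 * T ^ c) * Λ := by
      rw [show 3 * T ^ c = 2 * T ^ c + T ^ c by ring, pow_add]
      ring
    _ ≤ d * (2 : ℝ) ^ ((A : ℝ) * ρ ^ A) * Λ := by gcongr

/-- The resolution of the partitions is polynomial in the number of rounds. -/
theorem one_div_width_le [NeZero K] {q : ℕ} (hε : 0 < ε) (hε1 : ε < 1) (ha : 10 ^ 32 ≤ a)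
    (hb : b = 300000 * a * a) (hq : q = 300000 * a + 3) (hT : T = numRounds a K ε) :
    1 / invPoly b K ε ≤ T ^ q := by
  obtain ⟨hρ, -⟩ := one_le_ratio (K := K) hε hε1
  obtain ⟨hT1, -⟩ := numRounds_bounds (K := K) hε hε1 (a := a) (by omega)
  rw [← hT] at hT1
  rw [invPoly, one_div_one_div]
  set ρ : ℝ := K / ε
  have ha1 : (10 : ℝ) ^ 32 ≤ a := by exact_mod_cast ha
  have h1 := one_le_pow₀ (n := a) hρ
  have h2 : (a : ℝ) ≤ T := by nlinarith
  have h3 : ρ ^ a ≤ T := by nlinarith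
  have h4 : (300000 : ℝ) ≤ T := by linarith
  have hb' : (b : ℝ) = 300000 * a * a := by rw [hb]; push_cast; ring
  calc b * ρ ^ b = 300000 * a * a * (ρ ^ a) ^ (300000 * a) := by
        rw [hb', ← pow_mul, hb]
        congr 2
        ring
    _ ≤ T * T * T * (T : ℝ) ^ (300000 * a) := by gcongr
    _ = T ^ q := by rw [hq]; ring

/-- The running time in terms of the number of examples. -/
theorem steps_learnFrom_le_pow (E : EigenSolver) [NeZero K] [NeZero d] {q A : ℕ} {ε' σ : ℝ}
    (hδ : 0 < δ) (hδ1 : δ < 1) (hσ : 0 < σ) (hε : 0 < ε') (hε1 : ε' ≤ 1) (hKT : K ≤ T)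
    (hT : 5 ≤ T) (hq : 1 / ε' ≤ T ^ q) (hN : N = batchSize c d T δ)
    (hA : 130 ≤ A) (hA' : 10 * q + 10 ≤ A) (τ : ℝ) (S : Data d K T N) :
    (learnFrom ε' σ τ S).steps E ≤ A * ((T + 1) * N) ^ A := by
  have hΛ := half_le_log_two_div hδ hδ1
  have hd1 : 1 ≤ d := NeZero.one_le
  have hdN : d ≤ N := by
    have h := le_batchSize (c := c) (d := d) (T := T) (δ := δ)
    rw [← hN] at h
    have h2 : (2 : ℝ) ≤ 2 ^ T ^ c :=
      le_self_pow₀ (by norm_num) (by positivity)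
    have h3 : (d : ℝ) ≤ N := by
      calc (d : ℝ) = d * 2 * (1 / 2) := by ring
        _ ≤ d * 2 ^ T ^ c * Real.log (2 / δ) := by gcongr
        _ ≤ N := h
    exact_mod_cast h3
  have hTR : T ≤ (T + 1) * N := by nlinarith
  have hNR : N ≤ (T + 1) * N := Nat.le_mul_of_pos_left N (by omega)
  set R := (T + 1) * N
  -- The power `R ^ (2 q + 2)` bounds all sizes in the program, including the number of intervals
  -- per axis. Its fifth power has exponent `10 q + 10`.
  have hRX : R ≤ R ^ (2 * q + 2) := Nat.le_self_pow (by omega) R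
  refine (steps_learnFrom_le E (X := R ^ (2 * q + 2)) hε hσ τ (by omega) (by omega) (by omega)
    (by omega) (by omega) (fun k hk => ?_) S).trans ?_
  · have h1 : (⌈2 * √(2 * Real.log (k / ε')) / ε'⌉₊ : ℝ) ≤ (R ^ (2 * q + 2) : ℕ) := by
      refine (boxNumber_le k hε hε1).trans ?_
      have hR1 : (1 : ℝ) ≤ R := by exact_mod_cast (by omega : 1 ≤ R)
      have hk' : (k : ℝ) ≤ R := by exact_mod_cast (by omega : k ≤ R)
      have hT' : (T : ℝ) ≤ R := by exact_mod_cast hTR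
      have h5 : (5 : ℝ) ≤ R := by exact_mod_cast (by omega : 5 ≤ R)
      have h6 : (1 : ℝ) ≤ R * (R ^ q) ^ 2 := one_le_mul_of_one_le_of_one_le hR1
        (one_le_pow₀ (one_le_pow₀ hR1))
      have h7 : 1 / ε' ≤ R ^ q := hq.trans (by gcongr)
      push_cast
      calc 4 * (k : ℝ) * (1 / ε') ^ 2 + 1 ≤ 4 * (R : ℝ) * (R ^ q) ^ 2 + R * (R ^ q) ^ 2 := by gcongr
        _ = 5 * ((R : ℝ) * (R ^ q) ^ 2) := by ring
        _ ≤ (R : ℝ) * (R * (R ^ q) ^ 2) := by gcongr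
        _ = (R : ℝ) ^ (2 * q + 2) := by ring
    exact_mod_cast h1
  · rw [← pow_mul]
    exact Nat.mul_le_mul hA (Nat.pow_le_pow_right (by omega) (by omega))

set_option maxHeartbeats 2000000 in
/-- The learner succeeds with the prescribed probability. -/
theorem measure_failure_le (E : EigenSolver) [NeZero K] [NeZero d] {q m : ℕ} {ε' σ τ : ℝ}
    (D : Measure ((Fin d → ℝ) × Fin K)) [IsProbabilityMeasure D]
    (hD : D.map Prod.fst = stdNormal d) (hε : 0 < ε) (hε1 : ε < 1) (hδ : 0 < δ) (hδ1 : δ < 1)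
    (ha : 10 ^ 32 ≤ a) (hb : b = 300000 * a * a) (hq : q = 300000 * a + 3) (hm : m = 2 * q + 5)
    (hc : c = 5 + (3 * m + 33)) (hT : T = numRounds a K ε) (hN : N = batchSize c d T δ)
    (hε' : ε' = invPoly b K ε) (hσ : σ = invPoly a K ε) (hτ : 0 < τ) (hτε : τ < ε') :
    dataLaw D T N {S | 3203 * opt D + ε < err D (learned E ε' σ τ S)} ≤ ENNReal.ofReal δ := by
  have hw := one_div_width_le (K := K) hε hε1 ha hb hq hT
  rw [← hε'] at hw
  obtain ⟨hρ, hKρ⟩ := one_le_ratio (K := K) hε hε1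
  obtain ⟨hT1, hT2⟩ := numRounds_bounds (K := K) hε hε1 (a := a) (by omega)
  rw [← hT] at hT1 hT2
  have hNle := le_batchSize (c := c) (d := d) (T := T) (δ := δ)
  rw [← hN] at hNle
  have hd1 : (1 : ℝ) ≤ d := by exact_mod_cast NeZero.one_le
  have hK1 : (1 : ℝ) ≤ K := by exact_mod_cast NeZero.one_le
  have hK0 : (0 : ℝ) < K := by linarith
  have ha1 : (10 : ℝ) ^ 32 ≤ a := by exact_mod_cast ha
  have ha0 : (0 : ℝ) < a := by linarith
  have hgain := gain_eq hK0 hε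
  rw [invPoly] at hε' hσ
  have hερ : 1 ≤ ε * (K / ε) := by field_simp; exact hK1
  set ρ : ℝ := K / ε with hρdef
  have hρ0 : 0 < ρ := by linarith
  have h1 := one_le_pow₀ (n := a) hρ
  have haT : (a : ℝ) ≤ T := (le_mul_of_one_le_right ha0.le h1).trans hT1
  have hρT : ρ ^ a ≤ T := (le_mul_of_one_le_left (by positivity) (by linarith)).trans hT1
  have hρT1 : ρ ≤ T := (le_self_pow₀ hρ (by omega)).trans hρT
  have hKT : (K : ℝ) ≤ T := hKρ.trans hρT1
  have hT32 : (10 : ℝ) ^ 32 ≤ T := ha1.trans haT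
  have hT1' : (1 : ℝ) ≤ T := by linarith
  have hΛ := half_le_log_two_div hδ hδ1
  have hσ0 : 0 < σ := by rw [hσ]; positivity
  have hb1 : (b : ℝ) = 300000 * a * a := by rw [hb]; push_cast; ring
  have hb0 : (0 : ℝ) < b := by rw [hb1]; positivity
  have hε0 : 0 < ε' := by rw [hε']; positivity
  have hε'1 : ε' < 1 := by
    rw [hε', div_lt_one (by positivity)]
    have := one_le_pow₀ (n := b) hρ
    have hb2 : 1 < (b : ℝ) := by
      rw [hb1]
      exact lt_of_lt_of_le (by linarith) (le_mul_of_one_le_right (by linarith)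
        (show (1 : ℝ) ≤ a by linarith))
    exact one_lt_mul_of_lt_of_le hb2 this
  -- the dimension of the subspaces
  obtain ⟨kmax, hkmax⟩ : ∃ k : ℕ, k = ⌈3 * T * K * (a * ρ ^ a)⌉₊ := ⟨_, rfl⟩
  have hx1 : 1 ≤ T * K * (a * ρ ^ a) := by
    have : 1 ≤ a * ρ ^ a := one_le_mul_of_one_le_of_one_le (by linarith) h1
    exact one_le_mul_of_one_le_of_one_le (one_le_mul_of_one_le_of_one_le hT1' hK1) this
  have hk1 : 3 * T * K * (a * ρ ^ a) ≤ kmax := by rw [hkmax]; exact Nat.le_ceil _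
  have hk2 : kmax ≤ 4 * T * K * (a * ρ ^ a) := by
    rw [hkmax]
    refine (Nat.ceil_lt_add_one (by positivity)).le.trans ?_
    linarith
  have hkone : (1 : ℝ) ≤ kmax := by linarith
  have hkT : (kmax : ℝ) ≤ T ^ 4 := by
    calc (kmax : ℝ) ≤ 4 * T * K * (a * ρ ^ a) := hk2
      _ ≤ T * T * T * T := by gcongr; linarith
      _ = T ^ 4 := by ring
  have hkρ : (kmax : ℝ) ≤ 8 * a ^ 2 * ρ ^ (2 * a + 1) := by
    calc (kmax : ℝ) ≤ 4 * T * K * (a * ρ ^ a) := hk2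
      _ ≤ 4 * (2 * (a * ρ ^ a)) * ρ * (a * ρ ^ a) := by gcongr
      _ = 8 * a ^ 2 * ρ ^ (2 * a + 1) := by ring
  -- This determines `b`: since `1 / ε ≤ ρ` and `K ≤ ρ`, the quantity `kmax * K ^ 2 / ε` is at most
  -- `8 a ^ 2 ρ ^ (2 a + 4)`, and `1 / ε'` has to exceed that by a large constant factor.
  have hkε : (kmax : ℝ) * ε' * K ^ 2 ≤ 8 / 300000 * ε := by
    have e1 : ε' * (300000 * a * a * ρ ^ (2 * a + 4)) ≤ 1 := by
      rw [hε', hb1, one_div, inv_mul_le_iff₀ (by positivity), mul_one]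
      gcongr
      rw [hb]
      nlinarith
    calc (kmax : ℝ) * ε' * K ^ 2 = kmax * ε' * K ^ 2 * 1 := by ring
      _ ≤ 8 * a ^ 2 * ρ ^ (2 * a + 1) * ε' * ρ ^ 2 * (ε * ρ) := by gcongr
      _ = 8 / 300000 * ε * (ε' * (300000 * a * a * ρ ^ (2 * a + 4))) := by ring
      _ ≤ 8 / 300000 * ε * 1 := by gcongr
      _ = 8 / 300000 * ε := by ring
  -- the number of cells
  obtain ⟨M, hM⟩ : ∃ M : ℝ, M = 2 ^ (m * T ^ 5) := ⟨_, rfl⟩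
  have hM1 : 1 ≤ M := hM ▸ one_le_pow₀ (by norm_num)
  have hM0 : 0 < M := by linarith
  have hTtwo : (T : ℝ) ≤ 2 ^ T := by exact_mod_cast Nat.lt_two_pow_self.le
  have hcells : ∀ k ≤ kmax, (⌈2 * √(2 * Real.log (k / ε')) / ε'⌉₊ ^ k : ℝ) ≤ M := by
    intro k hk
    have hk' : (k : ℝ) ≤ T ^ 4 := le_trans (by exact_mod_cast hk) hkT
    have hk4 : k ≤ T ^ 4 := by exact_mod_cast hk'
    -- The exponent `m = 2 q + 5` collects `2 q` from `1 / ε'` squared, `4` from the dimension and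
    -- `1` for the constant factor `5`.
    have h2 : (⌈2 * √(2 * Real.log (k / ε')) / ε'⌉₊ : ℝ) ≤ T ^ m := by
      refine (boxNumber_le k hε0 hε'1.le).trans ?_
      have h6 : (1 : ℝ) ≤ T ^ 4 * (T ^ q) ^ 2 := one_le_mul_of_one_le_of_one_le
        (one_le_pow₀ hT1') (one_le_pow₀ (one_le_pow₀ hT1'))
      calc 4 * (k : ℝ) * (1 / ε') ^ 2 + 1
          ≤ 4 * (T : ℝ) ^ 4 * (T ^ q) ^ 2 + T ^ 4 * (T ^ q) ^ 2 := by gcongr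
        _ = 5 * ((T : ℝ) ^ 4 * (T ^ q) ^ 2) := by ring
        _ ≤ (T : ℝ) * (T ^ 4 * (T ^ q) ^ 2) := by gcongr; linarith
        _ = (T : ℝ) ^ m := by rw [hm]; ring
    calc (⌈2 * √(2 * Real.log (k / ε')) / ε'⌉₊ ^ k : ℝ) ≤ (T ^ m) ^ k := by gcongr
      _ ≤ (T ^ m) ^ T ^ 4 := pow_le_pow_right₀ (one_le_pow₀ hT1') hk4
      _ = T ^ (m * T ^ 4) := (pow_mul _ _ _).symm
      _ ≤ (2 ^ T) ^ (m * T ^ 4) := by gcongr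
      _ = M := by rw [hM, ← pow_mul]; congr 1; ring
  -- This determines `c`: the binary exponent of the left side is at most `T ^ 5 * (3 m + 33)`, and
  -- `3 m + 33 ≤ T ^ (3 m + 33)`.
  have hG : M ^ 3 * T ^ 33 ≤ (2 : ℝ) ^ T ^ c := by
    have hT2n : 2 ≤ T := by exact_mod_cast (by linarith : (2 : ℝ) ≤ T)
    have hTT : T ≤ T ^ 5 := Nat.le_self_pow (by norm_num) T
    have hexp : m * T ^ 5 * 3 + T * 33 ≤ T ^ c := by
      calc m * T ^ 5 * 3 + T * 33 ≤ m * T ^ 5 * 3 + T ^ 5 * 33 := by gcongr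
        _ = T ^ 5 * (3 * m + 33) := by ring
        _ ≤ T ^ 5 * T ^ (3 * m + 33) := by
          gcongr
          exact Nat.lt_two_pow_self.le.trans (Nat.pow_le_pow_left hT2n _)
        _ = T ^ c := by rw [hc, pow_add T 5]
    calc M ^ 3 * (T : ℝ) ^ 33 ≤ M ^ 3 * (2 ^ T) ^ 33 := by gcongr
      _ = 2 ^ (m * T ^ 5 * 3 + T * 33) := by rw [hM, ← pow_mul, ← pow_mul, ← pow_add]
      _ ≤ 2 ^ T ^ c := pow_le_pow_right₀ (by norm_num) hexp
  have hN0 : (0 : ℝ) < N := lt_of_lt_of_le (by positivity) hNle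
  -- the gain in each round
  obtain ⟨g, hg⟩ : ∃ g : ℝ, g = 1 / (8 * 10 ^ 30 * K ^ 3 * ρ ^ 7) := ⟨_, rfl⟩
  have hg0 : 0 < g := by rw [hg]; positivity
  -- Serves both the threshold (`σ K ^ 2 ≤ g`) and the number of rounds (`3 K ^ 3 < T g`): `a ≥ 10 ^
  -- 32` beats the constants in `1 / g`, and `ρ ^ a` beats the powers of `K` and `ρ`.
  have hgK : ∀ n ≤ 12, ∀ x : ℝ, 0 ≤ x → x * 8 ≤ 100 → ∀ y, a * ρ ^ a ≤ y →
      x * K ^ n ≤ y * g := by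
    intro n hn x hx0 hx y hy
    rw [hg, mul_one_div, le_div_iff₀ (by positivity)]
    calc x * K ^ n * (8 * 10 ^ 30 * K ^ 3 * ρ ^ 7)
        ≤ x * ρ ^ n * (8 * 10 ^ 30 * ρ ^ 3 * ρ ^ 7) := by gcongr
      _ = (x * 8) * 10 ^ 30 * ρ ^ (n + 10) := by ring
      _ ≤ 100 * 10 ^ 30 * ρ ^ a := by gcongr; omega
      _ ≤ a * ρ ^ a := by gcongr; linarith
      _ ≤ y := hy
  have hg1 : g ≤ 1 / 2 := by
    rw [hg]
    apply one_div_le_one_div_of_le (by norm_num)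
    calc (2 : ℝ) ≤ 8 * 10 ^ 30 * 1 * 1 := by norm_num
      _ ≤ 8 * 10 ^ 30 * K ^ 3 * ρ ^ 7 := by gcongr; exacts [one_le_pow₀ hK1, one_le_pow₀ hρ]
  have hopt : 0 ≤ opt D :=
    Real.sInf_nonneg (by rintro - ⟨f, -, rfl⟩; exact measureReal_nonneg)
  set α := ε / (10 ^ 5 * K ^ 2) with hα
  set e := ε / 50 with he
  have hgain2 : (α ^ 2 * e / (200 * K)) ^ 2 * e / 8 = 2 * g := by
    rw [hg, ← hgain]
    ring
  rw [← hg] at hgain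
  have hα0 : 0 < α := by positivity
  have hK2 : (1 : ℝ) ≤ K ^ 2 := one_le_pow₀ hK1
  have hα1 : α ≤ 1 := by
    rw [hα, div_le_one (by positivity)]
    linarith
  have hcσ : a * ρ ^ a * σ = 1 := by rw [hσ]; field_simp
  -- The accuracy `ξ` is the largest that `c2` permits. The slack `ε / 32030`, multiplied by the
  -- final constant `3203`, amounts to `ε / 10`.
  refine (measure_mono fun S hS => ?_).trans (measure_err_learned_le E D hD (kmax := kmax) (M := M)
    (ξ := e / (2 * M * K)) (s := N * g / (M * K)) (e := e) (α := α) (η := ε / 32030)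
    hε0 hε'1 hσ0 hτ hτε hcells (by positivity) (by positivity) (by positivity)
    (by exact_mod_cast hN0) hα0 hα1 (by positivity) ?_ ?_ ?_ ?_ ?_ ?_ ?_)
  · rw [Set.mem_ofPred_eq] at hS ⊢
    refine lt_of_le_of_lt ?_ hS
    have hsq : √(kmax : ℝ) ≤ kmax := by
      rw [Real.sqrt_le_left (by positivity)]
      exact le_self_pow₀ hkone two_ne_zero
    have e1 : K ^ 2 * (√(kmax : ℝ) * ε') ≤ 8 / 300000 * ε := by
      refine le_trans ?_ hkε
      rw [mul_comm, mul_assoc, mul_assoc]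
      gcongr
    have e2 : (2 + kmax) * ε' ≤ 3 * (8 / 300000 * ε) := by
      have : kmax * ε' * 1 ≤ kmax * ε' * K ^ 2 := by gcongr
      have h2 : 1 * ε' ≤ kmax * ε' := by gcongr
      linarith
    have e3 : K ^ 2 * α = ε / 10 ^ 5 := by rw [hα]; field_simp
    -- `OPT` enters once through `f` and `2 * 1601` times through the noise in the projection error,
    -- in total `3203` times. All remaining terms together stay below `ε`.
    rw [projectionError]
    linarith
  · have : (T : ℝ) * (3 * K) = 3 * T * K * (a * ρ ^ a) * σ := by
      rw [mul_assoc (3 * (T : ℝ) * K), hcσ]; ring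
    rw [this]
    gcongr
  · rw [show M * K * (N * g / (M * K)) = N * g by field_simp, div_eq_mul_one_div]
    gcongr
  · rw [show M * K * (e / (2 * M * K)) = e / 2 by field_simp]
  · rw [show M * (N * g / (M * K)) = N * (g / K) by field_simp, hgain2]
    gcongr
    exact (div_le_self hg0.le hK1).trans (by linarith)
  · rw [hgain]
    have := hgK 2 (by norm_num) 1 (by norm_num) (by norm_num) _ le_rfl
    calc σ * K ^ 2 = σ * (1 * K ^ 2) := by ring
      _ ≤ σ * (a * ρ ^ a * g) := by gcongr
      _ = a * ρ ^ a * σ * g := by ring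
      _ = g := by rw [hcσ, one_mul]
  · rw [hgain]
    have := hgK 3 (by norm_num) 4 (by norm_num) (by norm_num) _ hT1
    have h3 : (0 : ℝ) < K ^ 3 := by positivity
    linarith [show 3 * (K : ℝ) * K ^ 2 = 3 * K ^ 3 by ring]
  · refine deviation_bound (by linarith) hM1 hK1 hKT hd1 hδ hδ1 hG hNle ?_ ?_
    · have : e / (2 * M * K) = 1 / (100 * M * ρ) := by
        rw [hρdef, he]
        field_simp
        norm_num
      rw [this]
      gcongr
      exact hρT1.trans (le_self_pow₀ hT1' (by norm_num))
    · rw [hg, mul_one_div, div_div]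
      refine div_le_div_of_nonneg_left hN0.le (by positivity) ?_
      calc 8 * 10 ^ 30 * (K : ℝ) ^ 3 * ρ ^ 7 * (M * K)
          = M * (8 * 10 ^ 30 * (K ^ 4 * ρ ^ 7)) := by ring
        _ ≤ M * (T * (T ^ 4 * T ^ 7)) := by gcongr; linarith
        _ = M * T ^ 12 := by ring
        _ ≤ M * T ^ 15 := by gcongr; norm_num

end parameters

end MulticlassLearning

/-! ### The theorem -/

open MulticlassLearning in
theorem theorem2p1 :
    ∃ C : ℝ, 0 < C ∧ ∃ a b s c A : ℕ, 0 < a ∧ 0 < b ∧ 0 < s ∧ 0 < c ∧ 0 < A ∧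
      ∀ (d K T N : ℕ) [NeZero d] [NeZero K] (ε δ ε' σ τ : ℝ) (E : EigenSolver)
        (D : Measure ((Fin d → ℝ) × Fin K)) [IsProbabilityMeasure D],
        D.map Prod.fst = stdNormal d →
        0 < ε → ε < 1 → 0 < δ → δ < 1 →
        T = numRounds a K ε → N = batchSize c d T δ →
        ε' = invPoly b K ε → σ = invPoly s K ε → 0 < τ → τ < ε' / 2 →
        (((T + 1) * N : ℕ) : ℝ) ≤
            d * (2 : ℝ) ^ ((A : ℝ) * ((K : ℝ) / ε) ^ A) * Real.log (2 / δ) ∧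
          (∀ S : Data d K T N,
            (learnFrom ε' σ τ S).steps E ≤ A * ((T + 1) * N) ^ A) ∧
          dataLaw D T N {S | C * opt D + ε < err D (learned E ε' σ τ S)} ≤
            ENNReal.ofReal δ := by
  -- Only the lower bound on `a` matters. In terms of powers of `T`, `q` measures `1 / ε'`, `m` the
  -- number of intervals per axis, and `c` the logarithm of the number of cells.
  obtain ⟨a, ha⟩ : ∃ a : ℕ, 10 ^ 32 ≤ a := ⟨_, le_rfl⟩
  obtain ⟨b, hb⟩ : ∃ b : ℕ, b = 300000 * a * a := ⟨_, rfl⟩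
  obtain ⟨q, hq⟩ : ∃ q : ℕ, q = 300000 * a + 3 := ⟨_, rfl⟩
  obtain ⟨m, hm⟩ : ∃ m : ℕ, m = 2 * q + 5 := ⟨_, rfl⟩
  obtain ⟨c, hc⟩ : ∃ c : ℕ, c = 5 + (3 * m + 33) := ⟨_, rfl⟩
  obtain ⟨A, hA⟩ : ∃ A : ℕ, A = 3 * (2 * a) ^ c + a * c + 130 + (10 * q + 10) := ⟨_, rfl⟩
  have hb0 : 0 < b := by rw [hb]; positivity
  -- The threshold is the inverse of the polynomial that gives the number of rounds, so `s = a`.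
  refine ⟨3203, by norm_num, a, b, a, c, A, by omega, hb0, by omega, by omega, by omega, ?_⟩
  intro d K T N _ _ ε δ ε' σ τ E D _ hD hε hε1 hδ hδ1 hT hN hε' hσ hτ hτε
  obtain ⟨hρ, hKρ⟩ := one_le_ratio (K := K) hε hε1
  obtain ⟨hT1, -⟩ := numRounds_bounds (K := K) hε hε1 (a := a) (by omega)
  rw [← hT] at hT1
  have ha1 : (10 : ℝ) ^ 32 ≤ a := by exact_mod_cast ha
  have ha0 : (0 : ℝ) < a := by linarith
  have hσ0 : 0 < σ := by rw [hσ, invPoly]; positivity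
  have hb1 : (1 : ℝ) ≤ b := by exact_mod_cast hb0
  have hε0 : 0 < ε' := by rw [hε', invPoly]; positivity
  have hε'1 : ε' ≤ 1 := by
    rw [hε', invPoly, div_le_one (by positivity)]
    exact one_le_mul_of_one_le_of_one_le hb1 (one_le_pow₀ hρ)
  have h1 := one_le_pow₀ (n := a) hρ
  have hKT : K ≤ T := by
    have : (K : ℝ) ≤ T := (hKρ.trans (le_self_pow₀ hρ (by omega))).trans
      ((le_mul_of_one_le_left (by positivity) (by linarith)).trans hT1)
    exact_mod_cast this
  have hT5 : 5 ≤ T := by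
    have : (5 : ℝ) ≤ T := le_trans (by linarith) ((le_mul_of_one_le_right ha0.le h1).trans hT1)
    exact_mod_cast this
  refine ⟨?_, fun S => ?_, ?_⟩
  · rw [hN]
    exact sampleSize_le hε hε1 hδ hδ1 (by omega) (by omega) (by omega) (by omega) hT
  · have hw := one_div_width_le (K := K) hε hε1 ha hb hq hT
    rw [← hε'] at hw
    exact steps_learnFrom_le_pow E hδ hδ1 hσ0 hε0 hε'1 hKT hT5 hw hN (by omega) (by omega) τ S
  · exact measure_failure_le E D hD hε hε1 hδ hδ1 ha hb hq hm hc hT hN hε' hσ hτ (by linarith)
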